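/- Let $d\ge 1$, $T>0$ and $\sigma\in(1,2)$. For a nonnegative Borel measure $\mu$ on $\mathbb R^d$ put $$\mathcal L\varphi(x)=\int_{\mathbb R^d}\big(\varphi(x+z)-\varphi(x)-D\varphi(x)\cdot z\,1_{|z|<1}\big)\,d\mu(z),\qquad \hat{\mathcal L}(\xi)=\int_{\mathbb R^d}\big(e^{iz\cdot\xi}-1-i\xi\cdot z\,1_{|z|<1}\big)\,d\mu(z),$$ and let $K(t,\cdot)=\mathcal F^{-1}(e^{t\hat{\mathcal L}})$, i.e. $K(t,x)=(2\pi)^{-d}\int e^{ix\cdot\xi}e^{t\hat{\mathcal L}(\xi)}d\xi$, be the heat kernel of $\mathcal L$. Let $K^*$ be the heat kernel obtained in the same way from $\mu^*(B)=\mu(-B)$. Consider $$\partial_t u-\mathcal L u+H(x,u,Du)=f(t,x)\ \text{ in }(0,T)\times\mathbb R^d,\qquad u(0,x)=u_0(x)\ \text{ in }\mathbb R^d. \tag{1}$$ Assume: - (L1) $\int 1\wedge|z|^2\,d\mu(z)\le C_\mu$. - (L2) (i) $r^\sigma\int_{|z|<1}\frac{|z|^2}{r^2}\wedge1\,d\mu(z)\le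 c$ for all $r\in(0,1)$. (ii) For $t\in(0,T)$, the kernels $k=K,K^*$ are smooth in $x$, nonnegative, satisfy $\|k(t,\cdot)\|_{L^1}=1$, and $\|D^{n}k(t,\cdot)\|_{L^p}\le\kappa_{n,p}\,t^{-\frac1\sigma(n+(1-\frac1p)d)}$ for all integers $n\ge0$ and all $p\in[1,\infty)$, where $D^n$ is the tensor of all partial derivatives of order $n$ in $x$. - (A3) $H\in C^3(\mathbb R^d\times\mathbb R\times\mathbb R^d)$, and for each $R>0$ the derivatives of $H$ of order at most $3$ are bounded by $C_R$ on $\mathbb R^d\times[-R,R]\times B_R$. - (A4) For each $R>0$, $|H(x,u,p)-H(y,u,p)|\le C'_R(|p|+1)|x-y|$ for $x,y,p\in\mathbb R^d$ and $|u|\le R$. - (A5) There is $\gamma\in\mathbb R$ with $H(x,v,p)-H(x,u,p)\ge\gamma(v-u)$ for all $x,p\in\mathbb R^d$ and $u\le v$. - (B1)–(B4) $f$ is continuous on $[0,T]\times\mathbb R^d$ and $u_0$ is continuous; $|f(t,x)-f(t,y)|+|u_0(x)-u_0(y)|\le L|x-y|$ for $t\in[0,T]$; $f(t,\cdot)\in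 C_b^2(\mathbb R^d)$ for every $t\in[0,T]$ with derivatives of order $\le2$ bounded by $C_f$; $u_0\in C_b^3(\mathbb R^d)$ with derivatives of order $\le3$ bounded by $C_{u}$. - (B5) There is a modulus of continuity $\omega_f$ with $|f(s,x)-f(t,y)|\le\omega_f(|s-t|+|x-y|)$ for all $s,t\in[0,T]$, $x,y\in\mathbb R^d$. Here a modulus of continuity is a nondecreasing function on $[0,\infty)$ that vanishes at $0$ and is continuous at $0$. A classical solution of (1) is a function $u\in C([0,T]\times\mathbb R^d)$ for which $\partial_tu,Du,D^2u,\mathcal Lu$ exist and are continuous on $(0,T)\times\mathbb R^d$ and which satisfies (1) at every point. Then (1) has a bounded classical solution $u$, unique among bounded classical solutions, with $\partial_tu,u,Du,D^2u,D^3u\in C_b((0,T)\times\mathbb R^d)$, and there is a modulus of continuity $\omega$ such that for all $t,s\in(0,T)$ and $x,y\in\mathbb R^d$, $$|u(t,x)-u(s,y)|+|Du(t,x)-Du(s,y)|+|D^2u(t,x)-D^2u(s,y)|+|\partial_tu(t,x)-\partial_tu(s,y)|+|\mathcal Lu(t,x)-\mathcal Lu(s,y)|\le\omega(|t-s|+|x-y|).$$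 The modulus $\omega$ depends only on $\sigma$, $T$, $d$ and the quantities $C_\mu$, $c$, $(\kappa_{n,p})$, $(C_R)$, $(C'_R)$, $\gamma$, $L$, $C_f$, $C_u$, $\omega_f$ in the assumptions; it is the same for all $\mu,H,f,u_0$ that satisfy the assumptions with these quantities. -/

import Mathlib

open Set Filter Topology MeasureTheory FourierTransform

noncomputable section

namespace FracHJB

/-- The Euclidean space `ℝ^d`. -/
abbrev Rd (d : ℕ) := EuclideanSpace ℝ (Fin d)

variable {d : ℕ}

/-! ### The nonlocal operator and its heat kernel -/

/-- The Lévy operator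
`L φ (x) = ∫ (φ (x + z) - φ x - Dφ x · z 1_{|z| < 1}) dμ(z)`.
The integrand is `μ`-integrable when `φ` is bounded and `C²` and `∫ 1 ∧ |z|² dμ < ∞`. -/
def levyOp (μ : Measure (Rd d)) (φ : Rd d → ℝ) (x : Rd d) : ℝ :=
  ∫ z, (φ (x + z) - φ x
    - (Metric.ball (0 : Rd d) 1).indicator (fun w => inner ℝ (gradient φ x) w) z) ∂μ

/-- The Fourier multiplier of the Lévy operator,
`ξ ↦ ∫ (exp(i z·ξ) - 1 - i ξ·z 1_{|z| < 1}) dμ(z)`. -/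
def levySymbol (μ : Measure (Rd d)) (ξ : Rd d) : ℂ :=
  ∫ z, (Complex.exp (Complex.I * ((inner ℝ z ξ : ℝ) : ℂ)) - 1
    - (Metric.ball (0 : Rd d) 1).indicator
        (fun w => Complex.I * ((inner ℝ ξ w : ℝ) : ℂ)) z) ∂μ

/-- The heat kernel `K(t, x) = (2π)^{-d} ∫ exp(i x·ξ) exp(t m(ξ)) dξ`, where `m` is the multiplier
of the Lévy operator. Mathlib's inverse Fourier transform uses the character
`exp(2πi x·η)`, hence the substitution `ξ = 2πη`. The value is real, because `m(-ξ)` is the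
complex conjugate of `m(ξ)`. (If `exp(t m)` is not integrable the formula returns `0`; this is
excluded wherever `K(t, ·)` is required to have `L¹` norm one.) -/
def heatKernel (μ : Measure (Rd d)) (t : ℝ) (x : Rd d) : ℝ :=
  (𝓕⁻ (fun η : Rd d => Complex.exp ((t : ℂ) * levySymbol μ ((2 * Real.pi) • η))) x).re

/-- The antipodal measure `μ*(B) = μ(-B)`, the Lévy measure of the adjoint operator. -/
def antipodal (μ : Measure (Rd d)) : Measure (Rd d) := μ.map (fun z => -z)

/-! ### Assumptions on the Lévy measure -/

/-- The Lévy condition `∫ 1 ∧ |z|² dμ ≤ C`. -/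
def LevyCondition (μ : Measure (Rd d)) (C : ℝ) : Prop :=
  ∫⁻ z, min 1 (ENNReal.ofReal (‖z‖ ^ 2)) ∂μ ≤ ENNReal.ofReal C

/-- The bound `r^σ ∫_{|z| < 1} (|z|² / r²) ∧ 1 dμ ≤ c` for all `r ∈ (0, 1)`. -/
def OrderUpperBound (μ : Measure (Rd d)) (σ c : ℝ) : Prop :=
  ∀ r ∈ Ioo (0 : ℝ) 1,
    ENNReal.ofReal (r ^ σ) *
      ∫⁻ z in Metric.ball (0 : Rd d) 1, min (ENNReal.ofReal (‖z‖ ^ 2 / r ^ 2)) 1 ∂μ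
      ≤ ENNReal.ofReal c

/-- For `t ∈ (0, T)` the kernel `K(t, ·)` is smooth and nonnegative, has `L¹` norm one, and
`‖D^n K(t, ·)‖_{L^p} ≤ κ n p * t^{-(n + (1 - 1/p) d)/σ}` for every order `n` and every
`p ∈ [1, ∞)`. Here `D^n K` is the tensor of all partial derivatives of order `n`. -/
structure KernelBounds (K : ℝ → Rd d → ℝ) (σ T : ℝ) (κ : ℕ → ℝ → ℝ) : Prop where
  smooth : ∀ t ∈ Ioo 0 T, ContDiff ℝ (⊤ : ℕ∞) (K t)
  nonneg : ∀ t ∈ Ioo 0 T, ∀ x, 0 ≤ K t x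
  mass : ∀ t ∈ Ioo 0 T, eLpNorm (K t) 1 volume = 1
  bound : ∀ t ∈ Ioo 0 T, ∀ n : ℕ, ∀ p : ℝ, 1 ≤ p →
    eLpNorm (fun x => iteratedFDeriv ℝ n (K t) x) (ENNReal.ofReal p) volume
      ≤ ENNReal.ofReal (κ n p * t ^ (-(1 / σ) * ((n : ℝ) + (1 - 1 / p) * (d : ℝ))))

/-- Nondegeneracy of order `σ`: the upper bound on the Lévy measure near the origin, and the
kernel bounds for the heat kernels of the operator and of its adjoint. -/
structure Nondegenerate (μ : Measure (Rd d)) (σ T c : ℝ) (κ : ℕ → ℝ → ℝ) : Prop where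
  upper : OrderUpperBound μ σ c
  kernel : KernelBounds (heatKernel μ) σ T κ
  kernel_adjoint : KernelBounds (heatKernel (antipodal μ)) σ T κ

/-! ### Assumptions on the Hamiltonian `H(x, u, p)` -/

/-- `H` is `C³`, and its derivatives of order at most three are bounded by `C R` for
`x ∈ ℝ^d`, `u ∈ [-R, R]`, `p ∈ B_R`. -/
def HamiltonianBounds (H : Rd d → ℝ → Rd d → ℝ) (C : ℝ → ℝ) : Prop :=
  ContDiff ℝ 3 (fun q : Rd d × ℝ × Rd d => H q.1 q.2.1 q.2.2) ∧
  ∀ R > 0, ∀ x : Rd d, ∀ u ∈ Icc (-R) R, ∀ p ∈ Metric.ball (0 : Rd d) R, ∀ k ≤ 3,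
    ‖iteratedFDeriv ℝ k (fun q : Rd d × ℝ × Rd d => H q.1 q.2.1 q.2.2) (x, u, p)‖ ≤ C R

/-- `|H(x,u,p) - H(y,u,p)| ≤ C_R (|p| + 1) |x - y|` for `u ∈ [-R, R]` and all `p`. -/
def HamiltonianLipschitz (H : Rd d → ℝ → Rd d → ℝ) (C : ℝ → ℝ) : Prop :=
  ∀ R > 0, ∀ x y : Rd d, ∀ u ∈ Icc (-R) R, ∀ p : Rd d,
    |H x u p - H y u p| ≤ C R * (‖p‖ + 1) * ‖x - y‖

/-- `H(x,v,p) - H(x,u,p) ≥ γ (v - u)` for `u ≤ v`. -/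
def HamiltonianMonotone (H : Rd d → ℝ → Rd d → ℝ) (γ : ℝ) : Prop :=
  ∀ x : Rd d, ∀ u v : ℝ, u ≤ v → ∀ p : Rd d, γ * (v - u) ≤ H x v p - H x u p

/-! ### Assumptions on the source term and the initial value -/

/-- `g` has continuous derivatives up to order `k`, all bounded by `M`. -/
def CbBound (k : ℕ) (g : Rd d → ℝ) (M : ℝ) : Prop :=
  ContDiff ℝ k g ∧ ∀ j ≤ k, ∀ x, ‖iteratedFDeriv ℝ j g x‖ ≤ M

/-- A modulus of continuity: nondecreasing on `[0, ∞)`, zero at zero, and continuous there. -/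
structure IsModulus (ω : ℝ → ℝ) : Prop where
  mono : MonotoneOn ω (Ici 0)
  zero : ω 0 = 0
  tendsto : Tendsto ω (𝓝[≥] 0) (𝓝 0)

/-- The assumptions on the data `f` (on `[0, T] × ℝ^d`) and `u₀`: `f` and `u₀` are continuous,
Lipschitz in `x` with constant `L`; `‖f(t, ·)‖_{C_b²} ≤ Cf` for all `t`; `‖u₀‖_{C_b³} ≤ Cu`; and
`f` has the modulus of continuity `ωf` in space-time. -/
structure DataBounds (T : ℝ) (f : ℝ → Rd d → ℝ) (u₀ : Rd d → ℝ) (L Cf Cu : ℝ)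
    (ωf : ℝ → ℝ) : Prop where
  cont_f : ContinuousOn (fun q : ℝ × Rd d => f q.1 q.2) (Icc 0 T ×ˢ univ)
  cont_u₀ : Continuous u₀
  lip : ∀ t ∈ Icc 0 T, ∀ x y, |f t x - f t y| + |u₀ x - u₀ y| ≤ L * ‖x - y‖
  f_C2 : ∀ t ∈ Icc 0 T, CbBound 2 (f t) Cf
  u₀_C3 : CbBound 3 u₀ Cu
  f_modulus : ∀ t ∈ Icc 0 T, ∀ s ∈ Icc 0 T, ∀ x y,
    |f s x - f t y| ≤ ωf (|s - t| + ‖x - y‖)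

/-! ### Classical solutions -/

/-- `u` is a classical solution of `∂ₜu - Lu + H(x, u, Du) = f` in `(0, T) × ℝ^d`,
`u(0, ·) = u₀`: it is continuous on `[0, T] × ℝ^d`, the functions `∂ₜu, Du, D²u, Lu` exist and are
continuous on `(0, T) × ℝ^d`, and the equation holds at every point. -/
structure IsClassicalSolution (μ : Measure (Rd d)) (T : ℝ) (H : Rd d → ℝ → Rd d → ℝ)
    (f : ℝ → Rd d → ℝ) (u₀ : Rd d → ℝ) (u : ℝ → Rd d → ℝ) : Prop where
  cont : ContinuousOn (fun q : ℝ × Rd d => u q.1 q.2) (Icc 0 T ×ˢ univ)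
  diff_time : ∀ t ∈ Ioo 0 T, ∀ x, DifferentiableAt ℝ (fun s => u s x) t
  diff_space : ∀ t ∈ Ioo 0 T, ContDiff ℝ 2 (u t)
  cont_time : ContinuousOn (fun q : ℝ × Rd d => deriv (fun s => u s q.2) q.1)
    (Ioo 0 T ×ˢ univ)
  cont_grad : ContinuousOn (fun q : ℝ × Rd d => gradient (u q.1) q.2) (Ioo 0 T ×ˢ univ)
  cont_hess : ContinuousOn (fun q : ℝ × Rd d => iteratedFDeriv ℝ 2 (u q.1) q.2)
    (Ioo 0 T ×ˢ univ)
  cont_levy : ContinuousOn (fun q : ℝ × Rd d => levyOp μ (u q.1) q.2) (Ioo 0 T ×ˢ univ)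
  initial : ∀ x, u 0 x = u₀ x
  equation : ∀ t ∈ Ioo 0 T, ∀ x,
    deriv (fun s => u s x) t - levyOp μ (u t) x + H x (u t x) (gradient (u t) x) = f t x

/-- `u` is bounded on `[0, T] × ℝ^d`. -/
def IsBoundedSolution (T : ℝ) (u : ℝ → Rd d → ℝ) : Prop :=
  ∃ M, ∀ t ∈ Icc 0 T, ∀ x, |u t x| ≤ M

/-- `∂ₜu, u, Du, D²u, D³u` belong to `C_b((0, T) × ℝ^d)` (the continuity of `∂ₜu` is part of
the notion of classical solution). -/
structure HasBoundedDerivatives (T : ℝ) (u : ℝ → Rd d → ℝ) : Prop where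
  diff_space : ∀ t ∈ Ioo 0 T, ContDiff ℝ 3 (u t)
  cont_space : ∀ k ≤ 3, ContinuousOn (fun q : ℝ × Rd d => iteratedFDeriv ℝ k (u q.1) q.2)
    (Ioo 0 T ×ˢ univ)
  bound_space : ∃ M, ∀ k ≤ 3, ∀ t ∈ Ioo 0 T, ∀ x, ‖iteratedFDeriv ℝ k (u t) x‖ ≤ M
  bound_time : ∃ M, ∀ t ∈ Ioo 0 T, ∀ x, |deriv (fun s => u s x) t| ≤ M

/-- `u, Du, D²u, ∂ₜu, Lu` have the common modulus of continuity `ω` on `(0, T) × ℝ^d`. -/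
def HasDerivativeModulus (μ : Measure (Rd d)) (T : ℝ) (u : ℝ → Rd d → ℝ) (ω : ℝ → ℝ) : Prop :=
  ∀ t ∈ Ioo 0 T, ∀ s ∈ Ioo 0 T, ∀ x y : Rd d,
    |u t x - u s y|
      + ‖gradient (u t) x - gradient (u s) y‖
      + ‖iteratedFDeriv ℝ 2 (u t) x - iteratedFDeriv ℝ 2 (u s) y‖
      + |deriv (fun r => u r x) t - deriv (fun r => u r y) s|
      + |levyOp μ (u t) x - levyOp μ (u s) y|
      ≤ ω (|t - s| + ‖x - y‖)

end FracHJB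

end

/-!
# Smooth solutions of a nonlocal Hamilton–Jacobi equation of order above one

The bounds on the heat kernel say that `K(t, ·)` is a convolution semigroup of probability densities
whose gradient has `L¹` norm of order `t ^ (-1 / σ)` (`KernelBounds.isHeatFamily`). As `σ > 1` this
singularity is integrable in time, so the heat semigroup gains one derivative in the Duhamel formula,
and a nonlinearity in `Du` is a perturbation of lower order.

*Local theory.* If the nonlinearity `N(t, x, u, Du)` is bounded, with bounded and Lipschitz
derivative in `(x, u, Du)`, then the mild equation for the pair `(u, Du)` is solved on all of `(0, T)`
by a contraction in a supremum norm with exponential weight in time (`IsHeatFamily.exists_isMild`).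
Differences in space of a derivative of `u` satisfy a Gronwall inequality with the kernel
`t ^ (-1 / σ)`; this makes the derivative Lipschitz, then the source term is Lipschitz too, and the
Duhamel formula yields one more derivative (`exists_regularity_step`). Two rounds lead from `Du` to
`D³u` (`exists_isC3_of_isMild`). Dynkin's formula `K_t * φ - φ = ∫₀ᵗ K_s * Lφ ds`, seen on the Fourier
side for test functions and extended to bounded functions with Lipschitz gradient by mollification
and cutoff (`KernelBounds.convolution_sub`), turns the mild equation into the pointwise one
(`exists_isStrong`).

*Global theory.* A maximum principle for bounded functions, in which a wide cutoff penalizes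
infinity (`max_principle`), compares a solution with zero and bounds `u` (`IsStrong.abs_apply_le`).
Applied to `u(t, x + h) - u(t, x)` and an exponential barrier it bounds `Du`
(`IsStrong.norm_grad_le`): the Lipschitz constant of `H` in `x` grows at most linearly in `p`, so the
barrier can absorb it. Neither bound sees the level at which the gradient is truncated in `H`, and
the bound on `u` sees no truncation level at all. Hence `u` and then `Du` may be truncated above
these bounds without changing the solution (`exists_isStrong_hamiltonian`). The same comparison shows
uniqueness; it is enough that one of the two solutions has a bounded gradient, since at a maximum of
the penalized difference the two gradients are close (`IsClassicalSolution.eq`).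

*Moduli of continuity.* The equation makes `u` Lipschitz in time. Interpolation with the bounds on
`D²u` and `D³u` gives moduli for `Du` and `D²u` (`norm_fderiv_le_sqrt`), the operator `L` applied to a
difference of translates gives one for `Lu`, and the equation gives one for `∂ₜu`. All constants are
fixed before the measure, the Hamiltonian and the data, so that the modulus is uniform.
-/

noncomputable section

namespace FracHJB

set_option maxSynthPendingDepth 3

open scoped Convolution

/-! ### Convolution of an integrable kernel with a bounded continuous function -/

section Convolution

variable {V W E F : Type*} [NormedAddCommGroup V] [InnerProductSpace ℝ V]
  [FiniteDimensional ℝ V] [MeasurableSpace V] [BorelSpace V] [NormedAddCommGroup W] [NormedSpace ℝ W]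
  [NormedAddCommGroup E] [NormedSpace ℝ E] [NormedAddCommGroup F] [NormedSpace ℝ F]

lemma norm_bilin_le {B : W →L[ℝ] E →L[ℝ] F} (hB : ‖B‖ ≤ 1) (w : W) {e : E} {M : ℝ}
    (he : ‖e‖ ≤ M) : ‖B w e‖ ≤ ‖w‖ * M := by
  refine (B.le_opNorm₂ w e).trans ?_
  refine mul_le_mul (mul_le_of_le_one_left (norm_nonneg _) hB) he (norm_nonneg _) (norm_nonneg _)

lemma integrable_convolution_integrand (B : W →L[ℝ] E →L[ℝ] F) {k : V → W}
    (hk : Integrable k) {g : V → E} (hg : Continuous g) {M : ℝ} (hM : ∀ y, ‖g y‖ ≤ M)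
    (x : V) : Integrable (fun y => B (k y) (g (x - y))) := by
  refine Integrable.mono' (hk.norm.mul_const (‖B‖ * M))
    (B.aestronglyMeasurable_comp₂ hk.aestronglyMeasurable
      (by fun_prop : Continuous fun y => g (x - y)).aestronglyMeasurable) (ae_of_all _ fun y => ?_)
  refine (B.le_opNorm₂ _ _).trans ?_
  rw [mul_comm ‖B‖, mul_assoc]
  gcongr
  exact hM _

lemma norm_convolution_le {B : W →L[ℝ] E →L[ℝ] F} (hB : ‖B‖ ≤ 1) {k : V → W}
    (hk : Integrable k) {g : V → E} {M : ℝ} (hM : ∀ y, ‖g y‖ ≤ M)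
    (x : V) : ‖(k ⋆[B] g) x‖ ≤ (∫ y, ‖k y‖) * M := by
  rw [convolution_def, ← integral_mul_const]
  exact norm_integral_le_of_norm_le (hk.norm.mul_const M)
    (ae_of_all _ fun y => norm_bilin_le hB _ (hM _))

lemma convolution_sub_right (B : W →L[ℝ] E →L[ℝ] F) {k : V → W}
    (hk : Integrable k) {g h : V → E} (hg : Continuous g) (hh : Continuous h) {M N : ℝ}
    (hM : ∀ y, ‖g y‖ ≤ M) (hN : ∀ y, ‖h y‖ ≤ N) (x x' : V) :
    (k ⋆[B] g) x - (k ⋆[B] h) x' = (k ⋆[B] fun y => g y - h (y + (x' - x))) x := by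
  simp only [convolution_def]
  rw [← integral_sub (integrable_convolution_integrand B hk hg hM x)
    (integrable_convolution_integrand B hk hh hN x')]
  refine integral_congr_ae (ae_of_all _ fun y => ?_)
  have : x - y + (x' - x) = x' - y := by abel
  simp [this]

/-- Convolutions converge when the kernels converge in `L¹` and the functions are uniformly bounded
and converge pointwise. -/
lemma tendsto_convolution {ι : Type*} {l : Filter ι} [l.IsCountablyGenerated]
    {B : W →L[ℝ] E →L[ℝ] F} (hB : ‖B‖ ≤ 1) {k : ι → V → W} {k₀ : V → W}
    (hk : ∀ᶠ i in l, Integrable (k i)) (hk₀ : Integrable k₀)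
    (hL : Tendsto (fun i => ∫ y, ‖k i y - k₀ y‖) l (𝓝 0))
    {g : ι → V → E} {g₀ : V → E} {M : ℝ}
    (hg : ∀ᶠ i in l, Continuous (g i) ∧ ∀ y, ‖g i y‖ ≤ M)
    {x : ι → V} {x₀ : V}
    (hlim : ∀ y, Tendsto (fun i => g i (x i - y)) l (𝓝 (g₀ (x₀ - y)))) :
    Tendsto (fun i => (k i ⋆[B] g i) (x i)) l (𝓝 ((k₀ ⋆[B] g₀) x₀)) := by
  have h1 : Tendsto (fun i => (k₀ ⋆[B] g i) (x i)) l (𝓝 ((k₀ ⋆[B] g₀) x₀)) := by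
    refine tendsto_integral_filter_of_dominated_convergence (fun y => ‖k₀ y‖ * M) ?_ ?_
      (hk₀.norm.mul_const M) ?_
    · filter_upwards [hg] with i hi
      exact (integrable_convolution_integrand B hk₀ hi.1 hi.2 _).aestronglyMeasurable
    · filter_upwards [hg] with i hi
      exact ae_of_all _ fun y => norm_bilin_le hB _ (hi.2 _)
    · exact ae_of_all _ fun y => ((B (k₀ y)).continuous.tendsto _).comp (hlim y)
  have h2 : Tendsto (fun i => (k i ⋆[B] g i) (x i) - (k₀ ⋆[B] g i) (x i)) l (𝓝 0) := by
    refine squeeze_zero_norm' ?_ (by simpa using hL.mul_const M)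
    filter_upwards [hk, hg] with i hi hgi
    have h3 : (k i ⋆[B] g i) (x i) - (k₀ ⋆[B] g i) (x i)
        = ((fun y => k i y - k₀ y) ⋆[B] g i) (x i) := by
      simp only [convolution_def]
      rw [← integral_sub (integrable_convolution_integrand B hi hgi.1 hgi.2 _)
        (integrable_convolution_integrand B hk₀ hgi.1 hgi.2 _)]
      simp
    rw [h3]
    exact norm_convolution_le hB (hi.sub hk₀) hgi.2 _
  simpa using h2.add h1

lemma continuous_convolution {B : W →L[ℝ] E →L[ℝ] F} (hB : ‖B‖ ≤ 1) {k : V → W}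
    (hk : Integrable k) {g : V → E} (hg : Continuous g) {M : ℝ} (hM : ∀ y, ‖g y‖ ≤ M) :
    Continuous (k ⋆[B] g) := by
  refine continuous_iff_continuousAt.2 fun x => ?_
  refine tendsto_convolution (l := 𝓝 x) (k := fun _ => k) (g := fun _ => g) (x := id) (M := M) hB
    (Eventually.of_forall fun _ => hk) hk (by simp) (Eventually.of_forall fun _ => ⟨hg, hM⟩)
    fun y => ?_
  exact (by fun_prop : Continuous fun z => g (z - y)).tendsto x

/-- The derivative of a convolution may fall on the bounded factor. -/
lemma hasFDerivAt_convolution_smul {k : V → ℝ} (hk : Integrable k) {g : V → E}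
    {g' : V → V →L[ℝ] E} (hg : ∀ x, HasFDerivAt g (g' x) x) (hg' : Continuous g') {M M' : ℝ}
    (hM : ∀ y, ‖g y‖ ≤ M) (hM' : ∀ y, ‖g' y‖ ≤ M') (x : V) :
    HasFDerivAt (k ⋆[ContinuousLinearMap.lsmul ℝ ℝ] g)
      ((k ⋆[ContinuousLinearMap.lsmul ℝ ℝ] g') x) x := by
  have hgc : Continuous g := continuous_iff_continuousAt.2 fun x => (hg x).continuousAt
  refine hasFDerivAt_integral_of_dominated_of_fderiv_le (s := univ)
    (F' := fun x y => k y • g' (x - y)) (bound := fun y => ‖k y‖ * M') univ_mem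
    (Eventually.of_forall fun x =>
      (integrable_convolution_integrand _ hk hgc hM x).aestronglyMeasurable)
    (integrable_convolution_integrand _ hk hgc hM x)
    (integrable_convolution_integrand (ContinuousLinearMap.lsmul ℝ ℝ) hk hg' hM'
      x).aestronglyMeasurable
    (ae_of_all _ fun y z _ => ?_) (hk.norm.mul_const M') (ae_of_all _ fun y z _ => ?_)
  · rw [norm_smul]
    gcongr
    exact hM' _
  · have := ((hg (z - y)).comp z ((hasFDerivAt_id z).sub_const y)).const_smul (k y)
    simpa [Function.comp_def, Pi.smul_def] using this

lemma enorm_sub_le_lintegral_segment [CompleteSpace W] {k : V → W} (hk : ContDiff ℝ 1 k)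
    (y h : V) (A : V →L[ℝ] W) :
    ‖k (y + h) - k y - A h‖ₑ ≤ ∫⁻ θ in Ioc (0 : ℝ) 1, ‖h‖ₑ * ‖fderiv ℝ k (y + θ • h) - A‖ₑ := by
  have hc : Continuous (fderiv ℝ k) := hk.continuous_fderiv one_ne_zero
  have hd : ∀ θ : ℝ, HasDerivAt (fun θ : ℝ => k (y + θ • h) - A (θ • h))
      ((fderiv ℝ k (y + θ • h) - A) h) θ := by
    intro θ
    have h1 : HasDerivAt (fun θ : ℝ => y + θ • h) h θ := by
      simpa using ((hasDerivAt_id θ).smul_const h).const_add y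
    have h2 : HasDerivAt (fun θ : ℝ => θ • h) h θ := by
      simpa using ((hasDerivAt_id θ).smul_const h)
    exact (((hk.differentiable one_ne_zero _).hasFDerivAt).comp_hasDerivAt θ h1).sub
      (A.hasFDerivAt.comp_hasDerivAt θ h2)
  have hcont : Continuous fun θ : ℝ => (fderiv ℝ k (y + θ • h) - A) h := by fun_prop
  have h3 := intervalIntegral.integral_eq_sub_of_hasDerivAt (a := 0) (b := 1) (fun θ _ => hd θ)
    (hcont.intervalIntegrable _ _)
  have h4 : k (y + h) - k y - A h
      = ∫ θ in Ioc (0 : ℝ) 1, (fderiv ℝ k (y + θ • h) - A) h := by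
    rw [← intervalIntegral.integral_of_le zero_le_one, h3]
    simp
    abel
  rw [h4]
  refine (enorm_integral_le_lintegral_enorm _).trans (lintegral_mono fun θ => ?_)
  rw [mul_comm]
  exact (fderiv ℝ k (y + θ • h) - A).le_opENorm h

/-- The `L¹` modulus of translation is controlled by the `L¹` norm of the derivative. -/
lemma lintegral_translate_sub_le [CompleteSpace W] {k : V → W} (hk : ContDiff ℝ 1 k)
    (h : V) :
    ∫⁻ y, ‖k (y + h) - k y‖ₑ ≤ ‖h‖ₑ * ∫⁻ y, ‖fderiv ℝ k y‖ₑ := by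
  have hc : Continuous (fderiv ℝ k) := hk.continuous_fderiv one_ne_zero
  calc ∫⁻ y, ‖k (y + h) - k y‖ₑ
      ≤ ∫⁻ y, ∫⁻ θ in Ioc (0 : ℝ) 1, ‖h‖ₑ * ‖fderiv ℝ k (y + θ • h)‖ₑ :=
        lintegral_mono fun y => by simpa using enorm_sub_le_lintegral_segment hk y h 0
    _ = ∫⁻ θ in Ioc (0 : ℝ) 1, ∫⁻ y, ‖h‖ₑ * ‖fderiv ℝ k (y + θ • h)‖ₑ := by
        refine lintegral_lintegral_swap (Measurable.aemeasurable ?_)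
        have : Continuous fun p : V × ℝ => fderiv ℝ k (p.1 + p.2 • h) := by fun_prop
        exact (this.enorm.measurable).const_mul _
    _ = ∫⁻ θ in Ioc (0 : ℝ) 1, ‖h‖ₑ * ∫⁻ y, ‖fderiv ℝ k y‖ₑ := by
        refine lintegral_congr fun θ => ?_
        rw [lintegral_const_mul _ (by fun_prop)]
        congr 1
        exact lintegral_add_right_eq_self (fun y => ‖fderiv ℝ k y‖ₑ) (θ • h)
    _ = ‖h‖ₑ * ∫⁻ y, ‖fderiv ℝ k y‖ₑ := by simp

/-- Differentiability in `L¹`: the first order Taylor remainder is quadratic in `L¹`. -/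
lemma lintegral_taylor_le [CompleteSpace W] {k : V → W} (hk : ContDiff ℝ 2 k) (h : V) :
    ∫⁻ y, ‖k (y + h) - k y - fderiv ℝ k y h‖ₑ
      ≤ ‖h‖ₑ * (‖h‖ₑ * ∫⁻ y, ‖fderiv ℝ (fderiv ℝ k) y‖ₑ) := by
  have hk1 : ContDiff ℝ 1 (fderiv ℝ k) := hk.fderiv_right (by norm_num)
  have hc : Continuous (fderiv ℝ k) := hk1.continuous
  calc ∫⁻ y, ‖k (y + h) - k y - fderiv ℝ k y h‖ₑ
      ≤ ∫⁻ y, ∫⁻ θ in Ioc (0 : ℝ) 1, ‖h‖ₑ * ‖fderiv ℝ k (y + θ • h) - fderiv ℝ k y‖ₑ :=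
        lintegral_mono fun y =>
          enorm_sub_le_lintegral_segment (hk.of_le (by norm_num)) y h (fderiv ℝ k y)
    _ = ∫⁻ θ in Ioc (0 : ℝ) 1, ∫⁻ y, ‖h‖ₑ * ‖fderiv ℝ k (y + θ • h) - fderiv ℝ k y‖ₑ := by
        refine lintegral_lintegral_swap (Measurable.aemeasurable ?_)
        have : Continuous fun p : V × ℝ => fderiv ℝ k (p.1 + p.2 • h) - fderiv ℝ k p.1 := by
          fun_prop
        exact (this.enorm.measurable).const_mul _
    _ ≤ ∫⁻ θ in Ioc (0 : ℝ) 1, ‖h‖ₑ * (‖h‖ₑ * ∫⁻ y, ‖fderiv ℝ (fderiv ℝ k) y‖ₑ) := by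
        refine setLIntegral_mono' measurableSet_Ioc fun θ hθ => ?_
        rw [lintegral_const_mul _ (by
          have : Continuous fun y => fderiv ℝ k (y + θ • h) - fderiv ℝ k y := by fun_prop
          exact this.enorm.measurable)]
        gcongr
        refine (lintegral_translate_sub_le hk1 (θ • h)).trans ?_
        gcongr
        rw [enorm_smul]
        refine mul_le_of_le_one_left (zero_le) ?_
        rw [Real.enorm_of_nonneg hθ.1.le]
        exact ENNReal.ofReal_le_one.2 hθ.2
    _ = ‖h‖ₑ * (‖h‖ₑ * ∫⁻ y, ‖fderiv ℝ (fderiv ℝ k) y‖ₑ) := by simp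

/-- The derivative of a convolution may fall on the integrable factor. No pointwise domination of
the difference quotients of the kernel is available; convergence takes place in `L¹`. -/
lemma hasFDerivAt_convolution_kernel [CompleteSpace W] {B : W →L[ℝ] E →L[ℝ] F} (hB : ‖B‖ ≤ 1)
    {k : V → W} (hk : ContDiff ℝ 2 k) (hk0 : Integrable k) (hk1 : Integrable (fderiv ℝ k))
    (hk2 : Integrable (fderiv ℝ (fderiv ℝ k))) {g : V → E} (hg : Continuous g) {M : ℝ}
    (hM : ∀ y, ‖g y‖ ≤ M) (x : V) :
    HasFDerivAt (k ⋆[B] g) ((fderiv ℝ k ⋆[B.precompL (V)] g) x) x := by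
  have hM0 : 0 ≤ M := (norm_nonneg _).trans (hM 0)
  have hkc : Continuous (fderiv ℝ k) := hk.continuous_fderiv two_ne_zero
  set N := ∫ y, ‖fderiv ℝ (fderiv ℝ k) y‖ with hN
  have hrem : ∀ h, Integrable (fun y => k (y + h) - k y - fderiv ℝ k y h) ∧
      ∫ y, ‖k (y + h) - k y - fderiv ℝ k y h‖ ≤ ‖h‖ * (‖h‖ * N) := by
    intro h
    have hi : Integrable (fun y => k (y + h) - k y - fderiv ℝ k y h) :=
      ((hk0.comp_add_right h).sub hk0).sub (hk1.apply_continuousLinearMap h)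
    refine ⟨hi, ?_⟩
    rw [integral_norm_eq_lintegral_enorm hi.aestronglyMeasurable, hN,
      integral_norm_eq_lintegral_enorm hk2.aestronglyMeasurable]
    have := ENNReal.toReal_mono ?_ (lintegral_taylor_le hk h)
    · simpa [ENNReal.toReal_mul] using this
    · exact ENNReal.mul_ne_top (by simp) (ENNReal.mul_ne_top (by simp) hk2.2.ne)
  have hest : ∀ h, ‖(k ⋆[B] g) (x + h) - (k ⋆[B] g) x - (fderiv ℝ k ⋆[B.precompL V] g) x h‖
      ≤ ‖h‖ * (‖h‖ * N) * M := by
    intro h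
    have e1 : (k ⋆[B] g) (x + h) = ∫ y, B (k (y + h)) (g (x - y)) := by
      rw [convolution_def, ← integral_add_right_eq_self _ h]
      refine integral_congr_ae (ae_of_all _ fun y => ?_)
      have : x + h - (y + h) = x - y := by abel
      simp [this]
    have i1 := integrable_convolution_integrand B (hk0.comp_add_right h) hg hM x
    have i2 := integrable_convolution_integrand B hk0 hg hM x
    have i3 := integrable_convolution_integrand (B.precompL V) hk1 hg hM x
    have e2 : (fderiv ℝ k ⋆[B.precompL V] g) x h = ∫ y, B (fderiv ℝ k y h) (g (x - y)) := by
      rw [convolution_def, ContinuousLinearMap.integral_apply i3]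
      rfl
    have i3' : Integrable fun y => B (fderiv ℝ k y h) (g (x - y)) :=
      integrable_convolution_integrand B (hk1.apply_continuousLinearMap h) hg hM x
    have e3 : (k ⋆[B] g) (x + h) - (k ⋆[B] g) x - (fderiv ℝ k ⋆[B.precompL V] g) x h
        = ((fun y => k (y + h) - k y - fderiv ℝ k y h) ⋆[B] g) x := by
      rw [e1, e2]
      simp only [convolution_def]
      rw [← integral_sub i1 i2]
      refine (integral_sub (i1.sub i2) i3').symm.trans (integral_congr_ae (ae_of_all _ fun y => ?_))
      simp
    rw [e3]
    refine (norm_convolution_le hB (hrem h).1 hM x).trans ?_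
    gcongr
    exact (hrem h).2
  rw [hasFDerivAt_iff_isLittleO_nhds_zero]
  refine Asymptotics.IsBigO.trans_isLittleO (g := fun h : V => ‖h‖ * ‖h‖) ?_ ?_
  · refine Asymptotics.IsBigO.of_bound (N * M) (Eventually.of_forall fun h => ?_)
    refine (hest h).trans (le_of_eq ?_)
    rw [Real.norm_of_nonneg (by positivity)]
    ring
  · refine Asymptotics.IsLittleO.of_norm_right ?_
    have : (fun h : V => ‖h‖) =o[𝓝 0] (fun _ => (1 : ℝ)) := by
      refine (Asymptotics.isLittleO_one_iff ℝ).2 ?_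
      simpa using (continuous_norm.tendsto (0 : V))
    simpa using this.mul_isBigO (Asymptotics.isBigO_refl (fun h : V => ‖h‖) (𝓝 0))

end Convolution

/-! ### Convolution semigroups of densities -/

section Semigroup

variable {V W E F : Type*} [NormedAddCommGroup V] [InnerProductSpace ℝ V]
  [FiniteDimensional ℝ V] [MeasurableSpace V] [BorelSpace V] [NormedAddCommGroup W] [NormedSpace ℝ W]
  [NormedAddCommGroup E] [NormedSpace ℝ E] [NormedAddCommGroup F] [NormedSpace ℝ F]

/-- Scalar multiplication as a bilinear map: the pairing in the convolution of a real kernel with a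
vector valued function. -/
abbrev smulB (E : Type*) [NormedAddCommGroup E] [NormedSpace ℝ E] : ℝ →L[ℝ] E →L[ℝ] E :=
  ContinuousLinearMap.lsmul ℝ ℝ

/-- The pairing in the convolution of the derivative of a real kernel with a function. -/
abbrev smulB₁ (V E : Type*) [NormedAddCommGroup V] [NormedSpace ℝ V] [NormedAddCommGroup E]
    [NormedSpace ℝ E] : (V →L[ℝ] ℝ) →L[ℝ] E →L[ℝ] V →L[ℝ] E :=
  (smulB E).precompL V

/-- The pairing in the convolution of the second derivative of a real kernel with a function. -/
abbrev smulB₂ (V E : Type*) [NormedAddCommGroup V] [NormedSpace ℝ V] [NormedAddCommGroup E]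
    [NormedSpace ℝ E] : (V →L[ℝ] V →L[ℝ] ℝ) →L[ℝ] E →L[ℝ] V →L[ℝ] V →L[ℝ] E :=
  (smulB₁ V E).precompL V

lemma norm_smulB_le : ‖smulB E‖ ≤ 1 := ContinuousLinearMap.opNorm_lsmul_le

lemma norm_smulB₁_le : ‖smulB₁ V E‖ ≤ 1 :=
  (ContinuousLinearMap.norm_precompL_le V _).trans norm_smulB_le

lemma norm_smulB₂_le : ‖smulB₂ V E‖ ≤ 1 :=
  (ContinuousLinearMap.norm_precompL_le V _).trans norm_smulB₁_le

/-- A semigroup of smooth probability densities on the time interval `(0, T)`, continuous in `L¹`,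
whose gradient is of order `t ^ (-1 / σ)` in `L¹`. -/
structure IsHeatFamily (K : ℝ → V → ℝ) (σ T κ : ℝ) : Prop where
  smooth : ∀ t ∈ Ioo 0 T, ContDiff ℝ (⊤ : ℕ∞) (K t)
  nonneg : ∀ t ∈ Ioo 0 T, ∀ x, 0 ≤ K t x
  bounded : ∀ t ∈ Ioo 0 T, ∃ M, ∀ x, ‖K t x‖ ≤ M
  int0 : ∀ t ∈ Ioo 0 T, Integrable (K t)
  int1 : ∀ t ∈ Ioo 0 T, Integrable (fderiv ℝ (K t))
  int2 : ∀ t ∈ Ioo 0 T, Integrable (fderiv ℝ (fderiv ℝ (K t)))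
  int3 : ∀ t ∈ Ioo 0 T, Integrable (fderiv ℝ (fderiv ℝ (fderiv ℝ (K t))))
  mass : ∀ t ∈ Ioo 0 T, ∫ y, K t y = 1
  grad_bound : ∀ t ∈ Ioo 0 T, ∫ y, ‖fderiv ℝ (K t) y‖ ≤ κ * t ^ (-(1 / σ))
  semigroup : ∀ s ∈ Ioo 0 T, ∀ t ∈ Ioo 0 T, s + t < T →
    ∀ x, K (s + t) x = (K s ⋆[smulB ℝ] K t) x
  l1_cont : ∀ t ∈ Ioo 0 T, Tendsto (fun s => ∫ y, ‖K s y - K t y‖) (𝓝 t) (𝓝 0)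

/-- Young's inequality for `L¹` kernels. -/
lemma integral_norm_convolution_le {B : W →L[ℝ] E →L[ℝ] F} (hB : ‖B‖ ≤ 1)
    {k : V → W} (hk : Integrable k) {g : V → E} (hg : Continuous g) (hgi : Integrable g) {M : ℝ}
    (hM : ∀ y, ‖g y‖ ≤ M) :
    ∫ x, ‖(k ⋆[B] g) x‖ ≤ (∫ y, ‖k y‖) * ∫ y, ‖g y‖ := by
  have h := integral_convolution (ContinuousLinearMap.mul ℝ ℝ) hk.norm hgi.norm
  simp only [ContinuousLinearMap.mul_apply'] at h
  rw [← h]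
  refine integral_mono_of_nonneg (ae_of_all _ fun x => norm_nonneg _)
    (hk.norm.integrable_convolution (ContinuousLinearMap.mul ℝ ℝ) hgi.norm)
    (ae_of_all _ fun x => ?_)
  refine norm_integral_le_of_norm_le (integrable_convolution_integrand
    (ContinuousLinearMap.mul ℝ ℝ) hk.norm hg.norm (M := M) (by simpa using hM) x)
    (ae_of_all _ fun y => ?_)
  exact norm_bilin_le hB _ le_rfl

namespace IsHeatFamily

variable {K : ℝ → V → ℝ} {σ T κ : ℝ}

lemma continuous (hK : IsHeatFamily K σ T κ) {t : ℝ} (ht : t ∈ Ioo 0 T) : Continuous (K t) :=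
  (hK.smooth t ht).continuous

lemma integral_norm (hK : IsHeatFamily K σ T κ) {t : ℝ} (ht : t ∈ Ioo 0 T) :
    ∫ y, ‖K t y‖ = 1 := by
  rw [← hK.mass t ht]
  exact integral_congr_ae (ae_of_all _ fun y => Real.norm_of_nonneg (hK.nonneg t ht y))

/-- A family of kernels that factors through the semigroup inherits its continuity in `L¹`. -/
lemma l1_cont_of_factor (hK : IsHeatFamily K σ T κ) {B : W →L[ℝ] ℝ →L[ℝ] W} (hB : ‖B‖ ≤ 1)
    {k : ℝ → V → W} (hk : ∀ t ∈ Ioo 0 T, Integrable (k t))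
    (hf : ∀ s ∈ Ioo 0 T, ∀ t ∈ Ioo 0 T, s + t < T → ∀ x, k (s + t) x = (k s ⋆[B] K t) x)
    {t : ℝ} (ht : t ∈ Ioo 0 T) :
    Tendsto (fun s => ∫ y, ‖k s y - k t y‖) (𝓝 t) (𝓝 0) := by
  have ht2 : t / 2 ∈ Ioo 0 T := ⟨by linarith [ht.1], by linarith [ht.1, ht.2]⟩
  have h1 : Tendsto (fun s => (∫ y, ‖k (t / 2) y‖) * ∫ y, ‖K (s - t / 2) y - K (t / 2) y‖) (𝓝 t)
      (𝓝 0) := by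
    have : Tendsto (fun s : ℝ => s - t / 2) (𝓝 t) (𝓝 (t / 2)) := by
      have h : Continuous fun s : ℝ => s - t / 2 := by fun_prop
      simpa [sub_half] using h.tendsto t
    simpa using ((hK.l1_cont _ ht2).comp this).const_mul (∫ y, ‖k (t / 2) y‖)
  refine squeeze_zero' (Eventually.of_forall fun s => integral_nonneg fun y => norm_nonneg _) ?_ h1
  filter_upwards [Ioo_mem_nhds (show t / 2 < t by linarith [ht.1]) ht.2] with s hs
  have hs2 : s - t / 2 ∈ Ioo 0 T := ⟨by linarith [hs.1], by linarith [hs.2, ht.1]⟩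
  obtain ⟨M, hM⟩ := hK.bounded _ hs2
  obtain ⟨N, hN⟩ := hK.bounded _ ht2
  have hb : ∀ y, ‖K (s - t / 2) y - K (t / 2) y‖ ≤ M + N := fun y =>
    (norm_sub_le _ _).trans (add_le_add (hM y) (hN y))
  have h2 : ∀ x, k s x - k t x
      = (k (t / 2) ⋆[B] fun y => K (s - t / 2) y - K (t / 2) y) x := by
    intro x
    have e1 := hf _ ht2 _ hs2 (by linarith [hs.2]) x
    have e2 := hf _ ht2 _ ht2 (by linarith [ht.2]) x
    rw [add_sub_cancel] at e1
    rw [add_halves] at e2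
    rw [e1, e2, convolution_sub_right B (hk _ ht2) (hK.continuous hs2) (hK.continuous ht2) hM hN]
    simp
  simp_rw [h2]
  exact integral_norm_convolution_le hB (hk _ ht2)
    ((hK.continuous hs2).sub (hK.continuous ht2)) ((hK.int0 _ hs2).sub (hK.int0 _ ht2)) hb

lemma fderiv_semigroup (hK : IsHeatFamily K σ T κ) {s t : ℝ} (hs : s ∈ Ioo 0 T) (ht : t ∈ Ioo 0 T)
    (hst : s + t < T) (x : V) :
    fderiv ℝ (K (s + t)) x = (fderiv ℝ (K s) ⋆[smulB₁ V ℝ] K t) x := by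
  obtain ⟨M, hM⟩ := hK.bounded _ ht
  have h := hasFDerivAt_convolution_kernel (norm_smulB_le (E := ℝ))
    (contDiff_infty.1 (hK.smooth s hs) 2) (hK.int0 s hs) (hK.int1 s hs) (hK.int2 s hs)
    (hK.continuous ht) hM x
  rw [funext (hK.semigroup s hs t ht hst)]
  exact h.fderiv

lemma fderiv_fderiv_semigroup (hK : IsHeatFamily K σ T κ) {s t : ℝ} (hs : s ∈ Ioo 0 T)
    (ht : t ∈ Ioo 0 T) (hst : s + t < T) (x : V) :
    fderiv ℝ (fderiv ℝ (K (s + t))) x = (fderiv ℝ (fderiv ℝ (K s)) ⋆[smulB₂ V ℝ] K t) x := by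
  obtain ⟨M, hM⟩ := hK.bounded _ ht
  have h := hasFDerivAt_convolution_kernel (norm_smulB₁_le (V := V) (E := ℝ))
    (contDiff_infty.1 ((hK.smooth s hs).fderiv_right (m := (⊤ : ℕ∞)) (by simp)) 2)
    (hK.int1 s hs) (hK.int2 s hs) (hK.int3 s hs) (hK.continuous ht) hM x
  rw [funext fun x => hK.fderiv_semigroup hs ht hst x]
  exact h.fderiv

lemma l1_cont_fderiv (hK : IsHeatFamily K σ T κ) {t : ℝ} (ht : t ∈ Ioo 0 T) :
    Tendsto (fun s => ∫ y, ‖fderiv ℝ (K s) y - fderiv ℝ (K t) y‖) (𝓝 t) (𝓝 0) :=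
  hK.l1_cont_of_factor norm_smulB₁_le hK.int1
    (fun _ hs _ ht hst x => hK.fderiv_semigroup hs ht hst x) ht

lemma l1_cont_fderiv_fderiv (hK : IsHeatFamily K σ T κ) {t : ℝ} (ht : t ∈ Ioo 0 T) :
    Tendsto (fun s => ∫ y, ‖fderiv ℝ (fderiv ℝ (K s)) y - fderiv ℝ (fderiv ℝ (K t)) y‖)
      (𝓝 t) (𝓝 0) :=
  hK.l1_cont_of_factor norm_smulB₂_le hK.int2
    (fun _ hs _ ht hst x => hK.fderiv_fderiv_semigroup hs ht hst x) ht

variable {g : V → E} {M : ℝ}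

lemma norm_convolution_le (hK : IsHeatFamily K σ T κ) {t : ℝ} (ht : t ∈ Ioo 0 T)
    (hM : ∀ y, ‖g y‖ ≤ M) (x : V) : ‖(K t ⋆[smulB E] g) x‖ ≤ M := by
  simpa only [hK.integral_norm ht, one_mul] using
    FracHJB.norm_convolution_le norm_smulB_le (hK.int0 t ht) hM x

lemma norm_convolution_fderiv_le (hK : IsHeatFamily K σ T κ) {t : ℝ} (ht : t ∈ Ioo 0 T)
    (hM : ∀ y, ‖g y‖ ≤ M) (x : V) :
    ‖(fderiv ℝ (K t) ⋆[smulB₁ V E] g) x‖ ≤ κ * t ^ (-(1 / σ)) * M :=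
  (FracHJB.norm_convolution_le norm_smulB₁_le (hK.int1 t ht) hM x).trans <|
    mul_le_mul_of_nonneg_right (hK.grad_bound t ht) ((norm_nonneg _).trans (hM 0))

lemma hasFDerivAt_convolution (hK : IsHeatFamily K σ T κ) {t : ℝ} (ht : t ∈ Ioo 0 T)
    (hg : Continuous g) (hM : ∀ y, ‖g y‖ ≤ M) (x : V) :
    HasFDerivAt (K t ⋆[smulB E] g) ((fderiv ℝ (K t) ⋆[smulB₁ V E] g) x) x :=
  hasFDerivAt_convolution_kernel norm_smulB_le
    (contDiff_infty.1 (hK.smooth t ht) 2) (hK.int0 t ht) (hK.int1 t ht) (hK.int2 t ht)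
    hg hM x

lemma hasFDerivAt_convolution_fderiv (hK : IsHeatFamily K σ T κ) {t : ℝ} (ht : t ∈ Ioo 0 T)
    (hg : Continuous g) (hM : ∀ y, ‖g y‖ ≤ M) (x : V) :
    HasFDerivAt (fderiv ℝ (K t) ⋆[smulB₁ V E] g)
      ((fderiv ℝ (fderiv ℝ (K t)) ⋆[smulB₂ V E] g) x) x :=
  hasFDerivAt_convolution_kernel norm_smulB₁_le
    (contDiff_infty.1 ((hK.smooth t ht).fderiv_right (m := (⊤ : ℕ∞)) (by simp)) 2)
    (hK.int1 t ht) (hK.int2 t ht) (hK.int3 t ht) hg hM x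

/-- For Lipschitz `g` one of the two derivatives of the semigroup may be spent on `g`. -/
lemma norm_convolution_fderiv_fderiv_le (hK : IsHeatFamily K σ T κ) {t : ℝ} (ht : t ∈ Ioo 0 T)
    (hg : Continuous g) (hM : ∀ y, ‖g y‖ ≤ M) {A : ℝ} (hA : ∀ x y, ‖g x - g y‖ ≤ A * ‖x - y‖)
    (hA0 : 0 ≤ A) (x : V) :
    ‖(fderiv ℝ (fderiv ℝ (K t)) ⋆[smulB₂ V E] g) x‖ ≤ κ * t ^ (-(1 / σ)) * A := by
  have hκ : 0 ≤ κ * t ^ (-(1 / σ)) :=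
    (integral_nonneg fun _ => norm_nonneg _).trans (hK.grad_bound t ht)
  have hlip : LipschitzWith (κ * t ^ (-(1 / σ)) * A).toNNReal
      (fderiv ℝ (K t) ⋆[smulB₁ V E] g) := by
    refine LipschitzWith.of_dist_le_mul fun y z => ?_
    rw [dist_eq_norm, convolution_sub_right _ (hK.int1 t ht) hg hg hM hM,
      Real.coe_toNNReal _ (by positivity), dist_eq_norm]
    refine (hK.norm_convolution_fderiv_le ht (M := A * ‖y - z‖) (fun w => ?_) _).trans
      (le_of_eq (mul_assoc _ _ _).symm)
    refine (hA _ _).trans (le_of_eq ?_)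
    rw [show w - (w + (z - y)) = y - z by abel]
  have := (hK.hasFDerivAt_convolution_fderiv ht hg hM x).le_of_lipschitz hlip
  rwa [Real.coe_toNNReal _ (by positivity)] at this

/-- The gradient of the semigroup acts on the derivative of a `C¹` function as the Hessian of the
semigroup acts on the function. -/
lemma convolution_fderiv_fderiv_eq (hK : IsHeatFamily K σ T κ) {t : ℝ} (ht : t ∈ Ioo 0 T)
    {g' : V → V →L[ℝ] E} (hg : ∀ x, HasFDerivAt g (g' x) x) (hg' : Continuous g') {M' : ℝ}
    (hM : ∀ y, ‖g y‖ ≤ M) (hM' : ∀ y, ‖g' y‖ ≤ M') (x : V) :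
    (fderiv ℝ (fderiv ℝ (K t)) ⋆[smulB₂ V E] g) x
      = (fderiv ℝ (K t) ⋆[smulB₁ V (V →L[ℝ] E)] g') x := by
  have hgc : Continuous g := continuous_iff_continuousAt.2 fun x => (hg x).continuousAt
  have h1 : (fderiv ℝ (K t) ⋆[smulB₁ V E] g) = (K t ⋆[smulB (V →L[ℝ] E)] g') :=
    funext fun y => (hK.hasFDerivAt_convolution ht hgc hM y).unique
      (hasFDerivAt_convolution_smul (hK.int0 t ht) hg hg' hM hM' y)
  have h2 := hK.hasFDerivAt_convolution_fderiv ht hgc hM x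
  rw [h1] at h2
  exact h2.unique (hK.hasFDerivAt_convolution ht hg' hM' x)

end IsHeatFamily

end Semigroup

/-! ### Duhamel integrals -/

section Duhamel

variable {V W W' E F F' : Type*} [NormedAddCommGroup V] [InnerProductSpace ℝ V]
  [FiniteDimensional ℝ V] [MeasurableSpace V] [BorelSpace V] [NormedAddCommGroup W] [NormedSpace ℝ W]
  [NormedAddCommGroup W'] [NormedSpace ℝ W']
  [NormedAddCommGroup E] [NormedSpace ℝ E] [NormedAddCommGroup F] [NormedSpace ℝ F]
  [NormedAddCommGroup F'] [NormedSpace ℝ F']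

/-- The Duhamel integral `∫₀ᵗ k(r) * G(t - r) dr` of a source `G` against a family of kernels. -/
def duhamel (B : W →L[ℝ] E →L[ℝ] F) (k : ℝ → V → W) (G : ℝ → V → E) (t : ℝ) (x : V) : F :=
  ∫ r in Ioo 0 t, (k r ⋆[B] G (t - r)) x

/-- Hypotheses under which the Duhamel integral converges: an `L¹`-continuous family of kernels, a
bounded continuous source, and an integrable bound for the integrand. -/
structure IsDuhamel (B : W →L[ℝ] E →L[ℝ] F) (k : ℝ → V → W) (G : ℝ → V → E) (T : ℝ)
    (b : ℝ → ℝ) : Prop where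
  norm_le_one : ‖B‖ ≤ 1
  int : ∀ r ∈ Ioo 0 T, Integrable (k r)
  l1_cont : ∀ r ∈ Ioo 0 T, Tendsto (fun s => ∫ y, ‖k s y - k r y‖) (𝓝 r) (𝓝 0)
  cont : ContinuousOn (fun q : ℝ × V => G q.1 q.2) (Ioo 0 T ×ˢ univ)
  bdd : ∃ M, ∀ s ∈ Ioo 0 T, ∀ y, ‖G s y‖ ≤ M
  int_bound : IntegrableOn b (Ioo 0 T)
  bound : ∀ r t, 0 < r → r < t → t < T → ∀ x, ‖(k r ⋆[B] G (t - r)) x‖ ≤ b r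

lemma continuous_slice {G : ℝ → V → E} {T : ℝ}
    (hG : ContinuousOn (fun q : ℝ × V => G q.1 q.2) (Ioo 0 T ×ˢ univ)) {s : ℝ} (hs : s ∈ Ioo 0 T) :
    Continuous (G s) := by
  have := hG.comp_continuous (f := fun y : V => (s, y)) (by fun_prop) (fun y => ⟨hs, mem_univ _⟩)
  exact this

lemma norm_duhamel_le {B : W →L[ℝ] E →L[ℝ] F} {k : ℝ → V → W} {G : ℝ → V → E} {t : ℝ} {x : V}
    {c : ℝ → ℝ} (hc : IntegrableOn c (Ioo 0 t))
    (hb : ∀ r ∈ Ioo 0 t, ‖(k r ⋆[B] G (t - r)) x‖ ≤ c r) :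
    ‖duhamel B k G t x‖ ≤ ∫ r in Ioo 0 t, c r :=
  norm_integral_le_of_norm_le hc (ae_restrict_of_forall_mem measurableSet_Ioo hb)

namespace IsDuhamel

variable {B : W →L[ℝ] E →L[ℝ] F} {k : ℝ → V → W} {G : ℝ → V → E} {T : ℝ} {b : ℝ → ℝ}

lemma continuousAt_integrand (h : IsDuhamel B k G T b) {r t : ℝ} (hr : 0 < r) (hrt : r < t)
    (ht : t < T) (x : V) :
    ContinuousAt (fun p : ℝ × ℝ × V => (k p.1 ⋆[B] G (p.2.1 - p.1)) p.2.2) (r, t, x) := by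
  obtain ⟨M, hM⟩ := h.bdd
  have hr' : r ∈ Ioo 0 T := ⟨hr, hrt.trans ht⟩
  have e1 : ∀ᶠ p : ℝ × ℝ × V in 𝓝 (r, t, x), p.1 ∈ Ioo 0 T :=
    (continuous_fst.tendsto (r, t, x)).eventually (Ioo_mem_nhds hr'.1 hr'.2)
  have hc : Continuous fun p : ℝ × ℝ × V => p.2.1 - p.1 := by fun_prop
  have hs : t - r ∈ Ioo 0 T := ⟨by linarith, by linarith⟩
  have e2 : ∀ᶠ p : ℝ × ℝ × V in 𝓝 (r, t, x), p.2.1 - p.1 ∈ Ioo 0 T :=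
    (hc.tendsto (r, t, x)).eventually (Ioo_mem_nhds hs.1 hs.2)
  refine tendsto_convolution (M := M) h.norm_le_one ?_ (h.int r hr') ?_ ?_ ?_
  · filter_upwards [e1] with p hp using h.int _ hp
  · exact (h.l1_cont r hr').comp (continuous_fst.tendsto (r, t, x))
  · filter_upwards [e2] with p hp using ⟨continuous_slice h.cont hp, hM _ hp⟩
  · intro y
    have h1 : ContinuousAt (fun q : ℝ × V => G q.1 q.2) (t - r, x - y) :=
      h.cont.continuousAt (prod_mem_nhds (Ioo_mem_nhds hs.1 hs.2) univ_mem)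
    have h2 : Continuous fun p : ℝ × ℝ × V => (p.2.1 - p.1, p.2.2 - y) := by fun_prop
    exact h1.tendsto.comp (h2.tendsto (r, t, x))

lemma continuousOn_integrand (h : IsDuhamel B k G T b) {t : ℝ} (ht : t < T) :
    ContinuousOn (fun p : ℝ × V => (k p.1 ⋆[B] G (t - p.1)) p.2) (Ioo 0 t ×ˢ univ) := by
  rintro ⟨r, x⟩ ⟨hr, -⟩
  refine ContinuousAt.continuousWithinAt ?_
  have h2 : Continuous fun p : ℝ × V => (p.1, t, p.2) := by fun_prop
  exact ContinuousAt.comp (f := fun p : ℝ × V => (p.1, t, p.2))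
    (g := fun p : ℝ × ℝ × V => (k p.1 ⋆[B] G (p.2.1 - p.1)) p.2.2)
    (h.continuousAt_integrand hr.1 hr.2 ht x) h2.continuousAt

lemma integrableOn (h : IsDuhamel B k G T b) {t : ℝ} (ht : t < T) (x : V) :
    IntegrableOn (fun r => (k r ⋆[B] G (t - r)) x) (Ioo 0 t) := by
  have hc : ContinuousOn (fun r => (k r ⋆[B] G (t - r)) x) (Ioo 0 t) :=
    (h.continuousOn_integrand ht).comp (f := fun r : ℝ => (r, x)) (by fun_prop)
      fun r hr => ⟨hr, mem_univ _⟩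
  refine Integrable.mono' (h.int_bound.mono_set (Ioo_subset_Ioo_right ht.le))
    (hc.aestronglyMeasurable measurableSet_Ioo) ?_
  exact ae_restrict_of_forall_mem measurableSet_Ioo fun r hr => h.bound r t hr.1 hr.2 ht x

lemma duhamel_sub (h : IsDuhamel B k G T b) {G' : ℝ → V → E} {b' : ℝ → ℝ}
    (h' : IsDuhamel B k G' T b') {t : ℝ} (ht : t < T) (x x' : V) :
    duhamel B k G t x - duhamel B k G' t x'
      = duhamel B k (fun s y => G s y - G' s (y + (x' - x))) t x := by
  obtain ⟨M, hM⟩ := h.bdd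
  obtain ⟨M', hM'⟩ := h'.bdd
  rw [duhamel, duhamel, ← integral_sub (h.integrableOn ht x) (h'.integrableOn ht x')]
  refine setIntegral_congr_fun measurableSet_Ioo fun r hr => ?_
  have hs : t - r ∈ Ioo 0 T := ⟨by linarith [hr.2], by linarith [hr.1]⟩
  exact convolution_sub_right B (h.int r ⟨hr.1, hr.2.trans ht⟩) (continuous_slice h.cont hs)
    (continuous_slice h'.cont hs) (hM _ hs) (hM' _ hs) x x'

lemma continuousOn_duhamel (h : IsDuhamel B k G T b) :
    ContinuousOn (fun q : ℝ × V => duhamel B k G q.1 q.2) (Ioo 0 T ×ˢ univ) := by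
  rintro ⟨t, x⟩ ⟨ht, -⟩
  refine ContinuousAt.continuousWithinAt ?_
  have hq : ∀ᶠ q : ℝ × V in 𝓝 (t, x), q.1 ∈ Ioo 0 T :=
    (continuous_fst.tendsto (t, x)).eventually (Ioo_mem_nhds ht.1 ht.2)
  have e : ∀ q : ℝ × V, q.1 ∈ Ioo 0 T → duhamel B k G q.1 q.2
      = ∫ r in Ioo 0 T, (Iio q.1).indicator (fun r => (k r ⋆[B] G (q.1 - r)) q.2) r := by
    intro q hq
    rw [setIntegral_indicator measurableSet_Iio, Ioo_inter_Iio, min_eq_right hq.2.le, duhamel]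
  have hcont : ContinuousAt (fun q : ℝ × V =>
      ∫ r in Ioo 0 T, (Iio q.1).indicator (fun r => (k r ⋆[B] G (q.1 - r)) q.2) r) (t, x) := by
    refine continuousAt_of_dominated (bound := fun r => ‖b r‖) ?_ ?_ h.int_bound.norm ?_
    · filter_upwards [hq] with q hq
      rw [aestronglyMeasurable_indicator_iff measurableSet_Iio,
        Measure.restrict_restrict measurableSet_Iio, Iio_inter_Ioo, min_eq_left hq.2.le]
      exact (h.integrableOn hq.2 q.2).aestronglyMeasurable
    · filter_upwards [hq] with q hq
      refine ae_restrict_of_forall_mem measurableSet_Ioo fun r hr => ?_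
      by_cases hrq : r < q.1
      · rw [indicator_of_mem (by exact hrq)]
        exact (h.bound r q.1 hr.1 hrq hq.2 q.2).trans (le_abs_self _)
      · rw [indicator_of_notMem (by exact hrq)]
        simp
    · have hne : ∀ᵐ r : ℝ ∂(volume.restrict (Ioo 0 T)), r ≠ t :=
        ae_restrict_of_ae (Measure.ae_ne volume t)
      filter_upwards [hne, ae_restrict_mem measurableSet_Ioo] with r hr hr0
      rcases lt_or_gt_of_ne hr with hrt | hrt
      · have h1 : ContinuousAt (fun q : ℝ × V => (k r ⋆[B] G (q.1 - r)) q.2) (t, x) := by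
          have h2 : Continuous fun q : ℝ × V => (r, q.1, q.2) := by fun_prop
          exact ContinuousAt.comp (f := fun q : ℝ × V => (r, q.1, q.2))
            (g := fun p : ℝ × ℝ × V => (k p.1 ⋆[B] G (p.2.1 - p.1)) p.2.2)
            (h.continuousAt_integrand hr0.1 hrt ht.2 x) h2.continuousAt
        refine h1.congr ?_
        filter_upwards [(continuous_fst.tendsto (t, x)).eventually (lt_mem_nhds hrt)] with q hq
        rw [indicator_of_mem (by exact hq)]
      · refine continuousAt_const.congr (f := fun _ => (0 : F)) ?_
        filter_upwards [(continuous_fst.tendsto (t, x)).eventually (gt_mem_nhds hrt)] with q hq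
        rw [indicator_of_notMem (by simpa using hq.le)]
  refine hcont.congr ?_
  filter_upwards [hq] with q hq using (e q hq).symm

/-- Differentiation of a Duhamel integral under the integral sign. -/
lemma hasFDerivAt_duhamel (h : IsDuhamel B k G T b) {B' : W' →L[ℝ] E →L[ℝ] V →L[ℝ] F}
    {k' : ℝ → V → W'} {b' : ℝ → ℝ} (h' : IsDuhamel B' k' G T b') {t : ℝ} (ht : t < T)
    (hd : ∀ r ∈ Ioo 0 t, ∀ x, HasFDerivAt (k r ⋆[B] G (t - r)) ((k' r ⋆[B'] G (t - r)) x) x)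
    (x : V) : HasFDerivAt (duhamel B k G t) (duhamel B' k' G t x) x := by
  refine hasFDerivAt_integral_of_dominated_of_fderiv_le (s := univ)
    (F' := fun x r => (k' r ⋆[B'] G (t - r)) x) (bound := b') univ_mem
    (Eventually.of_forall fun y => (h.integrableOn ht y).aestronglyMeasurable)
    (h.integrableOn ht x) (h'.integrableOn ht x).aestronglyMeasurable
    (ae_restrict_of_forall_mem measurableSet_Ioo fun r hr y _ => h'.bound r t hr.1 hr.2 ht y)
    (h'.int_bound.mono_set (Ioo_subset_Ioo_right ht.le))
    (ae_restrict_of_forall_mem measurableSet_Ioo fun r hr y _ => hd r hr y)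

end IsDuhamel

/-! ### The singular weight `r ^ (-1 / σ)` -/

lemma integrableOn_singular {σ : ℝ} (hσ : 1 < σ) (T : ℝ) :
    IntegrableOn (fun r : ℝ => r ^ (-(1 / σ))) (Ioo 0 T) := by
  rcases le_or_gt T 0 with hT | hT
  · simp [Ioo_eq_empty_of_le hT]
  · rw [intervalIntegral.integrableOn_Ioo_rpow_iff hT]
    have : 1 / σ < 1 := by rw [div_lt_one (by linarith)]; exact hσ
    linarith

/-- The Laplace transform of the singular weight tends to zero, so that Duhamel operators are
contractions in norms with the exponential weight `exp (-lam * t)` for large `lam`. -/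
def singularWeight (σ T lam : ℝ) : ℝ := ∫ r in Ioo 0 T, r ^ (-(1 / σ)) * Real.exp (-lam * r)

lemma integrableOn_singular_exp {σ : ℝ} (hσ : 1 < σ) (T : ℝ) {lam : ℝ} (hl : 0 ≤ lam) :
    IntegrableOn (fun r : ℝ => r ^ (-(1 / σ)) * Real.exp (-lam * r)) (Ioo 0 T) := by
  refine Integrable.mono' (integrableOn_singular hσ T) ?_ ?_
  · exact (integrableOn_singular hσ T).aestronglyMeasurable.mul
      (by fun_prop : Continuous fun r : ℝ => Real.exp (-lam * r)).aestronglyMeasurable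
  · refine ae_restrict_of_forall_mem measurableSet_Ioo fun r hr => ?_
    have h1 : 0 ≤ r ^ (-(1 / σ)) := Real.rpow_nonneg hr.1.le _
    rw [Real.norm_of_nonneg (by positivity)]
    refine mul_le_of_le_one_right h1 (Real.exp_le_one_iff.2 ?_)
    nlinarith [hr.1]

lemma singularWeight_nonneg (σ T lam : ℝ) : 0 ≤ singularWeight σ T lam :=
  setIntegral_nonneg measurableSet_Ioo fun r hr =>
    mul_nonneg (Real.rpow_nonneg hr.1.le _) (Real.exp_pos _).le

lemma tendsto_singularWeight {σ : ℝ} (hσ : 1 < σ) (T : ℝ) :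
    Tendsto (singularWeight σ T) atTop (𝓝 0) := by
  have : Tendsto (singularWeight σ T) atTop (𝓝 (∫ _ in Ioo 0 T, (0 : ℝ))) := by
    refine tendsto_integral_filter_of_dominated_convergence (fun r : ℝ => r ^ (-(1 / σ))) ?_ ?_
      (integrableOn_singular hσ T) ?_
    · filter_upwards [eventually_ge_atTop 0] with lam hl
      exact (integrableOn_singular_exp hσ T hl).aestronglyMeasurable
    · filter_upwards [eventually_ge_atTop 0] with lam hl
      refine ae_restrict_of_forall_mem measurableSet_Ioo fun r hr => ?_
      have h1 : 0 ≤ r ^ (-(1 / σ)) := Real.rpow_nonneg hr.1.le _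
      rw [Real.norm_of_nonneg (by positivity)]
      refine mul_le_of_le_one_right h1 (Real.exp_le_one_iff.2 ?_)
      nlinarith [hr.1]
    · refine ae_restrict_of_forall_mem measurableSet_Ioo fun r hr => ?_
      have h2 : Tendsto (fun lam : ℝ => Real.exp (-lam * r)) atTop (𝓝 0) := by
        refine Real.tendsto_exp_atBot.comp ?_
        exact tendsto_neg_atTop_atBot.atBot_mul_const hr.1
      simpa using h2.const_mul (r ^ (-(1 / σ)))
  simpa using this

/-! ### Duhamel integrals of the heat semigroup -/

namespace IsHeatFamily

variable {K : ℝ → V → ℝ} {σ T κ : ℝ} {G : ℝ → V → E} {M : ℝ}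

lemma isDuhamel (hK : IsHeatFamily K σ T κ)
    (hG : ContinuousOn (fun q : ℝ × V => G q.1 q.2) (Ioo 0 T ×ˢ univ))
    (hM : ∀ s ∈ Ioo 0 T, ∀ y, ‖G s y‖ ≤ M) :
    IsDuhamel (smulB E) K G T (fun _ => M) where
  norm_le_one := norm_smulB_le
  int := hK.int0
  l1_cont := hK.l1_cont
  cont := hG
  bdd := ⟨M, hM⟩
  int_bound := by simp
  bound r t hr hrt ht x := hK.norm_convolution_le ⟨hr, hrt.trans ht⟩
    (hM _ ⟨by linarith, by linarith⟩) x

lemma isDuhamel_fderiv (hK : IsHeatFamily K σ T κ) (hσ : 1 < σ)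
    (hG : ContinuousOn (fun q : ℝ × V => G q.1 q.2) (Ioo 0 T ×ˢ univ))
    (hM : ∀ s ∈ Ioo 0 T, ∀ y, ‖G s y‖ ≤ M) :
    IsDuhamel (smulB₁ V E) (fun t => fderiv ℝ (K t)) G T (fun r => κ * r ^ (-(1 / σ)) * M) where
  norm_le_one := norm_smulB₁_le
  int := hK.int1
  l1_cont _ h := hK.l1_cont_fderiv h
  cont := hG
  bdd := ⟨M, hM⟩
  int_bound := ((integrableOn_singular hσ T).const_mul κ).mul_const M
  bound r t hr hrt ht x := hK.norm_convolution_fderiv_le ⟨hr, hrt.trans ht⟩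
    (hM _ ⟨by linarith, by linarith⟩) x

lemma isDuhamel_fderiv_fderiv (hK : IsHeatFamily K σ T κ) (hσ : 1 < σ)
    (hG : ContinuousOn (fun q : ℝ × V => G q.1 q.2) (Ioo 0 T ×ˢ univ))
    (hM : ∀ s ∈ Ioo 0 T, ∀ y, ‖G s y‖ ≤ M) {A : ℝ} (hA0 : 0 ≤ A)
    (hA : ∀ s ∈ Ioo 0 T, ∀ x y, ‖G s x - G s y‖ ≤ A * ‖x - y‖) :
    IsDuhamel (smulB₂ V E) (fun t => fderiv ℝ (fderiv ℝ (K t))) G T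
      (fun r => κ * r ^ (-(1 / σ)) * A) where
  norm_le_one := norm_smulB₂_le
  int := hK.int2
  l1_cont _ h := hK.l1_cont_fderiv_fderiv h
  cont := hG
  bdd := ⟨M, hM⟩
  int_bound := ((integrableOn_singular hσ T).const_mul κ).mul_const A
  bound r t hr hrt ht x :=
    have hs : t - r ∈ Ioo 0 T := ⟨by linarith, by linarith⟩
    hK.norm_convolution_fderiv_fderiv_le ⟨hr, hrt.trans ht⟩ (continuous_slice hG hs)
      (hM _ hs) (hA _ hs) hA0 x

lemma hasFDerivAt_duhamel (hK : IsHeatFamily K σ T κ) (hσ : 1 < σ)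
    (hG : ContinuousOn (fun q : ℝ × V => G q.1 q.2) (Ioo 0 T ×ˢ univ))
    (hM : ∀ s ∈ Ioo 0 T, ∀ y, ‖G s y‖ ≤ M) {t : ℝ} (ht : t < T) (x : V) :
    HasFDerivAt (duhamel (smulB E) K G t)
      (duhamel (smulB₁ V E) (fun t => fderiv ℝ (K t)) G t x) x := by
  refine (hK.isDuhamel hG hM).hasFDerivAt_duhamel (hK.isDuhamel_fderiv hσ hG hM) ht
    (fun r hr y => ?_) x
  have hs : t - r ∈ Ioo 0 T := ⟨by linarith [hr.2], by linarith [hr.1]⟩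
  exact hK.hasFDerivAt_convolution ⟨hr.1, hr.2.trans ht⟩ (continuous_slice hG hs) (hM _ hs) y

lemma hasFDerivAt_duhamel_fderiv (hK : IsHeatFamily K σ T κ) (hσ : 1 < σ)
    (hG : ContinuousOn (fun q : ℝ × V => G q.1 q.2) (Ioo 0 T ×ˢ univ))
    (hM : ∀ s ∈ Ioo 0 T, ∀ y, ‖G s y‖ ≤ M) {A : ℝ} (hA0 : 0 ≤ A)
    (hA : ∀ s ∈ Ioo 0 T, ∀ x y, ‖G s x - G s y‖ ≤ A * ‖x - y‖) {t : ℝ} (ht : t < T) (x : V) :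
    HasFDerivAt (duhamel (smulB₁ V E) (fun t => fderiv ℝ (K t)) G t)
      (duhamel (smulB₂ V E) (fun t => fderiv ℝ (fderiv ℝ (K t))) G t x) x := by
  refine (hK.isDuhamel_fderiv hσ hG hM).hasFDerivAt_duhamel
    (hK.isDuhamel_fderiv_fderiv hσ hG hM hA0 hA) ht (fun r hr y => ?_) x
  have hs : t - r ∈ Ioo 0 T := ⟨by linarith [hr.2], by linarith [hr.1]⟩
  exact hK.hasFDerivAt_convolution_fderiv ⟨hr.1, hr.2.trans ht⟩ (continuous_slice hG hs) (hM _ hs) y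

lemma kappa_nonneg (hK : IsHeatFamily K σ T κ) (hT : 0 < T) : 0 ≤ κ := by
  have h := (integral_nonneg fun _ => norm_nonneg _).trans
    (hK.grad_bound (T / 2) ⟨by linarith, by linarith⟩)
  exact nonneg_of_mul_nonneg_left h (Real.rpow_pos_of_pos (by linarith) _)

/-- The gradient Duhamel operator in an exponentially weighted supremum norm. -/
lemma norm_duhamel_fderiv_le (hK : IsHeatFamily K σ T κ) (hσ : 1 < σ) {lam A : ℝ}
    (hl : 0 ≤ lam) (hA : 0 ≤ A) (hG : ∀ s ∈ Ioo 0 T, ∀ y, ‖G s y‖ ≤ A * Real.exp (lam * s))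
    {t : ℝ} (ht : t ∈ Ioo 0 T) (x : V) :
    ‖duhamel (smulB₁ V E) (fun t => fderiv ℝ (K t)) G t x‖
      ≤ κ * singularWeight σ T lam * A * Real.exp (lam * t) := by
  have hκ := hK.kappa_nonneg (ht.1.trans ht.2)
  have hi : IntegrableOn (fun r => κ * (r ^ (-(1 / σ)) * Real.exp (-lam * r))
      * (A * Real.exp (lam * t))) (Ioo 0 T) :=
    ((integrableOn_singular_exp hσ T hl).const_mul κ).mul_const (A * Real.exp (lam * t))
  refine (norm_duhamel_le (hi.mono_set (Ioo_subset_Ioo_right ht.2.le)) fun r hr => ?_).trans ?_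
  · have hs : t - r ∈ Ioo 0 T := ⟨by linarith [hr.2], by linarith [hr.1, ht.2]⟩
    refine (hK.norm_convolution_fderiv_le ⟨hr.1, hr.2.trans ht.2⟩ (hG _ hs) x).trans (le_of_eq ?_)
    have : Real.exp (lam * (t - r)) = Real.exp (-lam * r) * Real.exp (lam * t) := by
      rw [← Real.exp_add]; ring_nf
    rw [this]; ring
  · refine (setIntegral_mono_set hi ?_ (Ioo_subset_Ioo_right ht.2.le).eventuallyLE).trans ?_
    · refine ae_restrict_of_forall_mem measurableSet_Ioo fun r hr => ?_
      have h1 : 0 ≤ r ^ (-(1 / σ)) := Real.rpow_nonneg hr.1.le _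
      simp only [Pi.zero_apply]
      positivity
    · rw [integral_mul_const, integral_const_mul, singularWeight, mul_assoc (κ * _)]

/-- The Duhamel operator in an exponentially weighted supremum norm. -/
lemma norm_duhamel_le (hK : IsHeatFamily K σ T κ) {lam A : ℝ}
    (hl : 0 < lam) (hA : 0 ≤ A) (hG : ∀ s ∈ Ioo 0 T, ∀ y, ‖G s y‖ ≤ A * Real.exp (lam * s))
    {t : ℝ} (ht : t ∈ Ioo 0 T) (x : V) :
    ‖duhamel (smulB E) K G t x‖ ≤ lam⁻¹ * A * Real.exp (lam * t) := by
  have hint : IntegrableOn (fun r => A * Real.exp (lam * (t - r))) (Ioo 0 t) :=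
    ((by fun_prop : Continuous fun r => A * Real.exp (lam * (t - r))).integrableOn_Icc).mono_set
      Ioo_subset_Icc_self
  refine (FracHJB.norm_duhamel_le hint fun r hr => ?_).trans ?_
  · have hs : t - r ∈ Ioo 0 T := ⟨by linarith [hr.2], by linarith [hr.1, ht.2]⟩
    exact hK.norm_convolution_le ⟨hr.1, hr.2.trans ht.2⟩ (hG _ hs) x
  · rw [← integral_Ioc_eq_integral_Ioo, ← intervalIntegral.integral_of_le ht.1.le]
    have hd : ∀ r ∈ uIcc 0 t, HasDerivAt (fun r => -(lam⁻¹ * A * Real.exp (lam * (t - r))))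
        (A * Real.exp (lam * (t - r))) r := by
      intro r _
      have h1 : HasDerivAt (fun r => lam * (t - r)) (-lam) r := by
        simpa using ((hasDerivAt_id r).const_sub t).const_mul lam
      have e : A * Real.exp (lam * (t - r))
          = -(lam⁻¹ * A * (Real.exp (lam * (t - r)) * -lam)) := by
        have := hl.ne'
        field_simp
      rw [e]
      exact (h1.exp.const_mul (lam⁻¹ * A)).neg
    rw [intervalIntegral.integral_eq_sub_of_hasDerivAt hd
      ((by fun_prop : Continuous fun r => A * Real.exp (lam * (t - r))).intervalIntegrable _ _)]
    simp only [sub_self, mul_zero, Real.exp_zero, mul_one, sub_zero, neg_sub_neg]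
    have : 0 ≤ lam⁻¹ * A := by positivity
    linarith

end IsHeatFamily

end Duhamel

open scoped Convolution BoundedContinuousFunction

/-! ### Mild solutions of semilinear equations -/

section Mild

variable {V E : Type*} [NormedAddCommGroup V] [InnerProductSpace ℝ V]
  [FiniteDimensional ℝ V] [MeasurableSpace V] [BorelSpace V]
  [NormedAddCommGroup E] [NormedSpace ℝ E]

lemma IsHeatFamily.continuousOn_convolution {K : ℝ → V → ℝ} {σ T κ : ℝ}
    (hK : IsHeatFamily K σ T κ) {g : V → E} (hg : Continuous g) {M : ℝ} (hM : ∀ y, ‖g y‖ ≤ M) :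
    ContinuousOn (fun q : ℝ × V => (K q.1 ⋆[smulB E] g) q.2) (Ioo 0 T ×ˢ univ) := by
  rintro ⟨t, x⟩ ⟨ht, -⟩
  refine ContinuousAt.continuousWithinAt ?_
  refine tendsto_convolution (g := fun _ : ℝ × V => g) (M := M) norm_smulB_le ?_ (hK.int0 t ht) ?_
    (Eventually.of_forall fun _ => ⟨hg, hM⟩) fun y => ?_
  · filter_upwards [(continuous_fst.tendsto (t, x)).eventually (Ioo_mem_nhds ht.1 ht.2)] with q hq
      using hK.int0 _ hq
  · exact (hK.l1_cont t ht).comp (continuous_fst.tendsto (t, x))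
  · have h2 : Continuous fun p : ℝ × V => g (p.2 - y) := by fun_prop
    exact h2.tendsto (t, x)

/-- A mild solution, in `C¹`, of the semilinear equation with nonlinearity `N s y (u, Du)`. -/
structure IsMild (K : ℝ → V → ℝ) (T : ℝ) (N : ℝ → V → ℝ × (V →L[ℝ] ℝ) → ℝ) (u₀ : V → ℝ)
    (u : ℝ → V → ℝ) (v : ℝ → V → V →L[ℝ] ℝ) : Prop where
  cont : ContinuousOn (fun q : ℝ × V => u q.1 q.2) (Ioo 0 T ×ˢ univ)
  cont_grad : ContinuousOn (fun q : ℝ × V => v q.1 q.2) (Ioo 0 T ×ˢ univ)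
  eq : ∀ t ∈ Ioo 0 T, ∀ x, u t x = (K t ⋆[smulB ℝ] u₀) x
    + duhamel (smulB ℝ) K (fun s y => N s y (u s y, v s y)) t x
  eq_grad : ∀ t ∈ Ioo 0 T, ∀ x, v t x = (K t ⋆[smulB (V →L[ℝ] ℝ)] fderiv ℝ u₀) x
    + duhamel (smulB₁ V ℝ) (fun t => fderiv ℝ (K t)) (fun s y => N s y (u s y, v s y)) t x

/-- Existence of a global mild solution for a bounded nonlinearity that is Lipschitz in `(u, Du)`:
the Duhamel map is a contraction in a supremum norm with exponential weight in time. -/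
theorem IsHeatFamily.exists_isMild {K : ℝ → V → ℝ} {σ T κ : ℝ} (hK : IsHeatFamily K σ T κ)
    (hT : 0 < T) (hσ : 1 < σ) {N : ℝ → V → ℝ × (V →L[ℝ] ℝ) → ℝ} {M C : ℝ}
    (hN : ContinuousOn (fun q : ℝ × V × (ℝ × (V →L[ℝ] ℝ)) => N q.1 q.2.1 q.2.2)
      (Ioo 0 T ×ˢ univ))
    (hM : ∀ s ∈ Ioo 0 T, ∀ y a, ‖N s y a‖ ≤ M) (hC0 : 0 ≤ C)
    (hC : ∀ s ∈ Ioo 0 T, ∀ y a b, ‖N s y a - N s y b‖ ≤ C * ‖a - b‖)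
    {u₀ : V → ℝ} (hu₀ : ContDiff ℝ 1 u₀) {M₀ : ℝ} (hM₀ : ∀ x, ‖u₀ x‖ ≤ M₀)
    (hM₁ : ∀ x, ‖fderiv ℝ u₀ x‖ ≤ M₀) :
    ∃ u v, IsMild K T N u₀ u v := by
  have hκ := hK.kappa_nonneg hT
  have hM0 : 0 ≤ M := (norm_nonneg _).trans (hM (T / 2) ⟨by linarith, by linarith⟩ 0 0)
  have hdu₀ : Continuous (fderiv ℝ u₀) := hu₀.continuous_fderiv one_ne_zero
  -- the weight is chosen so that both components of the Duhamel map contract by the factor `1 / 2`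
  obtain ⟨lam, hl1, hl2, hl0⟩ : ∃ lam : ℝ, lam⁻¹ * C ≤ 1 / 2 ∧
      κ * singularWeight σ T lam * C ≤ 1 / 2 ∧ 0 < lam := by
    have t1 : Tendsto (fun lam : ℝ => lam⁻¹ * C) atTop (𝓝 0) := by
      simpa using tendsto_inv_atTop_zero.mul_const C
    have t2 : Tendsto (fun lam : ℝ => κ * singularWeight σ T lam * C) atTop (𝓝 0) := by
      simpa using ((tendsto_singularWeight hσ T).const_mul κ).mul_const C
    exact ((t1.eventually (ge_mem_nhds (by norm_num : (0 : ℝ) < 1 / 2))).and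
      ((t2.eventually (ge_mem_nhds (by norm_num : (0 : ℝ) < 1 / 2))).and
        (eventually_gt_atTop 0))).exists
  set S : Set (ℝ × V) := Ioo 0 T ×ˢ univ with hS
  let Y := ℝ × (V →L[ℝ] ℝ)
  -- a bounded continuous `w` on `S` stands for the pair `(u, Du) = exp (lam * t) • w`, so that the
  -- supremum norm of `w` is the weighted norm of the pair
  let ext : (S →ᵇ Y) → ℝ × V → Y := by
    classical
    exact fun w q => if h : q ∈ S then Real.exp (lam * q.1) • w ⟨q, h⟩ else 0
  have ext_of : ∀ (w : S →ᵇ Y) (q : ℝ × V) (h : q ∈ S),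
      ext w q = Real.exp (lam * q.1) • w ⟨q, h⟩ := fun w q h => dif_pos h
  have ext_cont : ∀ w, ContinuousOn (ext w) S := by
    intro w
    rw [continuousOn_iff_continuous_domRestrict]
    have : S.domRestrict (ext w) = fun z : S => Real.exp (lam * z.1.1) • w z :=
      funext fun z => ext_of w z.1 z.2
    rw [this]
    fun_prop
  let src : (S →ᵇ Y) → ℝ → V → ℝ := fun w s y => N s y (ext w (s, y))
  have src_cont : ∀ w, ContinuousOn (fun q : ℝ × V => src w q.1 q.2) S := by
    intro w
    have h1 : ContinuousOn (fun q : ℝ × V => (q.1, q.2, ext w q)) S :=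
      continuousOn_fst.prodMk (continuousOn_snd.prodMk (ext_cont w))
    exact hN.comp h1 fun q hq => ⟨hq.1, mem_univ _⟩
  have src_bdd : ∀ w, ∀ s ∈ Ioo 0 T, ∀ y, ‖src w s y‖ ≤ M := fun w s hs y => hM s hs y _
  have src_lip : ∀ w w', ∀ s ∈ Ioo 0 T, ∀ y,
      ‖src w s y - src w' s y‖ ≤ C * dist w w' * Real.exp (lam * s) := by
    intro w w' s hs y
    have hq : (s, y) ∈ S := ⟨hs, mem_univ _⟩
    refine (hC s hs y _ _).trans ?_
    rw [ext_of w _ hq, ext_of w' _ hq, ← smul_sub, norm_smul, Real.norm_of_nonneg (Real.exp_pos _).le,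
      ← dist_eq_norm, mul_assoc C, mul_comm (dist w w')]
    gcongr
    exact BoundedContinuousFunction.dist_coe_le_dist _
  let Φ : (S →ᵇ Y) → ℝ × V → Y := fun w q =>
    ((K q.1 ⋆[smulB ℝ] u₀) q.2 + duhamel (smulB ℝ) K (src w) q.1 q.2,
      (K q.1 ⋆[smulB (V →L[ℝ] ℝ)] fderiv ℝ u₀) q.2
        + duhamel (smulB₁ V ℝ) (fun t => fderiv ℝ (K t)) (src w) q.1 q.2)
  have hD := fun w => hK.isDuhamel (src_cont w) (src_bdd w)
  have hD1 := fun w => hK.isDuhamel_fderiv hσ (src_cont w) (src_bdd w)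
  have Φ_cont : ∀ w, ContinuousOn (Φ w) S := fun w =>
    ((hK.continuousOn_convolution hu₀.continuous hM₀).add (hD w).continuousOn_duhamel).prodMk
      ((hK.continuousOn_convolution hdu₀ hM₁).add (hD1 w).continuousOn_duhamel)
  have exp_le : ∀ s ∈ Ioo 0 T, (1 : ℝ) ≤ Real.exp (lam * s) := fun s hs =>
    Real.one_le_exp (mul_nonneg hl0.le hs.1.le)
  have Φ_bdd : ∃ R, ∀ w, ∀ q ∈ S, ‖Φ w q‖ ≤ R := by
    refine ⟨max (M₀ + lam⁻¹ * M * Real.exp (lam * T))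
      (M₀ + κ * singularWeight σ T lam * M * Real.exp (lam * T)), fun w q hq => ?_⟩
    have hs : ∀ s ∈ Ioo 0 T, ∀ y, ‖src w s y‖ ≤ M * Real.exp (lam * s) := fun s hs y =>
      (src_bdd w s hs y).trans (le_mul_of_one_le_right hM0 (exp_le s hs))
    have e : Real.exp (lam * q.1) ≤ Real.exp (lam * T) := by
      have := hq.1.2
      gcongr
    have hq1 := singularWeight_nonneg σ T lam
    refine max_le_max ?_ ?_
    · refine (norm_add_le _ _).trans (add_le_add (hK.norm_convolution_le hq.1 hM₀ _) ?_)
      refine (hK.norm_duhamel_le hl0 hM0 hs hq.1 _).trans ?_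
      gcongr
    · refine (norm_add_le _ _).trans (add_le_add (hK.norm_convolution_le hq.1 hM₁ _) ?_)
      refine (hK.norm_duhamel_fderiv_le hσ hl0.le hM0 hs hq.1 _).trans ?_
      gcongr
  obtain ⟨R, hR⟩ := Φ_bdd
  let Ψ : (S →ᵇ Y) → (S →ᵇ Y) := fun w =>
    BoundedContinuousFunction.ofNormedAddCommGroup
      (fun z : S => Real.exp (-(lam * z.1.1)) • Φ w z.1)
      (by
        have h1 := continuousOn_iff_continuous_domRestrict.1 (Φ_cont w)
        have h2 : Continuous fun z : S => Real.exp (-(lam * z.1.1)) := by fun_prop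
        exact h2.smul h1) R
      (fun z => by
        rw [norm_smul, Real.norm_of_nonneg (Real.exp_pos _).le]
        refine (mul_le_of_le_one_left (norm_nonneg _) (Real.exp_le_one_iff.2 ?_)).trans (hR w _ z.2)
        have := z.2.1.1
        have : 0 ≤ lam * z.1.1 := by positivity
        linarith)
  have hΨ : ContractingWith (1 / 2 : NNReal) Ψ := by
    refine ⟨by rw [← NNReal.coe_lt_coe]; norm_num, LipschitzWith.of_dist_le_mul fun w w' => ?_⟩
    rw [BoundedContinuousFunction.dist_le (by positivity)]
    rintro ⟨⟨t, x⟩, hq⟩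
    have ht : t ∈ Ioo 0 T := hq.1
    have hdist : (0 : ℝ) ≤ dist w w' := dist_nonneg
    have hsub : ∀ s ∈ Ioo 0 T, ∀ y, ‖src w s y - src w' s (y + (x - x))‖
        ≤ C * dist w w' * Real.exp (lam * s) := fun s hs y => by simpa using src_lip w w' s hs y
    have hΦ : ‖Φ w (t, x) - Φ w' (t, x)‖ ≤ 1 / 2 * dist w w' * Real.exp (lam * t) := by
      have e : Φ w (t, x) - Φ w' (t, x)
          = (duhamel (smulB ℝ) K (src w) t x - duhamel (smulB ℝ) K (src w') t x,
            duhamel (smulB₁ V ℝ) (fun t => fderiv ℝ (K t)) (src w) t x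
              - duhamel (smulB₁ V ℝ) (fun t => fderiv ℝ (K t)) (src w') t x) :=
        Prod.ext (add_sub_add_left_eq_sub _ _ _) (add_sub_add_left_eq_sub _ _ _)
      rw [e, (hD w).duhamel_sub (hD w') ht.2, (hD1 w).duhamel_sub (hD1 w') ht.2]
      have hexp := Real.exp_pos (lam * t)
      refine max_le ?_ ?_
      · refine (hK.norm_duhamel_le hl0 (by positivity) hsub ht _).trans ?_
        rw [← mul_assoc]
        gcongr
      · refine (hK.norm_duhamel_fderiv_le hσ hl0.le (by positivity) hsub ht _).trans ?_
        rw [← mul_assoc]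
        gcongr
    rw [dist_eq_norm]
    change ‖Real.exp (-(lam * t)) • Φ w (t, x) - Real.exp (-(lam * t)) • Φ w' (t, x)‖ ≤ _
    rw [← smul_sub, norm_smul, Real.norm_of_nonneg (Real.exp_pos _).le]
    calc Real.exp (-(lam * t)) * ‖Φ w (t, x) - Φ w' (t, x)‖
        ≤ Real.exp (-(lam * t)) * (1 / 2 * dist w w' * Real.exp (lam * t)) := by gcongr
      _ = 1 / 2 * dist w w' := by
          rw [mul_comm, mul_assoc, ← Real.exp_add]; simp
      _ = _ := by simp
  have hfix : Ψ (hΨ.fixedPoint Ψ) = hΨ.fixedPoint Ψ := hΨ.fixedPoint_isFixedPt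
  set w := hΨ.fixedPoint Ψ with hw
  have hext : ∀ q ∈ S, ext w q = Φ w q := by
    intro q hq
    rw [ext_of w q hq]
    conv_lhs => rw [← hfix]
    change Real.exp (lam * q.1) • Real.exp (-(lam * q.1)) • Φ w q = _
    rw [smul_smul, ← Real.exp_add]
    simp
  refine ⟨fun t x => (ext w (t, x)).1, fun t x => (ext w (t, x)).2, ?_, ?_, ?_, ?_⟩
  · exact continuous_fst.comp_continuousOn (ext_cont w)
  · exact continuous_snd.comp_continuousOn (ext_cont w)
  · intro t ht x
    exact congrArg Prod.fst (hext (t, x) ⟨ht, mem_univ _⟩)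
  · intro t ht x
    exact congrArg Prod.snd (hext (t, x) ⟨ht, mem_univ _⟩)

end Mild

/-! ### Regularity of mild solutions -/

section Regularity

variable {V E : Type*} [NormedAddCommGroup V] [InnerProductSpace ℝ V]
  [FiniteDimensional ℝ V] [MeasurableSpace V] [BorelSpace V]
  [NormedAddCommGroup E] [NormedSpace ℝ E]

/-- A bounded quantity whose every upper bound `B` improves to `a + B / 2` is at most `2 * a`. -/
lemma le_of_self_improving {ι : Type*} {f : ι → ℝ} {a : ℝ} (hb : BddAbove (range f))
    (h : ∀ B, (∀ i, f i ≤ B) → ∀ i, f i ≤ a + B / 2) (i : ι) : f i ≤ 2 * a := by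
  have : Nonempty ι := ⟨i⟩
  have h1 : ⨆ i, f i ≤ a + (⨆ i, f i) / 2 := ciSup_le (h _ (le_ciSup hb))
  linarith [le_ciSup hb i]

lemma IsHeatFamily.norm_mild_le {K : ℝ → V → ℝ} {σ T κ : ℝ} (hK : IsHeatFamily K σ T κ)
    (hσ : 1 < σ) {G : ℝ → V → E} {w₀ : V → V →L[ℝ] E} {C₀ M : ℝ} (hM0 : 0 ≤ M)
    (hw₀ : ∀ x, ‖w₀ x‖ ≤ C₀) (hM : ∀ s ∈ Ioo 0 T, ∀ y, ‖G s y‖ ≤ M) {t : ℝ} (ht : t ∈ Ioo 0 T)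
    (x : V) :
    ‖(K t ⋆[smulB (V →L[ℝ] E)] w₀) x + duhamel (smulB₁ V E) (fun t => fderiv ℝ (K t)) G t x‖
      ≤ C₀ + κ * singularWeight σ T 0 * M := by
  refine (norm_add_le _ _).trans (add_le_add (hK.norm_convolution_le ht hw₀ x) ?_)
  simpa using hK.norm_duhamel_fderiv_le hσ (le_refl (0 : ℝ)) hM0 (fun s hs y => by
    simpa using hM s hs y) ht x

/-- One step of regularity. If `w = S(t) w₀ + ∫ D S(t - s) G(s) ds` and the differences of `G` are
controlled by those of `w`, then `w` is Lipschitz in space with an explicit constant, by a Gronwall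
argument for the differences; consequently `G` is Lipschitz in space and `w` is `C¹`. -/
theorem exists_regularity_step (V E : Type*) [NormedAddCommGroup V] [InnerProductSpace ℝ V]
    [FiniteDimensional ℝ V] [MeasurableSpace V] [BorelSpace V]
    [NormedAddCommGroup E] [NormedSpace ℝ E]
    {σ T κ C : ℝ} (hσ : 1 < σ) (hC : 0 ≤ C) : ∃ Λ : ℝ, 0 ≤ Λ ∧
    ∀ (K : ℝ → V → ℝ) (_ : IsHeatFamily K σ T κ) (G : ℝ → V → E) (w₀ : V → V →L[ℝ] E)
      (w : ℝ → V → V →L[ℝ] E) (C₀ A M : ℝ), 0 ≤ A → ContDiff ℝ 1 w₀ →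
      (∀ x, ‖w₀ x‖ ≤ C₀) → (∀ x, ‖fderiv ℝ w₀ x‖ ≤ C₀) →
      ContinuousOn (fun q : ℝ × V => G q.1 q.2) (Ioo 0 T ×ˢ univ) →
      (∀ s ∈ Ioo 0 T, ∀ y, ‖G s y‖ ≤ M) →
      (∀ t ∈ Ioo 0 T, ∀ x, w t x = (K t ⋆[smulB (V →L[ℝ] E)] w₀) x
        + duhamel (smulB₁ V E) (fun t => fderiv ℝ (K t)) G t x) →
      (∀ s ∈ Ioo 0 T, ∀ x y, ‖G s x - G s y‖ ≤ A * ‖x - y‖ + C * ‖w s x - w s y‖) →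
      (∀ t ∈ Ioo 0 T, ∀ x y, ‖w t x - w t y‖ ≤ Λ * (C₀ + A) * ‖x - y‖) ∧
      (∀ t ∈ Ioo 0 T, ∀ x, HasFDerivAt (w t) ((K t ⋆[smulB (V →L[ℝ] V →L[ℝ] E)] fderiv ℝ w₀) x
        + duhamel (smulB₂ V E) (fun t => fderiv ℝ (fderiv ℝ (K t))) G t x) x) ∧
      ContinuousOn (fun q : ℝ × V => (K q.1 ⋆[smulB (V →L[ℝ] V →L[ℝ] E)] fderiv ℝ w₀) q.2
        + duhamel (smulB₂ V E) (fun t => fderiv ℝ (fderiv ℝ (K t))) G q.1 q.2)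
        (Ioo 0 T ×ˢ univ) := by
  -- with this weight the difference quotients of `w` reproduce themselves with factor `1 / 2`
  obtain ⟨lam, hl1, hl2, hl0⟩ : ∃ lam : ℝ, κ * singularWeight σ T lam ≤ 1 / 2 ∧
      κ * singularWeight σ T lam * C ≤ 1 / 2 ∧ 0 < lam := by
    have t1 : Tendsto (fun lam : ℝ => κ * singularWeight σ T lam) atTop (𝓝 0) := by
      simpa using ((tendsto_singularWeight hσ T).const_mul κ)
    have t2 : Tendsto (fun lam : ℝ => κ * singularWeight σ T lam * C) atTop (𝓝 0) := by
      simpa using t1.mul_const C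
    exact ((t1.eventually (ge_mem_nhds (by norm_num : (0 : ℝ) < 1 / 2))).and
      ((t2.eventually (ge_mem_nhds (by norm_num : (0 : ℝ) < 1 / 2))).and
        (eventually_gt_atTop 0))).exists
  refine ⟨2 * Real.exp (lam * T), by positivity, ?_⟩
  intro K hK G w₀ w C₀ A M hA hw₀ hC₀ hC₁ hG hM hw hGw
  have hC₀0 : 0 ≤ C₀ := (norm_nonneg _).trans (hC₀ 0)
  have hD := hK.isDuhamel_fderiv hσ hG hM
  have hdw₀ : Continuous (fderiv ℝ w₀) := hw₀.continuous_fderiv one_ne_zero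
  have hw₀lip : ∀ x y, ‖w₀ x - w₀ y‖ ≤ C₀ * ‖x - y‖ := fun x y =>
    convex_univ.norm_image_sub_le_of_norm_fderiv_le
      (fun z _ => (hw₀.differentiable one_ne_zero) z) (fun z _ => hC₁ z) (mem_univ _) (mem_univ _)
  have hlip : ∀ t ∈ Ioo 0 T, ∀ x y,
      ‖w t x - w t y‖ ≤ 2 * Real.exp (lam * T) * (C₀ + A) * ‖x - y‖ := by
    intro t₀ ht₀ x₀ y₀
    have hT : 0 < T := ht₀.1.trans ht₀.2
    have hM0 : 0 ≤ M := (norm_nonneg _).trans (hM t₀ ht₀ 0)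
    have hκ := hK.kappa_nonneg hT
    set h := y₀ - x₀ with hh
    let f : Ioo 0 T × V → ℝ := fun i =>
      Real.exp (-(lam * i.1.1)) * ‖w i.1.1 i.2 - w i.1.1 (i.2 + h)‖
    have hfb : BddAbove (range f) := by
      refine ⟨2 * (C₀ + κ * singularWeight σ T 0 * M), ?_⟩
      rintro _ ⟨⟨⟨t, ht⟩, x⟩, rfl⟩
      have hb : ∀ z, ‖w t z‖ ≤ C₀ + κ * singularWeight σ T 0 * M := fun z => by
        rw [hw t ht z]
        exact hK.norm_mild_le hσ hM0 hC₀ hM ht z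
      have h1 : Real.exp (-(lam * t)) ≤ 1 := by
        rw [Real.exp_le_one_iff]
        nlinarith [ht.1]
      refine (mul_le_of_le_one_left (norm_nonneg _) h1).trans ((norm_sub_le _ _).trans ?_)
      linarith [hb x, hb (x + h)]
    have himp : ∀ B, (∀ i, f i ≤ B) → ∀ i, f i ≤ (C₀ + A) * ‖h‖ + B / 2 := by
      rintro B hB ⟨⟨t, ht⟩, x⟩
      have hB0 : 0 ≤ B := le_trans (by positivity) (hB ⟨⟨t, ht⟩, x⟩)
      have hsrc : ∀ s ∈ Ioo 0 T, ∀ y, ‖G s y - G s (y + (x + h - x))‖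
          ≤ (A * ‖h‖ + C * B) * Real.exp (lam * s) := by
        intro s hs y
        rw [add_sub_cancel_left]
        have h1 : ‖w s y - w s (y + h)‖ ≤ B * Real.exp (lam * s) := by
          have := hB ⟨⟨s, hs⟩, y⟩
          simp only [f] at this
          rw [Real.exp_neg, inv_mul_le_iff₀ (Real.exp_pos _)] at this
          linarith
        have h2 : (1 : ℝ) ≤ Real.exp (lam * s) := Real.one_le_exp (mul_nonneg hl0.le hs.1.le)
        have h3 := hGw s hs y (y + h)
        rw [show y - (y + h) = -h by abel, norm_neg] at h3
        calc _ ≤ A * ‖h‖ + C * ‖w s y - w s (y + h)‖ := h3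
          _ ≤ A * ‖h‖ * Real.exp (lam * s) + C * (B * Real.exp (lam * s)) :=
              add_le_add (le_mul_of_one_le_right (by positivity) h2) (by gcongr)
          _ = _ := by ring
      have hdiff : ‖w t x - w t (x + h)‖
          ≤ C₀ * ‖h‖ + κ * singularWeight σ T lam * (A * ‖h‖ + C * B) * Real.exp (lam * t) := by
        rw [hw t ht, hw t ht, add_sub_add_comm, hD.duhamel_sub hD ht.2,
          convolution_sub_right _ (hK.int0 t ht) hw₀.continuous hw₀.continuous hC₀ hC₀]
        refine (norm_add_le _ _).trans (add_le_add (hK.norm_convolution_le ht (fun y => ?_) x)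
          (hK.norm_duhamel_fderiv_le hσ hl0.le (by positivity) hsrc ht x))
        refine (hw₀lip _ _).trans (le_of_eq ?_)
        rw [show y - (y + (x + h - x)) = -h by abel, norm_neg]
      have h1 : Real.exp (-(lam * t)) ≤ 1 := by
        rw [Real.exp_le_one_iff]
        nlinarith [ht.1]
      have hq : κ * singularWeight σ T lam * (A * ‖h‖ + C * B) ≤ A * ‖h‖ + B / 2 := by
        have := mul_le_mul_of_nonneg_right hl1 (mul_nonneg hA (norm_nonneg h))
        have := mul_le_mul_of_nonneg_right hl2 hB0
        nlinarith [mul_nonneg hA (norm_nonneg h)]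
      calc f ⟨⟨t, ht⟩, x⟩ ≤ Real.exp (-(lam * t)) * (C₀ * ‖h‖
            + κ * singularWeight σ T lam * (A * ‖h‖ + C * B) * Real.exp (lam * t)) := by
            simp only [f]
            gcongr
        _ = Real.exp (-(lam * t)) * (C₀ * ‖h‖)
            + κ * singularWeight σ T lam * (A * ‖h‖ + C * B) := by
            have : Real.exp (-(lam * t)) * Real.exp (lam * t) = 1 := by
              rw [← Real.exp_add]; simp
            linear_combination κ * singularWeight σ T lam * (A * ‖h‖ + C * B) * this
        _ ≤ C₀ * ‖h‖ + (A * ‖h‖ + B / 2) :=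
            add_le_add (mul_le_of_le_one_left (by positivity) h1) hq
        _ = _ := by ring
    have := le_of_self_improving hfb himp ⟨⟨t₀, ht₀⟩, x₀⟩
    simp only [f] at this
    rw [Real.exp_neg, inv_mul_le_iff₀ (Real.exp_pos _), hh, add_sub_cancel, norm_sub_rev y₀] at this
    refine this.trans ?_
    have hexp : Real.exp (lam * t₀) ≤ Real.exp (lam * T) := by
      have := ht₀.2.le
      gcongr
    have : 0 ≤ (C₀ + A) * ‖x₀ - y₀‖ := by positivity
    nlinarith
  have hGlip : ∀ s ∈ Ioo 0 T, ∀ x y, ‖G s x - G s y‖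
      ≤ (A + C * (2 * Real.exp (lam * T) * (C₀ + A))) * ‖x - y‖ := by
    intro s hs x y
    refine (hGw s hs x y).trans ?_
    rw [add_mul, mul_assoc C]
    gcongr
    exact hlip s hs x y
  have hGlip0 : 0 ≤ A + C * (2 * Real.exp (lam * T) * (C₀ + A)) := by positivity
  refine ⟨hlip, fun t ht x => ?_, ?_⟩
  · have h1 := hasFDerivAt_convolution_smul (hK.int0 t ht)
      (fun x => (hw₀.differentiable one_ne_zero x).hasFDerivAt) hdw₀ hC₀ hC₁ x
    have h2 := hK.hasFDerivAt_duhamel_fderiv hσ hG hM hGlip0 hGlip ht.2 x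
    rw [funext (hw t ht)]
    exact h1.add h2
  · exact (hK.continuousOn_convolution hdw₀ hC₁).add
      (hK.isDuhamel_fderiv_fderiv hσ hG hM hGlip0 hGlip).continuousOn_duhamel

/-- A nonlinearity `N s (y, u, p)` that is differentiable in `(y, u, p)` with derivative `N'`; the
derivative is bounded and Lipschitz with constant `C`. -/
structure IsNonlinearity (N : ℝ → V × ℝ × (V →L[ℝ] ℝ) → ℝ)
    (N' : ℝ → V × ℝ × (V →L[ℝ] ℝ) → (V × ℝ × (V →L[ℝ] ℝ)) →L[ℝ] ℝ) (T M C : ℝ) : Prop where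
  cont : ContinuousOn (fun q : ℝ × V × ℝ × (V →L[ℝ] ℝ) => N q.1 q.2) (Ioo 0 T ×ˢ univ)
  bdd : ∀ s ∈ Ioo 0 T, ∀ q, ‖N s q‖ ≤ M
  hasFDerivAt : ∀ s ∈ Ioo 0 T, ∀ q, HasFDerivAt (N s) (N' s q) q
  cont' : ContinuousOn (fun q : ℝ × V × ℝ × (V →L[ℝ] ℝ) => N' q.1 q.2) (Ioo 0 T ×ˢ univ)
  bdd' : ∀ s ∈ Ioo 0 T, ∀ q, ‖N' s q‖ ≤ C
  lip' : ∀ s ∈ Ioo 0 T, ∀ q r, ‖N' s q - N' s r‖ ≤ C * ‖q - r‖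

lemma IsNonlinearity.lip {N : ℝ → V × ℝ × (V →L[ℝ] ℝ) → ℝ}
    {N' : ℝ → V × ℝ × (V →L[ℝ] ℝ) → (V × ℝ × (V →L[ℝ] ℝ)) →L[ℝ] ℝ} {T M C : ℝ}
    (h : IsNonlinearity N N' T M C) {s : ℝ} (hs : s ∈ Ioo 0 T) (q r : V × ℝ × (V →L[ℝ] ℝ)) :
    ‖N s q - N s r‖ ≤ C * ‖q - r‖ :=
  convex_univ.norm_image_sub_le_of_norm_hasFDerivWithin_le
    (fun z _ => (h.hasFDerivAt s hs z).hasFDerivWithinAt) (fun z _ => h.bdd' s hs z) (mem_univ _)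
    (mem_univ _)

/-- The function `u` together with its first three space derivatives `v`, `w`, `z` on the time
interval `(0, T)`; all of them are continuous in space-time and bounded by `R`. -/
structure IsC3 (T R : ℝ) (u : ℝ → V → ℝ) (v : ℝ → V → V →L[ℝ] ℝ) (w : ℝ → V → V →L[ℝ] V →L[ℝ] ℝ)
    (z : ℝ → V → V →L[ℝ] V →L[ℝ] V →L[ℝ] ℝ) : Prop where
  d1 : ∀ t ∈ Ioo 0 T, ∀ x, HasFDerivAt (u t) (v t x) x
  d2 : ∀ t ∈ Ioo 0 T, ∀ x, HasFDerivAt (v t) (w t x) x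
  d3 : ∀ t ∈ Ioo 0 T, ∀ x, HasFDerivAt (w t) (z t x) x
  c0 : ContinuousOn (fun q : ℝ × V => u q.1 q.2) (Ioo 0 T ×ˢ univ)
  c1 : ContinuousOn (fun q : ℝ × V => v q.1 q.2) (Ioo 0 T ×ˢ univ)
  c2 : ContinuousOn (fun q : ℝ × V => w q.1 q.2) (Ioo 0 T ×ˢ univ)
  c3 : ContinuousOn (fun q : ℝ × V => z q.1 q.2) (Ioo 0 T ×ˢ univ)
  b0 : ∀ t ∈ Ioo 0 T, ∀ x, ‖u t x‖ ≤ R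
  b1 : ∀ t ∈ Ioo 0 T, ∀ x, ‖v t x‖ ≤ R
  b2 : ∀ t ∈ Ioo 0 T, ∀ x, ‖w t x‖ ≤ R
  b3 : ∀ t ∈ Ioo 0 T, ∀ x, ‖z t x‖ ≤ R

lemma norm_le_of_lipschitz {F : Type*} [NormedAddCommGroup F] [NormedSpace ℝ F] {f : V → F}
    {f' : V →L[ℝ] F} {x : V} (hf : HasFDerivAt f f' x) {A : ℝ} (hA0 : 0 ≤ A)
    (hA : ∀ x y, ‖f x - f y‖ ≤ A * ‖x - y‖) : ‖f'‖ ≤ A := by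
  have h : LipschitzWith A.toNNReal f := LipschitzWith.of_dist_le_mul fun y z => by
    rw [Real.coe_toNNReal _ hA0, dist_eq_norm, dist_eq_norm]
    exact hA y z
  simpa [Real.coe_toNNReal _ hA0] using hf.le_of_lipschitz h

lemma lipschitz_of_norm_le {F : Type*} [NormedAddCommGroup F] [NormedSpace ℝ F] {f : V → F}
    {f' : V → V →L[ℝ] F} (hf : ∀ x, HasFDerivAt f (f' x) x) {A : ℝ}
    (hA : ∀ x, ‖f' x‖ ≤ A) (x y : V) : ‖f x - f y‖ ≤ A * ‖x - y‖ :=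
  convex_univ.norm_image_sub_le_of_norm_hasFDerivWithin_le
    (fun z _ => (hf z).hasFDerivWithinAt) (fun z _ => hA z) (mem_univ _) (mem_univ _)

lemma continuousOn_clm_prod {X E F G : Type*} [TopologicalSpace X] [NormedAddCommGroup E]
    [NormedSpace ℝ E] [NormedAddCommGroup F] [NormedSpace ℝ F] [NormedAddCommGroup G]
    [NormedSpace ℝ G] {f : X → E →L[ℝ] F} {g : X → E →L[ℝ] G} {s : Set X}
    (hf : ContinuousOn f s) (hg : ContinuousOn g s) :
    ContinuousOn (fun x => (f x).prod (g x)) s :=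
  (ContinuousLinearMap.prodₗᵢ (𝕜 := ℝ) (E := E) (F := F) (G := G) ℝ).continuous.comp_continuousOn
    (hf.prodMk hg)

set_option maxHeartbeats 800000 in
/-- Mild solutions with `C³` initial values are `C³` in space, with bounds that depend only on the
constants in the assumptions. -/
theorem exists_isC3_of_isMild (V : Type*) [NormedAddCommGroup V] [InnerProductSpace ℝ V]
    [FiniteDimensional ℝ V] [MeasurableSpace V] [BorelSpace V]
    {σ T κ M C C₀ : ℝ} (hT : 0 < T) (hσ : 1 < σ) (hM : 0 ≤ M) (hC : 0 ≤ C) (hC₀ : 0 ≤ C₀) :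
    ∃ R : ℝ, ∀ (K : ℝ → V → ℝ) (_ : IsHeatFamily K σ T κ)
      (N : ℝ → V × ℝ × (V →L[ℝ] ℝ) → ℝ)
      (N' : ℝ → V × ℝ × (V →L[ℝ] ℝ) → (V × ℝ × (V →L[ℝ] ℝ)) →L[ℝ] ℝ)
      (_ : IsNonlinearity N N' T M C) (u₀ : V → ℝ), ContDiff ℝ 3 u₀ →
      (∀ x, ‖u₀ x‖ ≤ C₀) → (∀ x, ‖fderiv ℝ u₀ x‖ ≤ C₀) →
      (∀ x, ‖fderiv ℝ (fderiv ℝ u₀) x‖ ≤ C₀) →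
      (∀ x, ‖fderiv ℝ (fderiv ℝ (fderiv ℝ u₀)) x‖ ≤ C₀) →
      ∀ u v, IsMild K T (fun s y a => N s (y, a)) u₀ u v → ∃ w z, IsC3 T R u v w z := by
  obtain ⟨Λ₁, hΛ₁, H1⟩ := exists_regularity_step V ℝ (T := T) (κ := κ) hσ hC
  obtain ⟨Λ₂, hΛ₂, H2⟩ := exists_regularity_step V (V →L[ℝ] ℝ) (T := T) (κ := κ) hσ hC
  set R₀ := C₀ + Real.exp T * M with hR₀
  set R₁ := C₀ + κ * singularWeight σ T 0 * M with hR₁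
  set A₁ := C * (1 + |R₁|) with hA₁
  set R₂ := Λ₁ * (C₀ + A₁) with hR₂
  set A₂ := C * (1 + |R₁| + R₂) * (1 + |R₁| + R₂) + C * R₂ with hA₂
  set R₃ := Λ₂ * (C₀ + A₂) with hR₃
  have hA₁0 : 0 ≤ A₁ := by positivity
  have hR₂0 : 0 ≤ R₂ := by positivity
  have hA₂0 : 0 ≤ A₂ := by positivity
  have hR₃0 : 0 ≤ R₃ := by positivity
  refine ⟨max (max R₀ R₁) (max R₂ R₃), ?_⟩
  intro K hK N N' hN u₀ hu₀ b0 b1 b2 b3 u v huv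
  have hd1 : ContDiff ℝ 2 (fderiv ℝ u₀) := hu₀.fderiv_right (by norm_num)
  have hd2 : ContDiff ℝ 1 (fderiv ℝ (fderiv ℝ u₀)) := hd1.fderiv_right (by norm_num)
  set G : ℝ → V → ℝ := fun s y => N s (y, u s y, v s y) with hGdef
  have hqc : ContinuousOn (fun q : ℝ × V => (q.1, q.2, u q.1 q.2, v q.1 q.2))
      (Ioo 0 T ×ˢ univ) :=
    continuousOn_fst.prodMk (continuousOn_snd.prodMk (huv.cont.prodMk huv.cont_grad))
  have hqm : MapsTo (fun q : ℝ × V => (q.1, q.2, u q.1 q.2, v q.1 q.2))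
      (Ioo 0 T ×ˢ univ) (Ioo 0 T ×ˢ univ) := fun q hq => ⟨hq.1, mem_univ _⟩
  have hGc : ContinuousOn (fun q : ℝ × V => G q.1 q.2) (Ioo 0 T ×ˢ univ) := hN.cont.comp hqc hqm
  have hGb : ∀ s ∈ Ioo 0 T, ∀ y, ‖G s y‖ ≤ M := fun s hs y => hN.bdd s hs _
  -- `u` and `v = Du` are bounded directly by the Duhamel formulas
  have hub : ∀ t ∈ Ioo 0 T, ∀ x, ‖u t x‖ ≤ R₀ := by
    intro t ht x
    rw [huv.eq t ht x]
    refine (norm_add_le _ _).trans (add_le_add (hK.norm_convolution_le ht b0 x) ?_)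
    refine (hK.norm_duhamel_le one_pos hM (fun s hs y => ?_) ht x).trans ?_
    · exact (hGb s hs y).trans (le_mul_of_one_le_right hM (Real.one_le_exp (by simpa using hs.1.le)))
    · have : Real.exp (1 * t) ≤ Real.exp T := by
        rw [one_mul]; exact Real.exp_le_exp.2 ht.2.le
      simp only [inv_one, one_mul] at this ⊢
      nlinarith
  have hvb : ∀ t ∈ Ioo 0 T, ∀ x, ‖v t x‖ ≤ R₁ := by
    intro t ht x
    rw [huv.eq_grad t ht x]
    exact hK.norm_mild_le hσ hM b1 hGb ht x
  have hd_u : ∀ t ∈ Ioo 0 T, ∀ x, HasFDerivAt (u t) (v t x) x := by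
    intro t ht x
    have h1 := hasFDerivAt_convolution_smul (hK.int0 t ht)
      (fun x => (hu₀.differentiable (by norm_num) x).hasFDerivAt) hd1.continuous b0 b1 x
    have h2 := hK.hasFDerivAt_duhamel hσ hGc hGb ht.2 x
    rw [funext (huv.eq t ht), huv.eq_grad t ht]
    exact h1.add h2
  have hR₁0 : 0 ≤ R₁ := (norm_nonneg _).trans (hvb (T / 2) ⟨by linarith, by linarith⟩ 0)
  rw [abs_of_nonneg hR₁0] at hA₁ hA₂
  have hulip : ∀ t ∈ Ioo 0 T, ∀ x y, ‖u t x - u t y‖ ≤ R₁ * ‖x - y‖ := fun t ht x y =>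
    lipschitz_of_norm_le (hd_u t ht) (hvb t ht) x y
  have hGlip : ∀ s ∈ Ioo 0 T, ∀ x y,
      ‖G s x - G s y‖ ≤ A₁ * ‖x - y‖ + C * ‖v s x - v s y‖ := by
    intro s hs x y
    refine (hN.lip hs _ _).trans ?_
    rw [hA₁, mul_assoc, ← mul_add]
    gcongr
    have h0 := hulip s hs x y
    have h1 := norm_nonneg (x - y)
    have h2 := norm_nonneg (v s x - v s y)
    have h3 : 0 ≤ R₁ * ‖x - y‖ := by positivity
    refine max_le ?_ (max_le ?_ ?_)
    · change ‖x - y‖ ≤ _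
      linarith
    · change ‖u s x - u s y‖ ≤ _
      linarith
    · change ‖v s x - v s y‖ ≤ _
      linarith
  -- `G` depends on `v` without loss of derivatives, so the regularity step applies to `v`
  obtain ⟨hvlip, hd_v, hwc⟩ := H1 K hK G (fderiv ℝ u₀) v C₀ A₁ M hA₁0 (hd1.of_le (by norm_num)) b1
    b2 hGc hGb huv.eq_grad hGlip
  set w : ℝ → V → V →L[ℝ] V →L[ℝ] ℝ := fun t x =>
    (K t ⋆[smulB (V →L[ℝ] V →L[ℝ] ℝ)] fderiv ℝ (fderiv ℝ u₀)) x
      + duhamel (smulB₂ V ℝ) (fun t => fderiv ℝ (fderiv ℝ (K t))) G t x with hw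
  have hwb : ∀ t ∈ Ioo 0 T, ∀ x, ‖w t x‖ ≤ R₂ := fun t ht x =>
    norm_le_of_lipschitz (hd_v t ht x) hR₂0 (hvlip t ht)
  -- `G' = DG` by the chain rule; it is affine in the second derivative `w`
  let Q : ℝ → V → V →L[ℝ] V × ℝ × (V →L[ℝ] ℝ) := fun s y =>
    (ContinuousLinearMap.id ℝ V).prod ((v s y).prod (w s y))
  set G' : ℝ → V → V →L[ℝ] ℝ := fun s y => (N' s (y, u s y, v s y)).comp (Q s y) with hG'
  have hQb : ∀ s ∈ Ioo 0 T, ∀ y, ‖Q s y‖ ≤ 1 + R₁ + R₂ := by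
    intro s hs y
    refine ContinuousLinearMap.opNorm_le_bound _ (by positivity) fun a => ?_
    have h1 := (v s y).le_of_opNorm_le (hvb s hs y) a
    have h2 := (w s y).le_of_opNorm_le (hwb s hs y) a
    have h3 : 0 ≤ R₁ * ‖a‖ := by positivity
    have h4 : 0 ≤ R₂ * ‖a‖ := by positivity
    have h5 := norm_nonneg a
    refine max_le ?_ (max_le ?_ ?_)
    · change ‖a‖ ≤ _
      linarith
    · change ‖v s y a‖ ≤ _
      linarith
    · change ‖w s y a‖ ≤ _
      linarith
  have hQlip : ∀ s ∈ Ioo 0 T, ∀ x y, ‖Q s x - Q s y‖ ≤ R₂ * ‖x - y‖ + ‖w s x - w s y‖ := by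
    intro s hs x y
    refine ContinuousLinearMap.opNorm_le_bound _ (by positivity) fun a => ?_
    have h1 := (v s x - v s y).le_of_opNorm_le (hvlip s hs x y) a
    have h2 := (w s x - w s y).le_opNorm a
    have h3 : 0 ≤ R₂ * ‖x - y‖ * ‖a‖ := by positivity
    have h4 : 0 ≤ ‖w s x - w s y‖ * ‖a‖ := by positivity
    refine max_le ?_ (max_le ?_ ?_)
    · change ‖a - a‖ ≤ _
      simp only [sub_self, norm_zero]
      positivity
    · change ‖(v s x - v s y) a‖ ≤ _
      linarith
    · change ‖(w s x - w s y) a‖ ≤ _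
      linarith
  have hqlip : ∀ s ∈ Ioo 0 T, ∀ x y, ‖(x, u s x, v s x) - (y, u s y, v s y)‖
      ≤ (1 + R₁ + R₂) * ‖x - y‖ := by
    intro s hs x y
    have h0 := hulip s hs x y
    have h1 := norm_nonneg (x - y)
    have h2 := hvlip s hs x y
    have h3 : 0 ≤ R₁ * ‖x - y‖ := by positivity
    have h4 : 0 ≤ R₂ * ‖x - y‖ := by positivity
    refine max_le ?_ (max_le ?_ ?_)
    · change ‖x - y‖ ≤ _
      linarith
    · change ‖u s x - u s y‖ ≤ _
      linarith
    · change ‖v s x - v s y‖ ≤ _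
      linarith
  have hG'd : ∀ s ∈ Ioo 0 T, ∀ y, HasFDerivAt (G s) (G' s y) y := by
    intro s hs y
    have h1 : HasFDerivAt (fun y => (y, u s y, v s y)) (Q s y) y :=
      (hasFDerivAt_id y).prodMk ((hd_u s hs y).prodMk (hd_v s hs y))
    exact (hN.hasFDerivAt s hs _).comp y h1
  have hG'c : ContinuousOn (fun q : ℝ × V => G' q.1 q.2) (Ioo 0 T ×ˢ univ) := by
    have h1 : ContinuousOn (fun q : ℝ × V => Q q.1 q.2) (Ioo 0 T ×ˢ univ) := by
      exact continuousOn_clm_prod continuousOn_const (continuousOn_clm_prod huv.cont_grad hwc)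
    exact (hN.cont'.comp hqc hqm).clm_comp h1
  have hG'b : ∀ s ∈ Ioo 0 T, ∀ y, ‖G' s y‖ ≤ C * (1 + R₁ + R₂) := fun s hs y =>
    (ContinuousLinearMap.opNorm_comp_le _ _).trans
      (mul_le_mul (hN.bdd' s hs _) (hQb s hs y) (norm_nonneg _) hC)
  have hG'lip : ∀ s ∈ Ioo 0 T, ∀ x y,
      ‖G' s x - G' s y‖ ≤ A₂ * ‖x - y‖ + C * ‖w s x - w s y‖ := by
    intro s hs x y
    have e : G' s x - G' s y
        = (N' s (x, u s x, v s x) - N' s (y, u s y, v s y)).comp (Q s x)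
          + (N' s (y, u s y, v s y)).comp (Q s x - Q s y) := by
      simp only [hG', ContinuousLinearMap.sub_comp, ContinuousLinearMap.comp_sub]
      abel
    rw [e]
    calc _ ≤ C * ((1 + R₁ + R₂) * ‖x - y‖) * (1 + R₁ + R₂)
          + C * (R₂ * ‖x - y‖ + ‖w s x - w s y‖) := by
          refine (norm_add_le _ _).trans (add_le_add ?_ ?_)
          · refine (ContinuousLinearMap.opNorm_comp_le _ _).trans
              (mul_le_mul ?_ (hQb s hs x) (norm_nonneg _) (by positivity))
            refine (hN.lip' s hs _ _).trans ?_
            gcongr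
            exact hqlip s hs x y
          · exact (ContinuousLinearMap.opNorm_comp_le _ _).trans
              (mul_le_mul (hN.bdd' s hs _) (hQlip s hs x y) (norm_nonneg _) hC)
      _ = _ := by rw [hA₂]; ring
  have hw_eq : ∀ t ∈ Ioo 0 T, ∀ x, w t x
      = (K t ⋆[smulB (V →L[ℝ] V →L[ℝ] ℝ)] fderiv ℝ (fderiv ℝ u₀)) x
        + duhamel (smulB₁ V (V →L[ℝ] ℝ)) (fun t => fderiv ℝ (K t)) G' t x := by
    intro t ht x
    simp only [hw]
    congr 1
    refine setIntegral_congr_fun measurableSet_Ioo fun r hr => ?_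
    have hs : t - r ∈ Ioo 0 T := ⟨by linarith [hr.2], by linarith [hr.1, ht.2]⟩
    exact hK.convolution_fderiv_fderiv_eq ⟨hr.1, hr.2.trans ht.2⟩ (hG'd _ hs)
      (continuous_slice hG'c hs) (hGb _ hs) (hG'b _ hs) x
  -- the regularity step once more, now for `w` and its source term `G'`
  obtain ⟨hwlip, hd_w, hzc⟩ := H2 K hK G' (fderiv ℝ (fderiv ℝ u₀)) w C₀ A₂ _ hA₂0 hd2 b2
    b3 hG'c hG'b hw_eq hG'lip
  refine ⟨w, _, hd_u, hd_v, hd_w, huv.cont, huv.cont_grad, hwc, hzc, ?_, ?_, ?_, ?_⟩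
  · exact fun t ht x => (hub t ht x).trans ((le_max_left _ _).trans (le_max_left _ _))
  · exact fun t ht x => (hvb t ht x).trans ((le_max_right _ _).trans (le_max_left _ _))
  · exact fun t ht x => (hwb t ht x).trans ((le_max_left _ _).trans (le_max_right _ _))
  · exact fun t ht x => (norm_le_of_lipschitz (hd_w t ht x) hR₃0 (hwlip t ht)).trans
      ((le_max_right _ _).trans (le_max_right _ _))

end Regularity

/-! ### The Lévy operator on bounded functions with Lipschitz gradient -/

section Levy

variable {d : ℕ} {μ : Measure (Rd d)}

/-- The Lévy weight `1 ∧ |z|²`. -/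
def levyWeight (z : Rd d) : ℝ := min 1 (‖z‖ ^ 2)

lemma levyWeight_nonneg (z : Rd d) : 0 ≤ levyWeight z := le_min zero_le_one (by positivity)

lemma continuous_levyWeight : Continuous (levyWeight (d := d)) :=
  continuous_const.min (by fun_prop)

lemma levyWeight_of_lt {z : Rd d} (hz : ‖z‖ < 1) : levyWeight z = ‖z‖ ^ 2 :=
  min_eq_right (pow_le_one₀ (norm_nonneg _) hz.le)

lemma levyWeight_of_le {z : Rd d} (hz : 1 ≤ ‖z‖) : levyWeight z = 1 :=
  min_eq_left (one_le_pow₀ hz)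

lemma LevyCondition.lintegral_le {C : ℝ} (h : LevyCondition μ C) :
    ∫⁻ z, ENNReal.ofReal (levyWeight z) ∂μ ≤ ENNReal.ofReal C := by
  refine le_trans (le_of_eq (lintegral_congr fun z => ?_)) h
  rw [levyWeight, ENNReal.ofReal_min, ENNReal.ofReal_one]

lemma LevyCondition.integrable {C : ℝ} (h : LevyCondition μ C) : Integrable levyWeight μ := by
  refine ⟨continuous_levyWeight.aestronglyMeasurable, ?_⟩
  rw [hasFiniteIntegral_iff_ofReal (ae_of_all _ levyWeight_nonneg)]
  exact h.lintegral_le.trans_lt ENNReal.ofReal_lt_top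

lemma LevyCondition.integral_le {C : ℝ} (h : LevyCondition μ C) : ∫ z, levyWeight z ∂μ ≤ |C| := by
  rw [integral_eq_lintegral_of_nonneg_ae (ae_of_all _ levyWeight_nonneg)
    continuous_levyWeight.aestronglyMeasurable]
  have := ENNReal.toReal_mono ENNReal.ofReal_ne_top h.lintegral_le
  refine this.trans ?_
  rw [ENNReal.toReal_ofReal']
  exact max_le (le_abs_self _) (abs_nonneg _)

/-- The integrand of the Lévy operator, for a function with derivative `p` at `x`. -/
def levyIntegrand (φ : Rd d → ℝ) (p : Rd d →L[ℝ] ℝ) (x z : Rd d) : ℝ :=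
  φ (x + z) - φ x - (Metric.ball (0 : Rd d) 1).indicator p z

lemma levyOp_eq {φ : Rd d → ℝ} {p : Rd d →L[ℝ] ℝ} {x : Rd d} (h : HasFDerivAt φ p x) :
    levyOp μ φ x = ∫ z, levyIntegrand φ p x z ∂μ := by
  have : ∀ w, inner ℝ (gradient φ x) w = p w := fun w => by
    rw [gradient, h.fderiv, InnerProductSpace.toDual_symm_apply]
  simp only [levyOp, levyIntegrand, this]

lemma measurable_levyIntegrand {φ : Rd d → ℝ} (hφ : Continuous φ) (p : Rd d →L[ℝ] ℝ) (x : Rd d) :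
    Measurable (levyIntegrand φ p x) :=
  ((hφ.comp (by fun_prop : Continuous fun z => x + z)).measurable.sub_const _).sub
    (p.continuous.measurable.indicator Metric.isOpen_ball.measurableSet)

/-- Second order Taylor bound for the integrand of the Lévy operator. Only the behaviour of the
derivative in the unit ball around `x` matters. -/
lemma abs_levyIntegrand_le {φ : Rd d → ℝ} {φ' : Rd d → Rd d →L[ℝ] ℝ}
    (hφ : ∀ y, HasFDerivAt φ (φ' y) y) {a b : ℝ} (ha : ∀ y, |φ y| ≤ a) (hb0 : 0 ≤ b) {x : Rd d}
    (hb : ∀ y, ‖y - x‖ < 1 → ‖φ' y - φ' x‖ ≤ b * ‖y - x‖) (z : Rd d) :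
    |levyIntegrand φ (φ' x) x z| ≤ (2 * a + b) * levyWeight z := by
  have ha0 : 0 ≤ a := (abs_nonneg _).trans (ha 0)
  rcases lt_or_ge ‖z‖ 1 with hz | hz
  · rw [levyIntegrand, indicator_of_mem (by simpa using hz), levyWeight_of_lt hz]
    have h1 := (convex_closedBall x ‖z‖).norm_image_sub_le_of_norm_hasFDerivWithin_le' (f := φ)
      (f' := φ') (φ := φ' x) (C := b * ‖z‖) (x := x) (y := x + z)
      (fun y _ => (hφ y).hasFDerivWithinAt) (fun y hy => by
        rw [mem_closedBall_iff_norm] at hy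
        exact (hb y (hy.trans_lt hz)).trans (by gcongr)) (by simp) (by simp)
    rw [add_sub_cancel_left, Real.norm_eq_abs] at h1
    refine h1.trans ?_
    nlinarith [sq_nonneg ‖z‖]
  · rw [levyIntegrand, indicator_of_notMem (by simpa using hz), levyWeight_of_le hz, sub_zero,
      mul_one]
    have := abs_sub (φ (x + z)) (φ x)
    linarith [ha (x + z), ha x]

/-- Bounded functions with bounded Lipschitz derivative `φ'`. -/
structure IsC11 (φ : Rd d → ℝ) (φ' : Rd d → Rd d →L[ℝ] ℝ) (a b : ℝ) : Prop where
  hasFDerivAt : ∀ x, HasFDerivAt φ (φ' x) x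
  bdd : ∀ x, |φ x| ≤ a
  bdd' : ∀ x, ‖φ' x‖ ≤ b
  lip : ∀ x y, ‖φ' x - φ' y‖ ≤ b * ‖x - y‖

namespace IsC11

variable {φ : Rd d → ℝ} {φ' : Rd d → Rd d →L[ℝ] ℝ} {a b : ℝ}

lemma a_nonneg (h : IsC11 φ φ' a b) : 0 ≤ a := (abs_nonneg _).trans (h.bdd 0)

lemma b_nonneg (h : IsC11 φ φ' a b) : 0 ≤ b := (norm_nonneg _).trans (h.bdd' 0)

lemma continuous (h : IsC11 φ φ' a b) : Continuous φ :=
  continuous_iff_continuousAt.2 fun x => (h.hasFDerivAt x).continuousAt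

lemma continuous' (h : IsC11 φ φ' a b) : Continuous φ' := by
  have : LipschitzWith b.toNNReal φ' := LipschitzWith.of_dist_le_mul fun y z => by
    rw [Real.coe_toNNReal _ h.b_nonneg, dist_eq_norm, dist_eq_norm]
    exact h.lip y z
  exact this.continuous

lemma abs_levyIntegrand_le (h : IsC11 φ φ' a b) (x z : Rd d) :
    |levyIntegrand φ (φ' x) x z| ≤ (2 * a + b) * levyWeight z :=
  FracHJB.abs_levyIntegrand_le h.hasFDerivAt h.bdd h.b_nonneg (fun y _ => h.lip y x) z

lemma integrable (h : IsC11 φ φ' a b) (hμ : Integrable levyWeight μ) (x : Rd d) :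
    Integrable (levyIntegrand φ (φ' x) x) μ :=
  (hμ.const_mul (2 * a + b)).mono' (measurable_levyIntegrand h.continuous _ _).aestronglyMeasurable
    (ae_of_all _ (h.abs_levyIntegrand_le x))

lemma abs_levyOp_le (h : IsC11 φ φ' a b) {C : ℝ} (hμ : LevyCondition μ C) (x : Rd d) :
    |levyOp μ φ x| ≤ (2 * a + b) * |C| := by
  rw [levyOp_eq (h.hasFDerivAt x), ← Real.norm_eq_abs]
  refine (norm_integral_le_of_norm_le (hμ.integrable.const_mul (2 * a + b))
    (ae_of_all _ (h.abs_levyIntegrand_le x))).trans ?_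
  rw [integral_const_mul]
  have := h.a_nonneg
  have := h.b_nonneg
  gcongr
  exact hμ.integral_le

end IsC11

/-- Convergence of Lévy operators under uniform `C^{1,1}` bounds. -/
lemma tendsto_levyOp {ι : Type*} {l : Filter ι} [l.IsCountablyGenerated]
    (hμ : Integrable levyWeight μ) {φ : ι → Rd d → ℝ} {φ' : ι → Rd d → Rd d →L[ℝ] ℝ} {a b : ℝ}
    (h : ∀ᶠ i in l, IsC11 (φ i) (φ' i) a b) {φ₀ : Rd d → ℝ} {φ₀' : Rd d → Rd d →L[ℝ] ℝ}
    (h₀ : ∀ x, HasFDerivAt φ₀ (φ₀' x) x) {x : ι → Rd d} {x₀ : Rd d}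
    (hlim : ∀ z, Tendsto (fun i => φ i (x i + z)) l (𝓝 (φ₀ (x₀ + z))))
    (hlim' : Tendsto (fun i => φ' i (x i)) l (𝓝 (φ₀' x₀))) :
    Tendsto (fun i => levyOp μ (φ i) (x i)) l (𝓝 (levyOp μ φ₀ x₀)) := by
  rw [levyOp_eq (h₀ x₀)]
  have h1 : Tendsto (fun i => ∫ z, levyIntegrand (φ i) (φ' i (x i)) (x i) z ∂μ) l
      (𝓝 (∫ z, levyIntegrand φ₀ (φ₀' x₀) x₀ z ∂μ)) := by
    refine tendsto_integral_filter_of_dominated_convergence (fun z => (2 * a + b) * levyWeight z)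
      ?_ ?_ (hμ.const_mul _) ?_
    · filter_upwards [h] with i hi
        using (measurable_levyIntegrand hi.continuous _ _).aestronglyMeasurable
    · filter_upwards [h] with i hi using ae_of_all _ (hi.abs_levyIntegrand_le _)
    · refine ae_of_all _ fun z => ?_
      refine ((hlim z).sub (by simpa using hlim 0)).sub ?_
      by_cases hz : z ∈ Metric.ball (0 : Rd d) 1
      · simp only [indicator_of_mem hz]
        exact ((ContinuousLinearMap.apply ℝ ℝ z).continuous.tendsto _).comp hlim'
      · simp only [indicator_of_notMem hz]
        exact tendsto_const_nhds
  refine h1.congr' ?_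
  filter_upwards [h] with i hi using (levyOp_eq (hi.hasFDerivAt _)).symm

lemma IsC11.continuous_levyOp {φ : Rd d → ℝ} {φ' : Rd d → Rd d →L[ℝ] ℝ} {a b : ℝ}
    (h : IsC11 φ φ' a b) (hμ : Integrable levyWeight μ) : Continuous (levyOp μ φ) := by
  refine continuous_iff_continuousAt.2 fun x => ?_
  refine tendsto_levyOp (l := 𝓝 x) (φ := fun _ => φ) (φ' := fun _ => φ') (x := id) hμ
    (Eventually.of_forall fun _ => h) h.hasFDerivAt (fun z => ?_) (h.continuous'.tendsto x)
  exact (h.continuous.comp (by fun_prop : Continuous fun y => y + z)).tendsto x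

end Levy

/-! ### The Fourier multiplier of the Lévy operator -/

section Symbol

variable {d : ℕ} {μ : Measure (Rd d)}

/-- The integrand of the Fourier multiplier of the Lévy operator. -/
def symbolIntegrand (ξ z : Rd d) : ℂ :=
  Complex.exp (Complex.I * ((inner ℝ z ξ : ℝ) : ℂ)) - 1
    - (Metric.ball (0 : Rd d) 1).indicator (fun w => Complex.I * ((inner ℝ ξ w : ℝ) : ℂ)) z

lemma norm_exp_I_mul_sub_one_sub_le (θ : ℝ) :
    ‖Complex.exp (Complex.I * (θ : ℂ)) - 1 - Complex.I * (θ : ℂ)‖ ≤ 2 * θ ^ 2 := by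
  rcases le_or_gt |θ| 1 with h | h
  · have h1 : ‖Complex.I * (θ : ℂ)‖ = |θ| := by simp
    refine (Complex.norm_exp_sub_one_sub_id_le (by rw [h1]; exact h)).trans ?_
    rw [h1, sq_abs]
    nlinarith [sq_nonneg θ]
  · refine (norm_sub_le _ _).trans ?_
    have h1 := Real.norm_exp_I_mul_ofReal_sub_one_le (x := θ)
    rw [Real.norm_eq_abs] at h1
    have h2 : ‖Complex.I * (θ : ℂ)‖ = |θ| := by simp
    rw [h2, ← sq_abs]
    nlinarith

lemma norm_symbolIntegrand_le (ξ z : Rd d) :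
    ‖symbolIntegrand ξ z‖ ≤ 2 * (1 + ‖ξ‖ ^ 2) * levyWeight z := by
  rcases lt_or_ge ‖z‖ 1 with hz | hz
  · rw [symbolIntegrand, indicator_of_mem (by simpa using hz), levyWeight_of_lt hz,
      real_inner_comm]
    refine (norm_exp_I_mul_sub_one_sub_le _).trans ?_
    have h1 := abs_real_inner_le_norm ξ z
    have h2 : (inner ℝ ξ z) ^ 2 ≤ (‖ξ‖ * ‖z‖) ^ 2 := by
      rw [← sq_abs]
      gcongr
    nlinarith [sq_nonneg ‖z‖]
  · rw [symbolIntegrand, indicator_of_notMem (by simpa using hz), levyWeight_of_le hz, sub_zero]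
    refine (norm_sub_le _ _).trans ?_
    rw [mul_comm Complex.I, Complex.norm_exp_ofReal_mul_I]
    simp only [norm_one]
    nlinarith [sq_nonneg ‖ξ‖]

lemma measurable_symbolIntegrand :
    Measurable fun p : Rd d × Rd d => symbolIntegrand p.1 p.2 := by
  refine Measurable.sub ?_ ?_
  · exact (by fun_prop : Continuous fun p : Rd d × Rd d =>
      Complex.exp (Complex.I * ((inner ℝ p.2 p.1 : ℝ) : ℂ)) - 1).measurable
  · have : (fun p : Rd d × Rd d => (Metric.ball (0 : Rd d) 1).indicator
        (fun w => Complex.I * ((inner ℝ p.1 w : ℝ) : ℂ)) p.2)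
        = (univ ×ˢ Metric.ball (0 : Rd d) 1).indicator
          (fun p : Rd d × Rd d => Complex.I * ((inner ℝ p.1 p.2 : ℝ) : ℂ)) := by
      ext p
      by_cases h : p.2 ∈ Metric.ball (0 : Rd d) 1
      · rw [indicator_of_mem h, indicator_of_mem (by exact ⟨mem_univ _, h⟩)]
      · rw [indicator_of_notMem h, indicator_of_notMem (by simpa using h)]
    rw [this]
    exact (by fun_prop : Continuous fun p : Rd d × Rd d =>
      Complex.I * ((inner ℝ p.1 p.2 : ℝ) : ℂ)).measurable.indicator
      (MeasurableSet.univ.prod Metric.isOpen_ball.measurableSet)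

lemma continuous_symbolIntegrand (z : Rd d) : Continuous fun ξ => symbolIntegrand ξ z := by
  refine Continuous.sub (by fun_prop) ?_
  by_cases h : z ∈ Metric.ball (0 : Rd d) 1
  · simp only [indicator_of_mem h]
    fun_prop
  · simp only [indicator_of_notMem h]
    fun_prop

lemma integrable_symbolIntegrand (hμ : Integrable levyWeight μ) (ξ : Rd d) :
    Integrable (symbolIntegrand ξ) μ :=
  (hμ.const_mul (2 * (1 + ‖ξ‖ ^ 2))).mono'
    (measurable_symbolIntegrand.comp measurable_prodMk_left).aestronglyMeasurable
    (ae_of_all _ (norm_symbolIntegrand_le ξ))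

lemma levySymbol_eq (ξ : Rd d) : levySymbol μ ξ = ∫ z, symbolIntegrand ξ z ∂μ := rfl

lemma norm_levySymbol_le (hμ : Integrable levyWeight μ) (ξ : Rd d) :
    ‖levySymbol μ ξ‖ ≤ 2 * (1 + ‖ξ‖ ^ 2) * ∫ z, levyWeight z ∂μ := by
  rw [levySymbol_eq, ← integral_const_mul]
  exact norm_integral_le_of_norm_le (hμ.const_mul _) (ae_of_all _ (norm_symbolIntegrand_le ξ))

lemma continuous_levySymbol (hμ : Integrable levyWeight μ) : Continuous (levySymbol μ) := by
  refine continuous_iff_continuousAt.2 fun ξ₀ => ?_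
  refine continuousAt_of_dominated (F := symbolIntegrand)
    (bound := fun z => 2 * (1 + (‖ξ₀‖ + 1) ^ 2) * levyWeight z)
    (Eventually.of_forall fun ξ => (integrable_symbolIntegrand hμ ξ).aestronglyMeasurable) ?_
    (hμ.const_mul _) (ae_of_all _ fun z => (continuous_symbolIntegrand z).continuousAt)
  filter_upwards [Metric.ball_mem_nhds ξ₀ one_pos] with ξ hξ
  refine ae_of_all _ fun z => (norm_symbolIntegrand_le ξ z).trans ?_
  have h1 : ‖ξ‖ ≤ ‖ξ₀‖ + 1 := by
    have := norm_le_norm_add_norm_sub' ξ ξ₀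
    rw [mem_ball_iff_norm] at hξ
    linarith
  have := levyWeight_nonneg z
  gcongr

lemma re_levySymbol_nonpos (hμ : Integrable levyWeight μ) (ξ : Rd d) :
    (levySymbol μ ξ).re ≤ 0 := by
  have h := integral_re (integrable_symbolIntegrand hμ ξ)
  simp only [RCLike.re_to_complex] at h
  rw [levySymbol_eq, ← h]
  refine integral_nonpos fun z => ?_
  have h1 : (symbolIntegrand ξ z).re = Real.cos (inner ℝ z ξ) - 1 := by
    rw [symbolIntegrand, mul_comm Complex.I, Complex.exp_mul_I]
    by_cases h : z ∈ Metric.ball (0 : Rd d) 1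
    · rw [indicator_of_mem h]
      simp [← Complex.ofReal_cos, ← Complex.ofReal_sin]
    · rw [indicator_of_notMem h]
      simp [← Complex.ofReal_cos, ← Complex.ofReal_sin]
  simp only [h1, Pi.zero_apply, sub_nonpos]
  exact Real.cos_le_one _

lemma levySymbol_neg (ξ : Rd d) :
    levySymbol μ (-ξ) = (starRingEnd ℂ) (levySymbol μ ξ) := by
  rw [levySymbol_eq, levySymbol_eq, ← integral_conj]
  refine integral_congr_ae (ae_of_all _ fun z => ?_)
  simp only [symbolIntegrand, map_sub, map_one, ← Complex.exp_conj, map_mul, Complex.conj_I,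
    Complex.conj_ofReal, inner_neg_right, inner_neg_left]
  by_cases h : z ∈ Metric.ball (0 : Rd d) 1
  · simp [indicator_of_mem h]
  · simp [indicator_of_notMem h]

/-- The Fourier transform `exp (t m)` of the heat kernel, in Mathlib's normalization. -/
def heatSymbol (μ : Measure (Rd d)) (t : ℝ) (η : Rd d) : ℂ :=
  Complex.exp ((t : ℂ) * levySymbol μ ((2 * Real.pi) • η))

lemma continuous_heatSymbol (hμ : Integrable levyWeight μ) :
    Continuous fun p : ℝ × Rd d => heatSymbol μ p.1 p.2 := by
  have := continuous_levySymbol hμ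
  unfold heatSymbol
  fun_prop

lemma norm_heatSymbol (t : ℝ) (η : Rd d) :
    ‖heatSymbol μ t η‖ = Real.exp (t * (levySymbol μ ((2 * Real.pi) • η)).re) := by
  rw [heatSymbol, Complex.norm_exp, Complex.re_ofReal_mul]

lemma norm_heatSymbol_le (hμ : Integrable levyWeight μ) {s t : ℝ} (h : s ≤ t) (η : Rd d) :
    ‖heatSymbol μ t η‖ ≤ ‖heatSymbol μ s η‖ := by
  rw [norm_heatSymbol, norm_heatSymbol, Real.exp_le_exp]
  exact mul_le_mul_of_nonpos_right h (re_levySymbol_nonpos hμ _)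

lemma norm_heatSymbol_le_one (hμ : Integrable levyWeight μ) {t : ℝ} (h : 0 ≤ t) (η : Rd d) :
    ‖heatSymbol μ t η‖ ≤ 1 := by
  simpa [norm_heatSymbol] using norm_heatSymbol_le hμ h η

lemma heatSymbol_add (s t : ℝ) (η : Rd d) :
    heatSymbol μ (s + t) η = heatSymbol μ s η * heatSymbol μ t η := by
  rw [heatSymbol, heatSymbol, heatSymbol, ← Complex.exp_add]
  push_cast
  ring_nf

/-! ### The heat kernel as a Fourier integral -/

/-- The character `θ ↦ exp (2 π i θ)`. -/
def character (θ : ℝ) : ℂ := Complex.exp (((2 * Real.pi * θ : ℝ) : ℂ) * Complex.I)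

lemma norm_character (θ : ℝ) : ‖character θ‖ = 1 := Complex.norm_exp_ofReal_mul_I _

lemma character_add (θ φ : ℝ) : character (θ + φ) = character θ * character φ := by
  rw [character, character, character, ← Complex.exp_add]
  push_cast
  ring_nf

lemma continuous_character : Continuous character := by
  unfold character
  fun_prop

lemma fourierInv_eq_character (a : Rd d → ℂ) (x : Rd d) :
    𝓕⁻ a x = ∫ η, character (inner ℝ η x) * a η := by
  rw [Real.fourierInv_eq']
  simp only [smul_eq_mul, character]

lemma integrable_character_mul {a : Rd d → ℂ} (ha : Integrable a) {f : Rd d → ℝ}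
    (hf : Continuous f) : Integrable fun η => character (f η) * a η :=
  ha.bdd_mul (c := 1) (continuous_character.comp hf).aestronglyMeasurable
    (ae_of_all _ fun _ => (norm_character _).le)

lemma norm_fourierInv_le (a : Rd d → ℂ) (x : Rd d) : ‖𝓕⁻ a x‖ ≤ ∫ η, ‖a η‖ := by
  rw [fourierInv_eq_character]
  refine (norm_integral_le_integral_norm _).trans (le_of_eq ?_)
  simp [norm_character]

lemma heatKernel_coe (t : ℝ) (x : Rd d) :
    (heatKernel μ t x : ℂ) = 𝓕⁻ (heatSymbol μ t) x := by
  change (((𝓕⁻ (heatSymbol μ t) x).re : ℝ) : ℂ) = _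
  refine Complex.conj_eq_iff_re.1 ?_
  rw [fourierInv_eq_character, ← integral_conj, ← integral_neg_eq_self]
  refine integral_congr_ae (ae_of_all _ fun η => ?_)
  simp only [map_mul, character, heatSymbol, ← Complex.exp_conj, Complex.conj_ofReal,
    Complex.conj_I, smul_neg, levySymbol_neg, Complex.conj_conj, inner_neg_left]
  congr 2
  push_cast
  ring

/-- If `exp (t m)` is not integrable then the heat kernel has the value zero. -/
lemma integrable_heatSymbol {t : ℝ} (hmass : eLpNorm (heatKernel μ t) 1 volume = 1)
    (hμ : Integrable levyWeight μ) : Integrable (heatSymbol μ t) := by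
  by_contra h
  have h0 : heatKernel μ t = 0 := by
    ext x
    have h1 : 𝓕⁻ (heatSymbol μ t) x = 0 := by
      rw [fourierInv_eq_character]
      refine integral_undef fun hi => h ?_
      have hm : AEStronglyMeasurable (heatSymbol μ t) (volume : Measure (Rd d)) :=
        ((continuous_heatSymbol hμ).comp (by fun_prop : Continuous fun η : Rd d =>
          (t, η))).aestronglyMeasurable
      refine (integrable_norm_iff hm).1 (hi.norm.congr (ae_of_all _ fun η => ?_))
      simp [norm_character]
    have := heatKernel_coe (μ := μ) t x
    rw [h1] at this
    exact_mod_cast this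
  rw [h0] at hmass
  simp at hmass

end Symbol

/-! ### The heat kernel as a convolution semigroup -/

section HeatKernel

variable {d : ℕ} {μ : Measure (Rd d)} {σ T : ℝ} {κ : ℕ → ℝ → ℝ}

lemma KernelBounds.integrable_heatKernel (hK : KernelBounds (heatKernel μ) σ T κ) {t : ℝ}
    (ht : t ∈ Ioo 0 T) : Integrable (heatKernel μ t) := by
  refine ⟨(hK.smooth t ht).continuous.aestronglyMeasurable, ?_⟩
  have := hK.mass t ht
  rw [eLpNorm_one_eq_lintegral_enorm] at this
  rw [hasFiniteIntegral_iff_enorm, this]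
  exact ENNReal.one_lt_top

lemma KernelBounds.fourier_heatKernel (hK : KernelBounds (heatKernel μ) σ T κ)
    (hμ : Integrable levyWeight μ) {t : ℝ} (ht : t ∈ Ioo 0 T) (η : Rd d) :
    ∫ y, character (-(inner ℝ y η)) * (heatKernel μ t y : ℂ) = heatSymbol μ t η := by
  have hg : Continuous (heatSymbol μ t) :=
    (continuous_heatSymbol hμ).comp (by fun_prop : Continuous fun η : Rd d => (t, η))
  have hc : 𝓕⁻ (heatSymbol μ t) = fun x => (heatKernel μ t x : ℂ) :=
    funext fun x => (heatKernel_coe t x).symm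
  have hi : Integrable (𝓕 (heatSymbol μ t)) := by
    have h1 : Integrable fun x => (heatKernel μ t x : ℂ) := (hK.integrable_heatKernel ht).ofReal
    have h2 : 𝓕 (heatSymbol μ t) = fun x => (heatKernel μ t (-x) : ℂ) := by
      ext x
      rw [← congrFun hc (-x), Real.fourierInv_eq_fourier_neg, neg_neg]
    rw [h2]
    exact h1.comp_neg
  have := congrFun (hg.fourier_fourierInv_eq (integrable_heatSymbol (hK.mass t ht) hμ) hi) η
  rw [hc, Real.fourier_eq'] at this
  rw [← this]
  refine integral_congr_ae (ae_of_all _ fun y => ?_)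
  simp only [character, smul_eq_mul]
  congr 3
  push_cast
  ring

/-- The heat semigroup acts on Fourier integrals by multiplication with the heat symbol. -/
lemma KernelBounds.integral_heatKernel_mul_fourierInv (hK : KernelBounds (heatKernel μ) σ T κ)
    (hμ : Integrable levyWeight μ) {t : ℝ} (ht : t ∈ Ioo 0 T) {a : Rd d → ℂ} (ha : Integrable a)
    (x : Rd d) :
    ∫ y, (heatKernel μ t y : ℂ) * 𝓕⁻ a (x - y) = 𝓕⁻ (fun η => a η * heatSymbol μ t η) x := by
  have hk : Integrable fun y => (heatKernel μ t y : ℂ) := (hK.integrable_heatKernel ht).ofReal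
  have hprod : Integrable (fun p : Rd d × Rd d =>
      character (inner ℝ p.2 (x - p.1)) * ((heatKernel μ t p.1 : ℂ) * a p.2))
      (volume.prod volume) := by
    refine (hk.mul_prod ha).bdd_mul (c := 1) ?_ (ae_of_all _ fun p => (norm_character _).le)
    exact (continuous_character.comp (by fun_prop :
      Continuous fun p : Rd d × Rd d => (inner ℝ p.2 (x - p.1) : ℝ))).aestronglyMeasurable
  calc ∫ y, (heatKernel μ t y : ℂ) * 𝓕⁻ a (x - y)
      = ∫ y, ∫ η, character (inner ℝ η (x - y)) * ((heatKernel μ t y : ℂ) * a η) := by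
        refine integral_congr_ae (ae_of_all _ fun y => ?_)
        simp only [fourierInv_eq_character]
        rw [← integral_const_mul]
        refine integral_congr_ae (ae_of_all _ fun η => ?_)
        ring
    _ = ∫ η, ∫ y, character (inner ℝ η (x - y)) * ((heatKernel μ t y : ℂ) * a η) :=
        integral_integral_swap hprod
    _ = _ := by
        rw [fourierInv_eq_character]
        refine integral_congr_ae (ae_of_all _ fun η => ?_)
        simp only
        rw [← hK.fourier_heatKernel hμ ht η, ← integral_const_mul, ← integral_const_mul]
        refine integral_congr_ae (ae_of_all _ fun y => ?_)
        simp only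
        rw [inner_sub_right, sub_eq_add_neg, character_add, real_inner_comm y η]
        ring

lemma KernelBounds.heatKernel_semigroup (hK : KernelBounds (heatKernel μ) σ T κ)
    (hμ : Integrable levyWeight μ) {s t : ℝ} (hs : s ∈ Ioo 0 T) (ht : t ∈ Ioo 0 T) (x : Rd d) :
    heatKernel μ (s + t) x = (heatKernel μ s ⋆[smulB ℝ] heatKernel μ t) x := by
  have h := hK.integral_heatKernel_mul_fourierInv hμ hs (integrable_heatSymbol (hK.mass t ht) hμ) x
  simp only [← heatKernel_coe, mul_comm (heatSymbol μ t _), ← heatSymbol_add, ← Complex.ofReal_mul,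
    integral_complex_ofReal] at h
  exact_mod_cast h.symm

/-- Scheffé's lemma for the heat kernel: pointwise continuity in time, which follows from the
Fourier representation, improves to continuity in `L¹` since all the kernels are probability
densities. -/
lemma KernelBounds.l1_cont (hK : KernelBounds (heatKernel μ) σ T κ)
    (hμ : Integrable levyWeight μ) (hmass : ∀ t ∈ Ioo 0 T, ∫ y, heatKernel μ t y = 1) {t : ℝ}
    (ht : t ∈ Ioo 0 T) :
    Tendsto (fun s => ∫ y, ‖heatKernel μ s y - heatKernel μ t y‖) (𝓝 t) (𝓝 0) := by
  have ht2 : t / 2 ∈ Ioo 0 T := ⟨by linarith [ht.1], by linarith [ht.1, ht.2]⟩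
  have hpt : ∀ x, Tendsto (fun s => heatKernel μ s x) (𝓝 t) (𝓝 (heatKernel μ t x)) := by
    intro x
    have h1 : Tendsto (fun s => 𝓕⁻ (heatSymbol μ s) x) (𝓝 t) (𝓝 (𝓕⁻ (heatSymbol μ t) x)) := by
      simp only [fourierInv_eq_character]
      refine tendsto_integral_filter_of_dominated_convergence (fun η => ‖heatSymbol μ (t / 2) η‖)
        (Eventually.of_forall fun s => ?_) ?_
        (integrable_heatSymbol (hK.mass _ ht2) hμ).norm (ae_of_all _ fun η => ?_)
      · exact ((continuous_character.comp (by fun_prop : Continuous fun η : Rd d =>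
          (inner ℝ η x : ℝ))).mul ((continuous_heatSymbol hμ).comp
          (by fun_prop : Continuous fun η : Rd d => (s, η)))).aestronglyMeasurable
      · filter_upwards [lt_mem_nhds (show t / 2 < t by linarith [ht.1])] with s hs
        refine ae_of_all _ fun η => ?_
        rw [norm_mul, norm_character, one_mul]
        exact norm_heatSymbol_le hμ hs.le η
      · exact (((continuous_heatSymbol hμ).comp
          (by fun_prop : Continuous fun s : ℝ => (s, η))).tendsto t).const_mul _
    have h2 := (Complex.continuous_re.tendsto _).comp h1
    exact h2
  have hpos : Tendsto (fun s => ∫ y, max (heatKernel μ t y - heatKernel μ s y) 0) (𝓝 t) (𝓝 0) := by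
    have : Tendsto (fun s => ∫ y, max (heatKernel μ t y - heatKernel μ s y) 0) (𝓝 t)
        (𝓝 (∫ y : Rd d, (0 : ℝ))) := by
      refine tendsto_integral_filter_of_dominated_convergence (heatKernel μ t) ?_ ?_
        (hK.integrable_heatKernel ht) (ae_of_all _ fun y => ?_)
      · filter_upwards [Ioo_mem_nhds ht.1 ht.2] with s hs
        exact (((hK.smooth t ht).continuous.sub (hK.smooth s hs).continuous).max
          continuous_const).aestronglyMeasurable
      · filter_upwards [Ioo_mem_nhds ht.1 ht.2] with s hs
        refine ae_of_all _ fun y => ?_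
        rw [Real.norm_of_nonneg (le_max_right _ _)]
        exact max_le (by linarith [hK.nonneg s hs y]) (hK.nonneg t ht y)
      · have h1 : Continuous fun r : ℝ => max (heatKernel μ t y - r) 0 := by fun_prop
        simpa [Function.comp_def] using (h1.tendsto _).comp (hpt y)
    simpa using this
  have h2 := hpos.const_mul 2
  rw [mul_zero] at h2
  refine h2.congr' ?_
  filter_upwards [Ioo_mem_nhds ht.1 ht.2] with s hs
  have hd : Integrable fun y => heatKernel μ s y - heatKernel μ t y :=
    (hK.integrable_heatKernel hs).sub (hK.integrable_heatKernel ht)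
  have hd' := (hK.integrable_heatKernel ht).sub (hK.integrable_heatKernel hs)
  have e : ∀ y, ‖heatKernel μ s y - heatKernel μ t y‖
      = 2 * max (heatKernel μ t y - heatKernel μ s y) 0
        + (heatKernel μ s y - heatKernel μ t y) := by
    intro y
    rw [Real.norm_eq_abs]
    rcases le_total (heatKernel μ t y) (heatKernel μ s y) with h | h
    · rw [abs_of_nonneg (by linarith), max_eq_right (by linarith)]; ring
    · rw [abs_of_nonpos (by linarith), max_eq_left (by linarith)]; ring
  simp only [e]
  have hmx : Integrable fun y => 2 * max (heatKernel μ t y - heatKernel μ s y) 0 :=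
    (hd'.pos_part).const_mul 2
  have hd0 : ∫ y, (heatKernel μ s y - heatKernel μ t y) = 0 := by
    rw [integral_sub (hK.integrable_heatKernel hs) (hK.integrable_heatKernel ht), hmass s hs,
      hmass t ht, sub_self]
  rw [integral_add hmx hd, integral_const_mul]
  exact ((add_eq_left).2 hd0).symm

lemma norm_fderiv_fderiv_eq {V E : Type*} [NormedAddCommGroup V] [NormedSpace ℝ V]
    [NormedAddCommGroup E] [NormedSpace ℝ E] (f : V → E) (x : V) :
    ‖fderiv ℝ (fderiv ℝ f) x‖ = ‖iteratedFDeriv ℝ 2 f x‖ := by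
  rw [← norm_iteratedFDeriv_one, norm_iteratedFDeriv_fderiv]

lemma norm_fderiv_fderiv_fderiv_eq {V E : Type*} [NormedAddCommGroup V] [NormedSpace ℝ V]
    [NormedAddCommGroup E] [NormedSpace ℝ E] (f : V → E) (x : V) :
    ‖fderiv ℝ (fderiv ℝ (fderiv ℝ f)) x‖ = ‖iteratedFDeriv ℝ 3 f x‖ := by
  rw [norm_fderiv_fderiv_eq, norm_iteratedFDeriv_fderiv]

/-- Only the `L¹` bounds for derivatives of order at most three enter. The semigroup property is
read off from the multipliers, and boundedness from their integrability. -/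
theorem KernelBounds.isHeatFamily (hK : KernelBounds (heatKernel μ) σ T κ)
    (hμ : Integrable levyWeight μ) : IsHeatFamily (heatKernel μ) σ T (max (κ 1 1) 0) := by
  have hfin : ∀ t ∈ Ioo 0 T, ∀ n, ∫⁻ x, ‖iteratedFDeriv ℝ n (heatKernel μ t) x‖ₑ
      ≤ ENNReal.ofReal (κ n 1 * t ^ (-(1 / σ) * n)) := by
    intro t ht n
    have := hK.bound t ht n 1 le_rfl
    rw [ENNReal.ofReal_one, eLpNorm_one_eq_lintegral_enorm] at this
    simpa using this
  have hint : ∀ t ∈ Ioo 0 T, ∀ n, Integrable fun x => ‖iteratedFDeriv ℝ n (heatKernel μ t) x‖ := by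
    intro t ht n
    refine ⟨((hK.smooth t ht).continuous_iteratedFDeriv
      (by exact_mod_cast le_top)).norm.aestronglyMeasurable, ?_⟩
    rw [hasFiniteIntegral_norm_iff, hasFiniteIntegral_iff_enorm]
    exact (hfin t ht n).trans_lt ENNReal.ofReal_lt_top
  have hs : ∀ t ∈ Ioo 0 T, ContDiff ℝ 3 (heatKernel μ t) := fun t ht =>
    contDiff_infty.1 (hK.smooth t ht) 3
  have hmass : ∀ t ∈ Ioo 0 T, ∫ y, heatKernel μ t y = 1 := by
    intro t ht
    have := hK.mass t ht
    rw [eLpNorm_one_eq_lintegral_enorm] at this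
    rw [integral_eq_lintegral_of_nonneg_ae (ae_of_all _ (hK.nonneg t ht))
      (hK.smooth t ht).continuous.aestronglyMeasurable, ← ENNReal.toReal_one, ← this]
    congr 1
    refine lintegral_congr fun y => ?_
    rw [Real.enorm_of_nonneg (hK.nonneg t ht y)]
  refine
    { smooth := hK.smooth
      nonneg := hK.nonneg
      bounded := fun t _ => ⟨∫ η, ‖heatSymbol μ t η‖, fun x => ?_⟩
      int0 := fun t ht => hK.integrable_heatKernel ht
      int1 := fun t ht => ?_
      int2 := fun t ht => ?_
      int3 := fun t ht => ?_
      mass := hmass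
      grad_bound := fun t ht => ?_
      semigroup := fun s hs t ht _ x => hK.heatKernel_semigroup hμ hs ht x
      l1_cont := fun t ht => hK.l1_cont hμ hmass ht }
  · rw [← Complex.norm_real, heatKernel_coe]
    exact norm_fourierInv_le _ _
  · refine (integrable_norm_iff ((hs t ht).continuous_fderiv
      (by norm_num)).aestronglyMeasurable).1 ((hint t ht 1).congr (ae_of_all _ fun x => ?_))
    exact norm_iteratedFDeriv_one _
  · have h1 : ContDiff ℝ 2 (fderiv ℝ (heatKernel μ t)) := (hs t ht).fderiv_right (by norm_num)
    refine (integrable_norm_iff (h1.continuous_fderiv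
      (by norm_num)).aestronglyMeasurable).1 ((hint t ht 2).congr (ae_of_all _ fun x => ?_))
    exact (norm_fderiv_fderiv_eq _ _).symm
  · have h1 : ContDiff ℝ 2 (fderiv ℝ (heatKernel μ t)) := (hs t ht).fderiv_right (by norm_num)
    have h2 : ContDiff ℝ 1 (fderiv ℝ (fderiv ℝ (heatKernel μ t))) := h1.fderiv_right (by norm_num)
    refine (integrable_norm_iff (h2.continuous_fderiv
      (by norm_num)).aestronglyMeasurable).1 ((hint t ht 3).congr (ae_of_all _ fun x => ?_))
    exact (norm_fderiv_fderiv_fderiv_eq _ _).symm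
  · have h2 : ∫⁻ x, ‖fderiv ℝ (heatKernel μ t) x‖ₑ
        ≤ ENNReal.ofReal (κ 1 1 * t ^ (-(1 / σ))) := by
      have h1 := hfin t ht 1
      rw [Nat.cast_one, mul_one] at h1
      refine (lintegral_congr fun x => ?_).le.trans h1
      rw [← ofReal_norm, ← ofReal_norm, norm_iteratedFDeriv_one]
    have h1 := ENNReal.toReal_mono ENNReal.ofReal_ne_top h2
    rw [← integral_norm_eq_lintegral_enorm ((hs t ht).continuous_fderiv
      (by norm_num)).aestronglyMeasurable, ENNReal.toReal_ofReal'] at h1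
    rw [max_mul_of_nonneg _ _ (Real.rpow_nonneg ht.1.le _), zero_mul]
    exact h1

end HeatKernel

/-! ### The Lévy operator generates the heat semigroup -/

section Generator

variable {d : ℕ} {μ : Measure (Rd d)} {σ T : ℝ} {κ : ℕ → ℝ → ℝ}

lemma hasDerivAt_character (θ : ℝ) :
    HasDerivAt character (character θ * (2 * Real.pi * Complex.I)) θ := by
  have h1 : HasDerivAt (fun θ : ℝ => (((2 * Real.pi * θ : ℝ) : ℂ) * Complex.I))
      (2 * Real.pi * Complex.I) θ := by
    have := (((hasDerivAt_id θ).const_mul (2 * Real.pi)).ofReal_comp).mul_const Complex.I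
    simpa using this
  exact h1.cexp

/-- Directional derivatives of a Fourier integral. -/
lemma hasDerivAt_fourierInv {a : Rd d → ℂ} (ha : Integrable a)
    (ha1 : Integrable fun η => ‖η‖ * ‖a η‖) (x z : Rd d) :
    HasDerivAt (fun τ : ℝ => 𝓕⁻ a (x + τ • z))
      (∫ η, character (inner ℝ η x) * ((2 * Real.pi * (inner ℝ η z : ℝ)) * Complex.I * a η)) 0 := by
  simp only [fourierInv_eq_character]
  have hd : ∀ η (τ : ℝ), HasDerivAt (fun τ : ℝ => character (inner ℝ η (x + τ • z)) * a η)
      (character (inner ℝ η (x + τ • z)) * ((2 * Real.pi * (inner ℝ η z : ℝ)) * Complex.I * a η))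
      τ := by
    intro η τ
    have h1 : HasDerivAt (fun τ : ℝ => (inner ℝ η (x + τ • z) : ℝ)) (inner ℝ η z) τ := by
      simp only [inner_add_right, inner_smul_right]
      simpa using ((hasDerivAt_id τ).mul_const (inner ℝ η z)).const_add (inner ℝ η x)
    have h2 := ((hasDerivAt_character _).scomp τ h1).mul_const (a η)
    refine h2.congr_deriv ?_
    rw [Complex.real_smul]
    ring
  have hmeas : AEStronglyMeasurable (fun η : Rd d =>
      (2 * Real.pi * ((inner ℝ η z : ℝ) : ℂ)) * Complex.I * a η) volume :=
    ((by fun_prop : Continuous fun η : Rd d =>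
      (2 * Real.pi * ((inner ℝ η z : ℝ) : ℂ)) * Complex.I).aestronglyMeasurable).mul
      ha.aestronglyMeasurable
  have := (hasDerivAt_integral_of_dominated_loc_of_deriv_le (𝕜 := ℝ) (μ := volume) (s := univ)
    (F := fun τ η => character (inner ℝ η (x + τ • z)) * a η)
    (F' := fun τ η => character (inner ℝ η (x + τ • z)) *
      ((2 * Real.pi * (inner ℝ η z : ℝ)) * Complex.I * a η))
    (x₀ := (0 : ℝ)) (bound := fun η => 2 * Real.pi * ‖z‖ * (‖η‖ * ‖a η‖)) univ_mem
    (Eventually.of_forall fun τ =>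
      (integrable_character_mul ha (by fun_prop)).aestronglyMeasurable)
    (integrable_character_mul ha (by fun_prop)) ?_ ?_ (ha1.const_mul _)
    (ae_of_all _ fun η τ _ => hd η τ)).2
  · simpa using this
  · exact (continuous_character.comp (by fun_prop)).aestronglyMeasurable.mul hmeas
  · refine ae_of_all _ fun η τ _ => ?_
    rw [norm_mul, norm_character, one_mul, norm_mul, norm_mul, norm_mul, Complex.norm_I,
      Complex.norm_real, mul_one]
    have h1 := norm_inner_le_norm (𝕜 := ℝ) η z
    have h2 : ‖(2 * Real.pi : ℂ)‖ = 2 * Real.pi := by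
      rw [norm_mul, Complex.norm_real, Real.norm_of_nonneg Real.pi_pos.le]
      simp
    rw [h2]
    have := Real.pi_pos
    calc 2 * Real.pi * ‖(inner ℝ η z : ℝ)‖ * ‖a η‖ ≤ 2 * Real.pi * (‖η‖ * ‖z‖) * ‖a η‖ := by
          gcongr
      _ = _ := by ring

/-- The Lévy operator is a Fourier multiplier. -/
lemma levyOp_eq_fourierInv (hμ : Integrable levyWeight μ) {a : Rd d → ℂ} (ha : Integrable a)
    (ha1 : Integrable fun η => ‖η‖ * ‖a η‖) (ha2 : Integrable fun η => ‖η‖ ^ 2 * ‖a η‖)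
    {φ : Rd d → ℝ} (hφ : ∀ x, (φ x : ℂ) = 𝓕⁻ a x) {φ' : Rd d → Rd d →L[ℝ] ℝ}
    (hφ' : ∀ x, HasFDerivAt φ (φ' x) x) (x : Rd d) :
    (levyOp μ φ x : ℂ) = 𝓕⁻ (fun η => a η * levySymbol μ ((2 * Real.pi) • η)) x := by
  have hgrad : ∀ z, (φ' x z : ℂ)
      = ∫ η, character (inner ℝ η x) * ((2 * Real.pi * (inner ℝ η z : ℝ)) * Complex.I * a η) := by
    intro z
    have h1 : HasDerivAt (fun τ : ℝ => x + τ • z) z 0 := by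
      simpa using ((hasDerivAt_id (0 : ℝ)).smul_const z).const_add x
    have h2 : HasDerivAt (fun τ : ℝ => φ (x + τ • z)) (φ' x z) 0 :=
      HasFDerivAt.comp_hasDerivAt (0 : ℝ) (by simpa using hφ' x) h1
    have h3 := h2.ofReal_comp
    simp only [hφ] at h3
    exact h3.unique (hasDerivAt_fourierInv ha ha1 x z)
  have hint : ∀ y, Integrable fun η => character (inner ℝ η y) * a η := fun y =>
    integrable_character_mul ha (by fun_prop)
  have hpt : ∀ z, (levyIntegrand φ (φ' x) x z : ℂ)
      = ∫ η, character (inner ℝ η x) * a η * symbolIntegrand ((2 * Real.pi) • η) z := by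
    intro z
    have e1 : ∀ η, Complex.exp (Complex.I * ((inner ℝ z ((2 * Real.pi) • η) : ℝ) : ℂ))
        = character (inner ℝ η z) := by
      intro η
      rw [character, mul_comm Complex.I, inner_smul_right, real_inner_comm]
    have h12 : Integrable fun η => character (inner ℝ η (x + z)) * a η
        - character (inner ℝ η x) * a η := (hint (x + z)).sub (hint x)
    rw [levyIntegrand, Complex.ofReal_sub, Complex.ofReal_sub, hφ, hφ, fourierInv_eq_character,
      fourierInv_eq_character, ← integral_sub (hint _) (hint _)]
    by_cases hz : z ∈ Metric.ball (0 : Rd d) 1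
    · have h3 : Integrable fun η =>
          character (inner ℝ η x) * ((2 * Real.pi * (inner ℝ η z : ℝ)) * Complex.I * a η) := by
        refine Integrable.bdd_mul (c := 1) ?_
          (continuous_character.comp (by fun_prop)).aestronglyMeasurable
          (ae_of_all _ fun η => (norm_character _).le)
        refine (ha1.const_mul (2 * Real.pi * ‖z‖)).mono'
          (((by fun_prop : Continuous fun η : Rd d =>
            (2 * Real.pi * ((inner ℝ η z : ℝ) : ℂ)) * Complex.I).aestronglyMeasurable).mul
            ha.aestronglyMeasurable) (ae_of_all _ fun η => ?_)
        rw [norm_mul, norm_mul, norm_mul, Complex.norm_I, Complex.norm_real, mul_one]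
        have h1 := norm_inner_le_norm (𝕜 := ℝ) η z
        have h2 : ‖(2 * Real.pi : ℂ)‖ = 2 * Real.pi := by
          rw [norm_mul, Complex.norm_real, Real.norm_of_nonneg Real.pi_pos.le]
          simp
        rw [h2]
        have := Real.pi_pos
        calc 2 * Real.pi * ‖(inner ℝ η z : ℝ)‖ * ‖a η‖ ≤ 2 * Real.pi * (‖η‖ * ‖z‖) * ‖a η‖ := by
              gcongr
          _ = _ := by ring
      rw [indicator_of_mem hz, hgrad, ← integral_sub h12 h3]
      refine integral_congr_ae (ae_of_all _ fun η => ?_)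
      simp only [symbolIntegrand, indicator_of_mem hz, e1, inner_add_right, character_add,
        inner_smul_left]
      simp
      ring
    · rw [indicator_of_notMem hz, Complex.ofReal_zero, sub_zero]
      refine integral_congr_ae (ae_of_all _ fun η => ?_)
      simp only [symbolIntegrand, indicator_of_notMem hz, e1, inner_add_right, character_add]
      ring
  -- Fubini needs an s-finite measure; away from the origin `μ` is σ-finite.
  obtain ⟨t, ht, ht0, hσt⟩ := FinStronglyMeasurable.exists_set_sigmaFinite
    ((memLp_one_iff_integrable.2 hμ).finStronglyMeasurable_of_stronglyMeasurable
      continuous_levyWeight.stronglyMeasurable one_ne_zero ENNReal.one_ne_top)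
  have htc : ∀ z ∉ t, z = 0 := by
    intro z hz
    by_contra h
    have h1 := ht0 z hz
    have h2 : 0 < levyWeight z := lt_min one_pos (by positivity)
    exact h2.ne' h1
  have hs0 : ∀ ξ, ∀ z ∉ t, symbolIntegrand ξ z = 0 := by
    intro ξ z hz
    rw [htc z hz]
    simp [symbolIntegrand]
  have hl0 : ∀ z ∉ t, (levyIntegrand φ (φ' x) x z : ℂ) = 0 := by
    intro z hz
    rw [htc z hz]
    simp [levyIntegrand]
  have hprod : Integrable (Function.uncurry fun z η : Rd d =>
      character (inner ℝ η x) * a η * symbolIntegrand ((2 * Real.pi) • η) z)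
      ((μ.restrict t).prod volume) := by
    have hb : Integrable (fun η => 2 * (1 + ‖(2 * Real.pi) • η‖ ^ 2) * ‖a η‖) := by
      have := (ha.norm.const_mul 2).add (ha2.const_mul (2 * (2 * Real.pi) ^ 2))
      refine this.congr (ae_of_all _ fun η => ?_)
      simp only [Pi.add_apply]
      rw [norm_smul, Real.norm_of_nonneg (by positivity : 0 ≤ 2 * Real.pi)]
      ring
    have hw : Integrable levyWeight (μ.restrict t) := hμ.mono_measure Measure.restrict_le_self
    refine (hw.mul_prod hb).mono' ?_ (ae_of_all _ fun p => ?_)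
    · refine AEStronglyMeasurable.mul (AEStronglyMeasurable.mul ?_ ?_) ?_
      · exact (continuous_character.comp (by fun_prop : Continuous fun p : Rd d × Rd d =>
          (inner ℝ p.2 x : ℝ))).aestronglyMeasurable
      · exact ha.aestronglyMeasurable.comp_snd
      · exact (measurable_symbolIntegrand.comp
          (by fun_prop : Measurable fun p : Rd d × Rd d =>
            ((2 * Real.pi) • p.2, p.1))).aestronglyMeasurable
    · simp only [Function.uncurry]
      rw [norm_mul, norm_mul, norm_character, one_mul]
      calc ‖a p.2‖ * ‖symbolIntegrand ((2 * Real.pi) • p.2) p.1‖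
          ≤ ‖a p.2‖ * (2 * (1 + ‖(2 * Real.pi) • p.2‖ ^ 2) * levyWeight p.1) := by
            gcongr
            exact norm_symbolIntegrand_le _ _
        _ = _ := by ring
  rw [levyOp_eq (hφ' x), ← integral_complex_ofReal, fourierInv_eq_character,
    ← setIntegral_eq_integral_of_forall_compl_eq_zero hl0]
  simp only [hpt]
  rw [integral_integral_swap hprod]
  refine integral_congr_ae (ae_of_all _ fun η => ?_)
  simp only
  rw [integral_const_mul, setIntegral_eq_integral_of_forall_compl_eq_zero (hs0 _), levySymbol_eq,
    mul_assoc]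

end Generator

section Generator

variable {d : ℕ} {μ : Measure (Rd d)} {σ T : ℝ} {κ : ℕ → ℝ → ℝ}

lemma heatSymbol_sub_one (t : ℝ) (ht : 0 ≤ t) (η : Rd d) :
    heatSymbol μ t η - 1
      = ∫ s in Ioo 0 t, levySymbol μ ((2 * Real.pi) • η) * heatSymbol μ s η := by
  have hd : ∀ s : ℝ, HasDerivAt (fun s : ℝ => heatSymbol μ s η)
      (levySymbol μ ((2 * Real.pi) • η) * heatSymbol μ s η) s := by
    intro s
    have h1 : HasDerivAt (fun s : ℝ => (s : ℂ) * levySymbol μ ((2 * Real.pi) • η))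
        (levySymbol μ ((2 * Real.pi) • η)) s := by
      simpa using ((hasDerivAt_id s).ofReal_comp).mul_const (levySymbol μ ((2 * Real.pi) • η))
    refine h1.cexp.congr_deriv ?_
    rw [heatSymbol, mul_comm]
  have hc : Continuous fun s : ℝ => heatSymbol μ s η :=
    continuous_iff_continuousAt.2 fun s => (hd s).continuousAt
  have := intervalIntegral.integral_eq_sub_of_hasDerivAt (a := 0) (b := t) (fun s _ => hd s)
    ((continuous_const.mul hc).intervalIntegrable _ _)
  rw [← integral_Ioc_eq_integral_Ioo, ← intervalIntegral.integral_of_le ht, this]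
  simp [heatSymbol]

/-- Dynkin's formula for Fourier integrals `φ = 𝓕⁻ a`: with `m` the multiplier of `L`, it is the
identity `exp (t m) - 1 = ∫₀ᵗ exp (s m) m ds` integrated against `a`. -/
lemma KernelBounds.convolution_sub_of_fourierInv (hK : KernelBounds (heatKernel μ) σ T κ)
    (hμ : Integrable levyWeight μ) {a : Rd d → ℂ} (ha : Integrable a)
    (ha1 : Integrable fun η => ‖η‖ * ‖a η‖) (ha2 : Integrable fun η => ‖η‖ ^ 2 * ‖a η‖)
    {φ : Rd d → ℝ} (hφ : ∀ x, (φ x : ℂ) = 𝓕⁻ a x) {φ' : Rd d → Rd d →L[ℝ] ℝ}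
    (hφ' : ∀ x, HasFDerivAt φ (φ' x) x) {t : ℝ} (ht : t ∈ Ioo 0 T) (x : Rd d) :
    (heatKernel μ t ⋆[smulB ℝ] φ) x - φ x
      = ∫ s in Ioo 0 t, (heatKernel μ s ⋆[smulB ℝ] levyOp μ φ) x := by
  set m : Rd d → ℂ := fun η => levySymbol μ ((2 * Real.pi) • η) with hm
  have hmc : Continuous m := (continuous_levySymbol hμ).comp (by fun_prop)
  have ham : Integrable fun η => a η * m η := by
    have hb : Integrable (fun η => ‖a η‖ *
        (2 * (1 + ‖(2 * Real.pi) • η‖ ^ 2) * ∫ z, levyWeight z ∂μ)) := by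
      have := ((ha.norm.const_mul 2).add (ha2.const_mul (2 * (2 * Real.pi) ^ 2))).mul_const
        (∫ z, levyWeight z ∂μ)
      refine this.congr (ae_of_all _ fun η => ?_)
      simp only [Pi.add_apply]
      rw [norm_smul, Real.norm_of_nonneg (by positivity : 0 ≤ 2 * Real.pi)]
      ring
    refine hb.mono' (ha.aestronglyMeasurable.mul hmc.aestronglyMeasurable)
      (ae_of_all _ fun η => ?_)
    rw [norm_mul]
    gcongr
    exact norm_levySymbol_le hμ _
  have hgc : ∀ s, Continuous (heatSymbol μ s) := fun s =>
    (continuous_heatSymbol hμ).comp (by fun_prop : Continuous fun η : Rd d => (s, η))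
  have key : ∀ s ∈ Ioo 0 T, ∀ (b : Rd d → ℂ) (ψ : Rd d → ℝ), Integrable b →
      (∀ x, (ψ x : ℂ) = 𝓕⁻ b x) →
      (((heatKernel μ s ⋆[smulB ℝ] ψ) x : ℝ) : ℂ) = 𝓕⁻ (fun η => b η * heatSymbol μ s η) x := by
    intro s hs b ψ hb hψ
    rw [← hK.integral_heatKernel_mul_fourierInv hμ hs hb x]
    simp only [← hψ, ← Complex.ofReal_mul]
    rw [integral_complex_ofReal]
    rfl
  have hL : ∀ s ∈ Ioo 0 t, (((heatKernel μ s ⋆[smulB ℝ] levyOp μ φ) x : ℝ) : ℂ)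
      = ∫ η, character (inner ℝ η x) * (a η * m η) * heatSymbol μ s η := by
    intro s hs
    rw [key s ⟨hs.1, hs.2.trans ht.2⟩ _ _ ham (levyOp_eq_fourierInv hμ ha ha1 ha2 hφ hφ'),
      fourierInv_eq_character]
    simp only [mul_assoc]
  have hprod : Integrable (Function.uncurry fun (s : ℝ) (η : Rd d) =>
      character (inner ℝ η x) * (a η * m η) * heatSymbol μ s η)
      ((volume.restrict (Ioo 0 t)).prod volume) := by
    have h1 : Integrable (fun p : ℝ × Rd d => (1 : ℝ) * ‖a p.2 * m p.2‖)
        ((volume.restrict (Ioo 0 t)).prod volume) :=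
      (integrable_const (1 : ℝ)).mul_prod ham.norm
    refine h1.mono' ?_ ?_
    · refine AEStronglyMeasurable.mul (AEStronglyMeasurable.mul ?_ ?_) ?_
      · exact (continuous_character.comp (by fun_prop : Continuous fun p : ℝ × Rd d =>
          (inner ℝ p.2 x : ℝ))).aestronglyMeasurable
      · exact ham.aestronglyMeasurable.comp_snd
      · exact (continuous_heatSymbol hμ).aestronglyMeasurable
    · have h2 : ∀ᵐ p : ℝ × Rd d ∂((volume.restrict (Ioo 0 t)).prod volume), p.1 ∈ Ioo 0 t :=
        Measure.quasiMeasurePreserving_fst.ae (ae_restrict_mem measurableSet_Ioo)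
      filter_upwards [h2] with p hp
      simp only [Function.uncurry, one_mul]
      rw [norm_mul, norm_mul (character _), norm_character, one_mul]
      exact mul_le_of_le_one_right (norm_nonneg _) (norm_heatSymbol_le_one hμ hp.1.le _)
  have hcast : (((heatKernel μ t ⋆[smulB ℝ] φ) x - φ x : ℝ) : ℂ)
      = ((∫ s in Ioo 0 t, (heatKernel μ s ⋆[smulB ℝ] levyOp μ φ) x : ℝ) : ℂ) := by
    rw [← integral_complex_ofReal, setIntegral_congr_fun measurableSet_Ioo hL,
      integral_integral_swap hprod, Complex.ofReal_sub, key t ht a φ ha hφ, hφ,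
      fourierInv_eq_character, fourierInv_eq_character, ← integral_sub]
    · refine integral_congr_ae (ae_of_all _ fun η => ?_)
      simp only
      have h1 := heatSymbol_sub_one (μ := μ) t ht.1.le η
      calc character (inner ℝ η x) * (a η * heatSymbol μ t η) - character (inner ℝ η x) * a η
          = character (inner ℝ η x) * a η * (heatSymbol μ t η - 1) := by ring
        _ = _ := by
          rw [h1, ← integral_const_mul]
          refine integral_congr_ae (ae_of_all _ fun s => ?_)
          simp only [hm]
          ring
    · refine integrable_character_mul (ha.mul_bdd (c := 1) (hgc t).aestronglyMeasurable
        (ae_of_all _ fun η => norm_heatSymbol_le_one hμ ht.1.le η)) (by fun_prop)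
    · exact integrable_character_mul ha (by fun_prop)
  exact_mod_cast hcast

/-- Smooth compactly supported functions are Fourier integrals of rapidly decreasing functions. -/
lemma exists_fourierInv_eq {φ : Rd d → ℝ} (hφ : ContDiff ℝ (⊤ : ℕ∞) φ)
    (hs : HasCompactSupport φ) :
    ∃ a : Rd d → ℂ, Integrable a ∧ (Integrable fun η => ‖η‖ * ‖a η‖) ∧
      (Integrable fun η => ‖η‖ ^ 2 * ‖a η‖) ∧ ∀ x, (φ x : ℂ) = 𝓕⁻ a x := by
  have h1 : ContDiff ℝ (⊤ : ℕ∞) fun x => (φ x : ℂ) := Complex.ofRealCLM.contDiff.comp hφ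
  have h2 : HasCompactSupport fun x => (φ x : ℂ) := hs.comp_left (g := Complex.ofReal) rfl
  let f : SchwartzMap (Rd d) ℂ := h2.toSchwartzMap h1
  let a : SchwartzMap (Rd d) ℂ := 𝓕 f
  refine ⟨a, a.integrable, by simpa using a.integrable_pow_mul volume 1,
    a.integrable_pow_mul volume 2, fun x => ?_⟩
  have h3 : 𝓕⁻ (𝓕 f) = f := FourierPair.fourierInv_fourier_eq f
  have h4 : 𝓕⁻ (a : Rd d → ℂ) = f := by
    rw [← SchwartzMap.fourierInv_coe, h3]
  rw [h4]
  rfl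

/-- Dynkin's formula is stable under pointwise convergence of functions and gradients with uniform
`C^{1,1}` bounds. -/
lemma tendsto_heat_identity {κ₁ : ℝ} (hK : IsHeatFamily (heatKernel μ) σ T κ₁)
    (hμ : Integrable levyWeight μ) {C : ℝ} (hC : LevyCondition μ C)
    {φ : ℕ → Rd d → ℝ} {φ' : ℕ → Rd d → Rd d →L[ℝ] ℝ} {a b : ℝ}
    (h : ∀ n, IsC11 (φ n) (φ' n) a b) {φ₀ : Rd d → ℝ} {φ₀' : Rd d → Rd d →L[ℝ] ℝ}
    (h₀ : ∀ x, HasFDerivAt φ₀ (φ₀' x) x)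
    (hlim : ∀ x, Tendsto (fun n => φ n x) atTop (𝓝 (φ₀ x)))
    (hlim' : ∀ x, Tendsto (fun n => φ' n x) atTop (𝓝 (φ₀' x)))
    {t : ℝ} (ht : t ∈ Ioo 0 T) (x : Rd d)
    (hid : ∀ n, (heatKernel μ t ⋆[smulB ℝ] φ n) x - φ n x
      = ∫ s in Ioo 0 t, (heatKernel μ s ⋆[smulB ℝ] levyOp μ (φ n)) x) :
    (heatKernel μ t ⋆[smulB ℝ] φ₀) x - φ₀ x
      = ∫ s in Ioo 0 t, (heatKernel μ s ⋆[smulB ℝ] levyOp μ φ₀) x := by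
  have h1 : Tendsto (fun n => (heatKernel μ t ⋆[smulB ℝ] φ n) x - φ n x) atTop
      (𝓝 ((heatKernel μ t ⋆[smulB ℝ] φ₀) x - φ₀ x)) := by
    refine Tendsto.sub ?_ (hlim x)
    exact tendsto_convolution (x := fun _ => x) norm_smulB_le
      (Eventually.of_forall fun _ => hK.int0 t ht) (hK.int0 t ht) (by simp)
      (Eventually.of_forall fun n => ⟨(h n).continuous, (h n).bdd⟩) fun y => hlim _
  have hb : ∀ n y, ‖levyOp μ (φ n) y‖ ≤ (2 * a + b) * |C| := fun n => (h n).abs_levyOp_le hC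
  have h2 : Tendsto (fun n => ∫ s in Ioo 0 t, (heatKernel μ s ⋆[smulB ℝ] levyOp μ (φ n)) x) atTop
      (𝓝 (∫ s in Ioo 0 t, (heatKernel μ s ⋆[smulB ℝ] levyOp μ φ₀) x)) := by
    refine tendsto_integral_of_dominated_convergence (fun _ => (2 * a + b) * |C|) (fun n => ?_)
      (integrable_const _) (fun n => ?_) ?_
    · refine ContinuousOn.aestronglyMeasurable ?_ measurableSet_Ioo
      have := hK.continuousOn_convolution ((h n).continuous_levyOp hμ) (hb n)
      exact this.comp (f := fun s : ℝ => (s, x)) (by fun_prop)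
        fun s hs => ⟨⟨hs.1, hs.2.trans ht.2⟩, mem_univ _⟩
    · filter_upwards [ae_restrict_mem measurableSet_Ioo] with s hs
      exact hK.norm_convolution_le ⟨hs.1, hs.2.trans ht.2⟩ (hb n) x
    · filter_upwards [ae_restrict_mem measurableSet_Ioo] with s hs
      have hs' : s ∈ Ioo 0 T := ⟨hs.1, hs.2.trans ht.2⟩
      exact tendsto_convolution (x := fun _ => x) norm_smulB_le
        (Eventually.of_forall fun _ => hK.int0 s hs') (hK.int0 s hs') (by simp)
        (Eventually.of_forall fun n => ⟨(h n).continuous_levyOp hμ, hb n⟩) fun y =>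
          tendsto_levyOp (x := fun _ => x - y) hμ (Eventually.of_forall h) h₀
            (fun z => hlim _) (hlim' _)
  exact tendsto_nhds_unique h1 (by simpa only [hid] using h2)

end Generator

/-! ### Cutoff and mollification -/

section C11

variable {d : ℕ}

namespace IsC11

variable {φ ψ : Rd d → ℝ} {φ' ψ' : Rd d → Rd d →L[ℝ] ℝ} {a b a' b' : ℝ}

lemma abs_sub_le (h : IsC11 φ φ' a b) (x y : Rd d) : |φ x - φ y| ≤ b * ‖x - y‖ :=
  Convex.norm_image_sub_le_of_norm_hasFDerivWithin_le (𝕜 := ℝ) (f := φ) (f' := φ') (s := univ)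
    (fun z _ => (h.hasFDerivAt z).hasFDerivWithinAt) (fun z _ => h.bdd' z) convex_univ
    (mem_univ y) (mem_univ x)

lemma mul (h : IsC11 φ φ' a b) (k : IsC11 ψ ψ' a' b') :
    IsC11 (fun x => φ x * ψ x) (fun x => φ x • ψ' x + ψ x • φ' x) (a * a')
      (a * b' + a' * b + 2 * (b * b')) := by
  have ha := h.a_nonneg
  have hb := h.b_nonneg
  have ha' := k.a_nonneg
  have hb' := k.b_nonneg
  refine ⟨fun x => (h.hasFDerivAt x).mul (k.hasFDerivAt x), fun x => ?_, fun x => ?_,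
    fun x y => ?_⟩
  · rw [abs_mul]
    exact mul_le_mul (h.bdd x) (k.bdd x) (abs_nonneg _) ha
  · have h1 : ‖φ x • ψ' x‖ ≤ a * b' := by
      rw [norm_smul]
      exact mul_le_mul (h.bdd x) (k.bdd' x) (norm_nonneg _) ha
    have h2 : ‖ψ x • φ' x‖ ≤ a' * b := by
      rw [norm_smul]
      exact mul_le_mul (k.bdd x) (h.bdd' x) (norm_nonneg _) ha'
    have := norm_add_le (φ x • ψ' x) (ψ x • φ' x)
    nlinarith [mul_nonneg hb hb']
  · have e : φ x • ψ' x + ψ x • φ' x - (φ y • ψ' y + ψ y • φ' y)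
        = φ x • (ψ' x - ψ' y) + (φ x - φ y) • ψ' y + (ψ x • (φ' x - φ' y) + (ψ x - ψ y) • φ' y) := by
      module
    have hn := norm_nonneg (x - y)
    have h1 : ‖φ x • (ψ' x - ψ' y)‖ ≤ a * (b' * ‖x - y‖) := by
      rw [norm_smul]
      exact mul_le_mul (h.bdd x) (k.lip x y) (norm_nonneg _) ha
    have h2 : ‖(φ x - φ y) • ψ' y‖ ≤ b * ‖x - y‖ * b' := by
      rw [norm_smul]
      exact mul_le_mul (h.abs_sub_le x y) (k.bdd' y) (norm_nonneg _) (by positivity)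
    have h3 : ‖ψ x • (φ' x - φ' y)‖ ≤ a' * (b * ‖x - y‖) := by
      rw [norm_smul]
      exact mul_le_mul (k.bdd x) (h.lip x y) (norm_nonneg _) ha'
    have h4 : ‖(ψ x - ψ y) • φ' y‖ ≤ b' * ‖x - y‖ * b := by
      rw [norm_smul]
      exact mul_le_mul (k.abs_sub_le x y) (h.bdd' y) (norm_nonneg _) (by positivity)
    rw [e]
    refine ((norm_add_le _ _).trans (add_le_add (norm_add_le _ _) (norm_add_le _ _))).trans ?_
    linarith

lemma comp_smul (h : IsC11 φ φ' a b) (r : ℝ) :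
    IsC11 (fun x => φ (r • x)) (fun x => r • φ' (r • x)) a ((|r| + r ^ 2) * b) := by
  have hb := h.b_nonneg
  refine ⟨fun x => ?_, fun x => h.bdd _, fun x => ?_, fun x y => ?_⟩
  · have := (h.hasFDerivAt (r • x)).comp x ((hasFDerivAt_id x).const_smul r)
    refine this.congr_fderiv ?_
    ext z
    simp
  · rw [norm_smul, Real.norm_eq_abs]
    have := mul_le_mul_of_nonneg_left (h.bdd' (r • x)) (abs_nonneg r)
    nlinarith [mul_nonneg (sq_nonneg r) hb]
  · rw [← smul_sub, norm_smul, Real.norm_eq_abs]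
    have h1 := h.lip (r • x) (r • y)
    rw [← smul_sub, norm_smul, Real.norm_eq_abs] at h1
    have := mul_le_mul_of_nonneg_left h1 (abs_nonneg r)
    have e : |r| * (b * (|r| * ‖x - y‖)) = r ^ 2 * b * ‖x - y‖ := by
      rw [← sq_abs r]; ring
    rw [e] at this
    have := mul_nonneg (mul_nonneg (abs_nonneg r) hb) (norm_nonneg (x - y))
    linarith

lemma mono (h : IsC11 φ φ' a b) (ha : a ≤ a') (hb : b ≤ b') : IsC11 φ φ' a' b' :=
  ⟨h.hasFDerivAt, fun x => (h.bdd x).trans ha, fun x => (h.bdd' x).trans hb, fun x y =>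
    (h.lip x y).trans (by gcongr)⟩

lemma convolution (h : IsC11 φ φ' a b) {k : Rd d → ℝ} (hk : Integrable k)
    (hk1 : ∫ y, ‖k y‖ ≤ 1) : IsC11 (k ⋆[smulB ℝ] φ) (k ⋆[smulB (Rd d →L[ℝ] ℝ)] φ') a b := by
  have key : ∀ {E : Type} [NormedAddCommGroup E] [NormedSpace ℝ E] {g : Rd d → E} {c : ℝ} (x : Rd d),
      0 ≤ c → (∀ y, ‖g y‖ ≤ c) → ‖(k ⋆[smulB E] g) x‖ ≤ c := by
    intro E _ _ g c x hc hg
    exact (norm_convolution_le norm_smulB_le hk hg x).trans (mul_le_of_le_one_left hc hk1)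
  refine ⟨fun x => hasFDerivAt_convolution_smul hk h.hasFDerivAt h.continuous' h.bdd h.bdd' x,
    fun x => key (E := ℝ) x h.a_nonneg h.bdd, fun x => key x h.b_nonneg h.bdd', fun x y => ?_⟩
  rw [convolution_sub_right _ hk h.continuous' h.continuous' h.bdd' h.bdd']
  refine key x (mul_nonneg h.b_nonneg (norm_nonneg _)) fun z => ?_
  refine (h.lip _ _).trans (le_of_eq ?_)
  congr 2
  abel

end IsC11

/-- A smooth function with compact support that is equal to `1` in a neighbourhood of `0`. -/
def cutoff (d : ℕ) : ContDiffBump (0 : Rd d) := ⟨1, 2, one_pos, one_lt_two⟩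

lemma exists_isC11_of_hasCompactSupport {φ : Rd d → ℝ} (hφ : ContDiff ℝ 2 φ)
    (hs : HasCompactSupport φ) {a : ℝ} (ha : ∀ x, |φ x| ≤ a) :
    ∃ b, IsC11 φ (fderiv ℝ φ) a b := by
  have h1 : ContDiff ℝ 1 (fderiv ℝ φ) := hφ.fderiv_right (by norm_num)
  obtain ⟨b₁, hb₁⟩ := (hs.fderiv ℝ).exists_bound_of_continuous h1.continuous
  obtain ⟨b₂, hb₂⟩ := h1.lipschitzWith_of_hasCompactSupport (hs.fderiv ℝ) one_ne_zero
  refine ⟨max b₁ b₂, fun x => (hφ.differentiable (by norm_num) x).hasFDerivAt, ha,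
    fun x => (hb₁ x).trans (le_max_left _ _), fun x y => ?_⟩
  have := hb₂.dist_le_mul x y
  rw [dist_eq_norm, dist_eq_norm] at this
  exact this.trans (by gcongr; exact le_max_right _ _)

lemma exists_isC11_cutoff (d : ℕ) : ∃ b, IsC11 (cutoff d) (fderiv ℝ (cutoff d)) 1 b :=
  exists_isC11_of_hasCompactSupport (cutoff d).contDiff (cutoff d).hasCompactSupport fun x => by
    rw [abs_of_nonneg (cutoff d).nonneg]
    exact (cutoff d).le_one

end C11

section Generator

variable {d : ℕ} {μ : Measure (Rd d)} {σ T : ℝ} {κ : ℕ → ℝ → ℝ}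

/-- Dynkin's formula for compactly supported `C^{1,1}` functions, by mollification. -/
lemma KernelBounds.convolution_sub_of_hasCompactSupport (hK : KernelBounds (heatKernel μ) σ T κ)
    {C : ℝ} (hC : LevyCondition μ C) {φ : Rd d → ℝ} {φ' : Rd d → Rd d →L[ℝ] ℝ} {a b : ℝ}
    (h : IsC11 φ φ' a b) (hs : HasCompactSupport φ) {t : ℝ} (ht : t ∈ Ioo 0 T) (x : Rd d) :
    (heatKernel μ t ⋆[smulB ℝ] φ) x - φ x
      = ∫ s in Ioo 0 t, (heatKernel μ s ⋆[smulB ℝ] levyOp μ φ) x := by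
  let ρ : ℕ → ContDiffBump (0 : Rd d) := fun n =>
    ⟨1 / ((n : ℝ) + 1) / 2, 1 / ((n : ℝ) + 1), by positivity, by
      have : (0 : ℝ) < 1 / ((n : ℝ) + 1) := by positivity
      linarith⟩
  have hρ : Tendsto (fun n => (ρ n).rOut) atTop (𝓝 0) := tendsto_one_div_add_atTop_nhds_zero_nat
  have hn : ∀ n, ∫ y, ‖(ρ n).normed volume y‖ ≤ 1 := by
    intro n
    simp only [Real.norm_of_nonneg ((ρ n).nonneg_normed _)]
    exact (ρ n).integral_normed.le
  have hi : ∀ n, Integrable ((ρ n).normed (volume : Measure (Rd d))) := fun n =>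
    (ρ n).integrable_normed
  refine tendsto_heat_identity (hK.isHeatFamily hC.integrable) hC.integrable hC
    (φ := fun n => (ρ n).normed volume ⋆[smulB ℝ] φ) (a := a) (b := b)
    (fun n => h.convolution (hi n) (hn n)) h.hasFDerivAt
    (fun x => ContDiffBump.convolution_tendsto_right_of_continuous hρ h.continuous x)
    (fun x => ContDiffBump.convolution_tendsto_right_of_continuous hρ h.continuous' x) ht x
    fun n => ?_
  have hsm : ContDiff ℝ (⊤ : ℕ∞) ((ρ n).normed volume ⋆[smulB ℝ] φ) :=
    (ρ n).hasCompactSupport_normed.contDiff_convolution_left _ (ρ n).contDiff_normed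
      h.continuous.locallyIntegrable
  have hcs : HasCompactSupport ((ρ n).normed volume ⋆[smulB ℝ] φ) :=
    (ρ n).hasCompactSupport_normed.convolution _ hs
  obtain ⟨A, hA, hA1, hA2, hA3⟩ := exists_fourierInv_eq hsm hcs
  exact hK.convolution_sub_of_fourierInv hC.integrable hA hA1 hA2 hA3
    (h.convolution (hi n) (hn n)).hasFDerivAt ht x

/-- Dynkin's formula: the Lévy operator is the generator of the heat semigroup on `C^{1,1}`. The
function is multiplied by wide cutoffs, which keeps its `C^{1,1}` bounds. -/
theorem KernelBounds.convolution_sub (hK : KernelBounds (heatKernel μ) σ T κ)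
    {C : ℝ} (hC : LevyCondition μ C) {φ : Rd d → ℝ} {φ' : Rd d → Rd d →L[ℝ] ℝ} {a b : ℝ}
    (h : IsC11 φ φ' a b) {t : ℝ} (ht : t ∈ Ioo 0 T) (x : Rd d) :
    (heatKernel μ t ⋆[smulB ℝ] φ) x - φ x
      = ∫ s in Ioo 0 t, (heatKernel μ s ⋆[smulB ℝ] levyOp μ φ) x := by
  obtain ⟨c, hc⟩ := exists_isC11_cutoff d
  let r : ℕ → ℝ := fun n => 1 / ((n : ℝ) + 1)
  have hr : Tendsto r atTop (𝓝 0) := tendsto_one_div_add_atTop_nhds_zero_nat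
  have hr0 : ∀ n, 0 < r n := fun n => by positivity
  have hr1 : ∀ n, r n ≤ 1 := fun n => by
    rw [div_le_one (by positivity)]
    have : (0 : ℝ) ≤ n := by positivity
    linarith
  have hχ : ∀ n, IsC11 (fun x => cutoff d (r n • x)) (fun x => r n • fderiv ℝ (cutoff d) (r n • x))
      1 (2 * c) := by
    intro n
    refine (hc.comp_smul (r n)).mono le_rfl ?_
    have h1 : |r n| + r n ^ 2 ≤ 2 := by
      rw [abs_of_pos (hr0 n)]
      nlinarith [hr0 n, hr1 n]
    exact mul_le_mul_of_nonneg_right h1 hc.b_nonneg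
  have hx : ∀ x : Rd d, Tendsto (fun n => r n • x) atTop (𝓝 0) := fun x => by
    simpa using hr.smul_const x
  have hone : cutoff d 0 = 1 := (cutoff d).one_of_mem_closedBall (by simp [cutoff])
  have hlim : ∀ x : Rd d, Tendsto (fun n => cutoff d (r n • x)) atTop (𝓝 1) := fun x => by
    have := (hc.continuous.tendsto 0).comp (hx x)
    rwa [hone] at this
  have hlim' : ∀ x : Rd d, Tendsto (fun n => r n • fderiv ℝ (cutoff d) (r n • x)) atTop (𝓝 0) :=
    fun x => by
    simpa using hr.smul ((hc.continuous'.tendsto 0).comp (hx x))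
  refine tendsto_heat_identity (hK.isHeatFamily hC.integrable) hC.integrable hC
    (φ := fun n x => φ x * cutoff d (r n • x)) (fun n => h.mul (hχ n)) h.hasFDerivAt
    (fun x => by simpa using (hlim x).const_mul (φ x))
    (fun x => by simpa using ((hlim' x).const_smul (φ x)).add ((hlim x).smul_const (φ' x))) ht x
    fun n => ?_
  refine hK.convolution_sub_of_hasCompactSupport hC (h.mul (hχ n)) ?_ ht x
  have h1 : HasCompactSupport fun x : Rd d => cutoff d (r n • x) :=
    (cutoff d).hasCompactSupport.comp_homeomorph (Homeomorph.smulOfNeZero (r n) (hr0 n).ne')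
  exact h1.mul_left

end Generator

/-! ### Restarting the Duhamel formula -/

section Restart

variable {V : Type*} [NormedAddCommGroup V] [InnerProductSpace ℝ V]
  [FiniteDimensional ℝ V] [MeasurableSpace V] [BorelSpace V] {K : ℝ → V → ℝ} {σ T κ : ℝ}

/-- The semigroup property of the operators `g ↦ K_t * g` on bounded continuous functions. -/
lemma IsHeatFamily.convolution_convolution (hK : IsHeatFamily K σ T κ) {s t : ℝ}
    (hs : s ∈ Ioo 0 T) (ht : t ∈ Ioo 0 T) (hst : s + t < T) {g : V → ℝ} (hg : Continuous g)
    {M : ℝ} (hM : ∀ y, ‖g y‖ ≤ M) (x : V) :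
    (K (s + t) ⋆[smulB ℝ] g) x = (K s ⋆[smulB ℝ] (K t ⋆[smulB ℝ] g)) x := by
  have e : K (s + t) = K s ⋆[smulB ℝ] K t := funext fun y => hK.semigroup s hs t ht hst y
  rw [e]
  have hmulB : ‖ContinuousLinearMap.mul ℝ ℝ‖ ≤ 1 := ContinuousLinearMap.opNorm_mul_le ℝ ℝ
  have hM' : ∀ y, ‖‖g y‖‖ ≤ M := by simpa using hM
  refine convolution_assoc (smulB ℝ) (smulB ℝ) (smulB ℝ) (smulB ℝ) (fun a b c => ?_)
    (hK.int0 s hs).aestronglyMeasurable (hK.int0 t ht).aestronglyMeasurable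
    hg.aestronglyMeasurable ?_ ?_ ?_
  · simp [mul_assoc]
  · exact (hK.int0 s hs).ae_convolution_exists _ (hK.int0 t ht)
  · exact ae_of_all _ fun y => integrable_convolution_integrand (ContinuousLinearMap.mul ℝ ℝ)
      (hK.int0 t ht).norm hg.norm hM' y
  · exact integrable_convolution_integrand (ContinuousLinearMap.mul ℝ ℝ) (hK.int0 s hs).norm
      (continuous_convolution hmulB (hK.int0 t ht).norm hg.norm hM')
      (fun y => FracHJB.norm_convolution_le hmulB (hK.int0 t ht).norm hM' y) x

/-- The semigroup passes under the Duhamel integral. -/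
lemma IsHeatFamily.convolution_duhamel (hK : IsHeatFamily K σ T κ) {F : ℝ → V → ℝ} {M : ℝ}
    (hF : ContinuousOn (fun q : ℝ × V => F q.1 q.2) (Ioo 0 T ×ˢ univ))
    (hM : ∀ s ∈ Ioo 0 T, ∀ y, ‖F s y‖ ≤ M) {t h : ℝ} (ht : 0 < t) (hh : 0 < h) (hth : t + h < T)
    (x : V) :
    (K h ⋆[smulB ℝ] duhamel (smulB ℝ) K F t) x
      = ∫ r in Ioo 0 t, (K (h + r) ⋆[smulB ℝ] F (t - r)) x := by
  have hD := hK.isDuhamel hF hM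
  have hhT : h ∈ Ioo 0 T := ⟨hh, by linarith⟩
  have hc := hD.continuousOn_integrand (t := t) (by linarith)
  have hprod : Integrable (Function.uncurry fun (y : V) (r : ℝ) =>
      K h y * (K r ⋆[smulB ℝ] F (t - r)) (x - y)) (volume.prod (volume.restrict (Ioo 0 t))) := by
    have h1 : Integrable (fun p : V × ℝ => ‖K h p.1‖ * M)
        (volume.prod (volume.restrict (Ioo 0 t))) :=
      (hK.int0 h hhT).norm.mul_prod (integrable_const M)
    have hm : AEStronglyMeasurable (fun p : V × ℝ => (K p.2 ⋆[smulB ℝ] F (t - p.2)) (x - p.1))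
        (volume.prod (volume.restrict (Ioo 0 t))) := by
      have : ContinuousOn (fun p : V × ℝ => (K p.2 ⋆[smulB ℝ] F (t - p.2)) (x - p.1))
          (univ ×ˢ Ioo 0 t) :=
        hc.comp (f := fun p : V × ℝ => (p.2, x - p.1)) (by fun_prop)
          fun p hp => ⟨hp.2, mem_univ _⟩
      have h2 := this.aestronglyMeasurable (μ := volume.prod volume)
        (MeasurableSet.univ.prod measurableSet_Ioo)
      rwa [← Measure.prod_restrict, Measure.restrict_univ] at h2
    refine h1.mono' (((hK.continuous hhT).comp continuous_fst).aestronglyMeasurable.mul hm) ?_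
    have h2 : ∀ᵐ p : V × ℝ ∂(volume.prod (volume.restrict (Ioo 0 t))), p.2 ∈ Ioo 0 t :=
      Measure.quasiMeasurePreserving_snd.ae (ae_restrict_mem measurableSet_Ioo)
    filter_upwards [h2] with p hp
    simp only [Function.uncurry, norm_mul]
    gcongr
    exact hK.norm_convolution_le ⟨hp.1, by linarith [hp.2]⟩
      (hM _ ⟨by linarith [hp.2], by linarith [hp.1]⟩) _
  calc (K h ⋆[smulB ℝ] duhamel (smulB ℝ) K F t) x
      = ∫ y, ∫ r in Ioo 0 t, K h y * (K r ⋆[smulB ℝ] F (t - r)) (x - y) := by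
        refine integral_congr_ae (ae_of_all _ fun y => ?_)
        simp only [duhamel]
        rw [integral_const_mul]
        rfl
    _ = ∫ r in Ioo 0 t, ∫ y, K h y * (K r ⋆[smulB ℝ] F (t - r)) (x - y) :=
        integral_integral_swap hprod
    _ = _ := by
        refine setIntegral_congr_fun measurableSet_Ioo fun r hr => ?_
        have hs : t - r ∈ Ioo 0 T := ⟨by linarith [hr.2], by linarith [hr.1]⟩
        exact (hK.convolution_convolution hhT ⟨hr.1, by linarith [hr.2]⟩ (by linarith [hr.2])
          (continuous_slice hF hs) (hM _ hs) x).symm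

/-- The Duhamel formula may be restarted at any time. -/
lemma IsHeatFamily.restart (hK : IsHeatFamily K σ T κ) {F : ℝ → V → ℝ} {M : ℝ}
    (hF : ContinuousOn (fun q : ℝ × V => F q.1 q.2) (Ioo 0 T ×ˢ univ))
    (hM : ∀ s ∈ Ioo 0 T, ∀ y, ‖F s y‖ ≤ M) {u₀ : V → ℝ} (hu₀ : Continuous u₀) {M₀ : ℝ}
    (hM₀ : ∀ y, ‖u₀ y‖ ≤ M₀) {u : ℝ → V → ℝ}
    (hu : ∀ t ∈ Ioo 0 T, ∀ x, u t x = (K t ⋆[smulB ℝ] u₀) x + duhamel (smulB ℝ) K F t x)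
    {t h : ℝ} (ht : 0 < t) (hh : 0 < h) (hth : t + h < T) (x : V) :
    u (t + h) x = (K h ⋆[smulB ℝ] u t) x + ∫ r in Ioo 0 h, (K r ⋆[smulB ℝ] F (t + h - r)) x := by
  have hD := hK.isDuhamel hF hM
  have hhT : h ∈ Ioo 0 T := ⟨hh, by linarith⟩
  have htT : t ∈ Ioo 0 T := ⟨ht, by linarith⟩
  have e1 : u t = fun y => (K t ⋆[smulB ℝ] u₀) y + duhamel (smulB ℝ) K F t y :=
    funext fun y => hu t htT y
  have hcd : Continuous (duhamel (smulB ℝ) K F t) := continuous_slice hD.continuousOn_duhamel htT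
  have hbd : ∀ y, ‖duhamel (smulB ℝ) K F t y‖ ≤ ∫ r in Ioo 0 t, M := fun y =>
    FracHJB.norm_duhamel_le (by simp) fun r hr =>
      hK.norm_convolution_le ⟨hr.1, hr.2.trans htT.2⟩
        (hM _ ⟨by linarith [hr.2], by linarith [hr.1, htT.2]⟩) y
  have e2 : (K h ⋆[smulB ℝ] u t) x
      = (K h ⋆[smulB ℝ] (K t ⋆[smulB ℝ] u₀)) x + (K h ⋆[smulB ℝ] duhamel (smulB ℝ) K F t) x := by
    rw [e1]
    have h1 := integrable_convolution_integrand (smulB ℝ) (hK.int0 h hhT)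
      (continuous_convolution norm_smulB_le (hK.int0 t htT) hu₀ hM₀)
      (hK.norm_convolution_le htT hM₀) x
    have h2 := integrable_convolution_integrand (smulB ℝ) (hK.int0 h hhT) hcd hbd x
    refine Eq.trans (integral_congr_ae (ae_of_all _ fun y => ?_)) (integral_add h1 h2)
    exact map_add _ _ _
  have e3 : duhamel (smulB ℝ) K F (t + h) x = (∫ r in Ioo 0 h, (K r ⋆[smulB ℝ] F (t + h - r)) x)
      + ∫ r in Ioo 0 t, (K (h + r) ⋆[smulB ℝ] F (t - r)) x := by
    have hi := hD.integrableOn hth x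
    rw [duhamel, ← Ioc_union_Ioo_eq_Ioo hh.le (by linarith : h < t + h),
      setIntegral_union (disjoint_left.2 fun r hr hr' => hr.2.not_gt hr'.1) measurableSet_Ioo
        (hi.mono_set fun r hr => ⟨hr.1, by linarith [hr.2]⟩)
        (hi.mono_set fun r hr => ⟨by linarith [hr.1], hr.2⟩), integral_Ioc_eq_integral_Ioo]
    congr 1
    rw [← integral_Ioc_eq_integral_Ioo, ← integral_Ioc_eq_integral_Ioo,
      ← intervalIntegral.integral_of_le (by linarith), ← intervalIntegral.integral_of_le ht.le]
    have := intervalIntegral.integral_comp_add_left (a := 0) (b := t)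
      (fun r => (K r ⋆[smulB ℝ] F (t + h - r)) x) h
    rw [add_zero, add_comm h t] at this
    rw [← this]
    refine intervalIntegral.integral_congr fun r _ => ?_
    rw [show t + h - (h + r) = t - r by ring]
  rw [hu (t + h) ⟨by linarith, hth⟩, e2, e3, hK.convolution_duhamel hF hM ht hh hth,
    ← hK.convolution_convolution hhT htT (by linarith) hu₀ hM₀, add_comm h t]
  ring

end Restart

section TimeDerivative

variable {d : ℕ} {μ : Measure (Rd d)} {σ T : ℝ} {κ : ℕ → ℝ → ℝ} {C : ℝ}

lemma KernelBounds.abs_convolution_sub_le (hK : KernelBounds (heatKernel μ) σ T κ)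
    (hC : LevyCondition μ C) {φ : Rd d → ℝ} {φ' : Rd d → Rd d →L[ℝ] ℝ} {a b : ℝ}
    (h : IsC11 φ φ' a b) {t : ℝ} (ht : t ∈ Ioo 0 T) (x : Rd d) :
    |(heatKernel μ t ⋆[smulB ℝ] φ) x - φ x| ≤ (2 * a + b) * |C| * t := by
  rw [hK.convolution_sub hC h ht x, ← Real.norm_eq_abs]
  have := norm_setIntegral_le_of_norm_le_const (μ := volume) (s := Ioo 0 t)
    (f := fun s => (heatKernel μ s ⋆[smulB ℝ] levyOp μ φ) x) (C := (2 * a + b) * |C|) (by simp)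
    fun s hs => (hK.isHeatFamily hC.integrable).norm_convolution_le ⟨hs.1, hs.2.trans ht.2⟩
      (h.abs_levyOp_le hC) x
  simpa [ht.1.le] using this

/-- The heat kernels concentrate at the origin as `t → 0`. -/
lemma KernelBounds.tendsto_convolution_zero (hK : KernelBounds (heatKernel μ) σ T κ)
    (hC : LevyCondition μ C) {ι : Type*} {l : Filter ι} {s : ι → ℝ} (hs : ∀ᶠ i in l, s i ∈ Ioo 0 T)
    (hs0 : Tendsto s l (𝓝 0)) {g : ι → Rd d → ℝ} {M : ℝ}
    (hg : ∀ᶠ i in l, Continuous (g i) ∧ ∀ y, ‖g i y‖ ≤ M) {x : Rd d} {c : ℝ}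
    (hlim : Tendsto (fun p : ι × Rd d => g p.1 (x - p.2)) (l ×ˢ 𝓝 0) (𝓝 c)) :
    Tendsto (fun i => (heatKernel μ (s i) ⋆[smulB ℝ] g i) x) l (𝓝 c) := by
  have hF := hK.isHeatFamily hC.integrable
  rw [Metric.tendsto_nhds]
  intro ε hε
  have h1 := (Metric.tendsto_nhds.1 hlim) (ε / 2) (half_pos hε)
  obtain ⟨p, hp, q, hq, hpq⟩ := eventually_prod_iff.1 h1
  obtain ⟨δ, hδ, hq⟩ := Metric.eventually_nhds_iff.1 hq
  obtain ⟨b, hb⟩ := exists_isC11_cutoff d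
  set r : ℝ := 2 / δ with hr
  have hr0 : 0 < r := by positivity
  have hχ := hb.comp_smul r
  set χ : Rd d → ℝ := fun y => cutoff d (r • y) with hχdef
  have hχ0 : χ 0 = 1 := by
    rw [hχdef]
    simp only [smul_zero]
    exact (cutoff d).one_of_mem_closedBall (by simp [cutoff])
  set D : ℝ := |M| + |c| with hD
  -- outside a small ball around `x` the mass of the kernel is controlled by `1 - χ`
  have h2 : Tendsto (fun i => D * ((2 * 1 + (|r| + r ^ 2) * b) * |C| * s i)) l (𝓝 0) := by
    simpa using (hs0.const_mul ((2 * 1 + (|r| + r ^ 2) * b) * |C|)).const_mul D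
  filter_upwards [hp, hs, hg, h2.eventually (gt_mem_nhds (half_pos hε))] with i hpi hsi hgi h2i
  have hKi := hF.int0 _ hsi
  have hi1 := integrable_convolution_integrand (smulB ℝ) hKi hgi.1 hgi.2 x
  have hi2 := integrable_convolution_integrand (smulB ℝ) hKi hχ.continuous hχ.bdd 0
  have e1 : (heatKernel μ (s i) ⋆[smulB ℝ] g i) x - c
      = ∫ y, heatKernel μ (s i) y * (g i (x - y) - c) := by
    have : ∫ y, heatKernel μ (s i) y * c = c := by
      rw [integral_mul_const, hF.mass _ hsi, one_mul]
    nth_rewrite 1 [← this]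
    rw [convolution_def]
    refine (integral_sub hi1 (hKi.mul_const c)).symm.trans
      (integral_congr_ae (ae_of_all _ fun y => ?_))
    simp [mul_sub]
  have e2 : ∫ y, heatKernel μ (s i) y * (1 - χ (0 - y))
      = 1 - (heatKernel μ (s i) ⋆[smulB ℝ] χ) 0 := by
    have : ∫ y, heatKernel μ (s i) y * (1 - χ (0 - y))
        = (∫ y, heatKernel μ (s i) y) - (heatKernel μ (s i) ⋆[smulB ℝ] χ) 0 := by
      refine Eq.trans (integral_congr_ae (ae_of_all _ fun y => ?_)) (integral_sub hKi hi2)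
      simp [mul_sub]
    rwa [hF.mass _ hsi] at this
  have hi3 : Integrable fun y => heatKernel μ (s i) y * (1 - χ (0 - y)) := by
    refine (hKi.sub hi2).congr (ae_of_all _ fun y => ?_)
    simp [mul_sub]
  have hpt : ∀ y, ‖heatKernel μ (s i) y * (g i (x - y) - c)‖
      ≤ heatKernel μ (s i) y * (ε / 2) + D * (heatKernel μ (s i) y * (1 - χ (0 - y))) := by
    intro y
    have hk0 := hF.nonneg _ hsi y
    have hχ1 : χ (0 - y) ≤ 1 := (cutoff d).le_one
    have hD0 : 0 ≤ D := by positivity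
    rw [norm_mul, Real.norm_of_nonneg hk0]
    have : ‖g i (x - y) - c‖ ≤ ε / 2 + D * (1 - χ (0 - y)) := by
      rcases lt_or_ge ‖y‖ δ with hy | hy
      · have := hpq hpi (hq (by simpa using hy))
        rw [dist_eq_norm] at this
        have := mul_nonneg hD0 (sub_nonneg.2 hχ1)
        linarith
      · have h3 : χ (0 - y) = 0 := by
          refine (cutoff d).zero_of_le_dist ?_
          rw [dist_zero_right, norm_smul, zero_sub, norm_neg, Real.norm_of_nonneg hr0.le, hr]
          change 2 ≤ 2 / δ * ‖y‖
          rw [div_mul_eq_mul_div, le_div_iff₀ hδ]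
          linarith
        rw [h3, sub_zero, mul_one]
        have h4 := norm_sub_le (g i (x - y)) c
        have h5 := (hgi.2 (x - y)).trans (le_abs_self M)
        rw [Real.norm_eq_abs c] at h4
        linarith
    calc heatKernel μ (s i) y * ‖g i (x - y) - c‖
        ≤ heatKernel μ (s i) y * (ε / 2 + D * (1 - χ (0 - y))) := by gcongr
      _ = _ := by ring
  rw [dist_eq_norm, e1]
  have hB : Integrable fun y => heatKernel μ (s i) y * (ε / 2)
      + D * (heatKernel μ (s i) y * (1 - χ (0 - y))) :=
    (hKi.mul_const _).add (hi3.const_mul D)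
  refine (norm_integral_le_of_norm_le hB (ae_of_all _ hpt)).trans_lt ?_
  rw [integral_add (hKi.mul_const _) (hi3.const_mul D), integral_mul_const, hF.mass _ hsi,
    integral_const_mul, e2]
  have h6 := abs_le.1 (hK.abs_convolution_sub_le hC hχ hsi 0)
  rw [hχ0] at h6
  have h7 : D * (1 - (heatKernel μ (s i) ⋆[smulB ℝ] χ) 0)
      ≤ D * ((2 * 1 + (|r| + r ^ 2) * b) * |C| * s i) := by
    have hD0 : 0 ≤ D := by positivity
    gcongr
    linarith [h6.1]
  linarith

variable {F : ℝ → Rd d → ℝ} {M : ℝ} {u₀ : Rd d → ℝ} {M₀ : ℝ} {u : ℝ → Rd d → ℝ}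
  {v : ℝ → Rd d → Rd d →L[ℝ] ℝ} {a b : ℝ}

/-- The right time derivative of a Duhamel formula with smooth values. -/
lemma KernelBounds.hasDerivWithinAt (hK : KernelBounds (heatKernel μ) σ T κ)
    (hC : LevyCondition μ C)
    (hF : ContinuousOn (fun q : ℝ × Rd d => F q.1 q.2) (Ioo 0 T ×ˢ univ))
    (hM : ∀ s ∈ Ioo 0 T, ∀ y, ‖F s y‖ ≤ M) (hu₀ : Continuous u₀) (hM₀ : ∀ y, ‖u₀ y‖ ≤ M₀)
    (hu : ∀ t ∈ Ioo 0 T, ∀ x, u t x = (heatKernel μ t ⋆[smulB ℝ] u₀) x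
      + duhamel (smulB ℝ) (heatKernel μ) F t x)
    (hv : ∀ t ∈ Ioo 0 T, IsC11 (u t) (v t) a b) {t : ℝ} (ht : t ∈ Ioo 0 T) (x : Rd d) :
    HasDerivWithinAt (fun s => u s x) (levyOp μ (u t) x + F t x) (Ici t) t := by
  have hF' := hK.isHeatFamily hC.integrable
  have hLc := (hv t ht).continuous_levyOp hC.integrable
  have hLb : ∀ y, ‖levyOp μ (u t) y‖ ≤ (2 * a + b) * |C| := (hv t ht).abs_levyOp_le hC
  set w := levyOp μ (u t) x + F t x with hw
  have hlim : Tendsto (fun p : ℝ × ℝ => (heatKernel μ p.2 ⋆[smulB ℝ]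
      fun y => levyOp μ (u t) y + F (t + p.1 - p.2) y) x) (𝓝 0 ×ˢ 𝓝[>] 0) (𝓝 w) := by
    have hle : (𝓝 (0 : ℝ) ×ˢ 𝓝[>] (0 : ℝ)) ≤ 𝓝 ((0 : ℝ), (0 : ℝ)) := by
      rw [nhds_prod_eq]
      exact Filter.prod_mono le_rfl nhdsWithin_le_nhds
    have hc : Continuous fun p : ℝ × ℝ => t + p.1 - p.2 := by fun_prop
    have hT : ∀ᶠ p : ℝ × ℝ in 𝓝 0 ×ˢ 𝓝[>] 0, t + p.1 - p.2 ∈ Ioo 0 T :=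
      hle ((hc.tendsto (0, 0)).eventually (Ioo_mem_nhds (by simpa using ht.1) (by simpa using ht.2)))
    refine hK.tendsto_convolution_zero hC (M := (2 * a + b) * |C| + M) ?_
      (tendsto_snd.mono_right nhdsWithin_le_nhds) ?_ ?_
    · exact tendsto_snd.eventually (Ioo_mem_nhdsGT (ht.1.trans ht.2))
    · filter_upwards [hT] with p hp
      refine ⟨hLc.add (continuous_slice hF hp), fun y => (norm_add_le _ _).trans ?_⟩
      exact add_le_add (hLb y) (hM _ hp y)
    · have h1 : ContinuousAt (fun q : ℝ × Rd d => F q.1 q.2) (t, x) :=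
        hF.continuousAt (prod_mem_nhds (Ioo_mem_nhds ht.1 ht.2) univ_mem)
      have h2 : Continuous fun q : (ℝ × ℝ) × Rd d => (t + q.1.1 - q.1.2, x - q.2) := by fun_prop
      have h3 : ContinuousAt (fun q : (ℝ × ℝ) × Rd d => levyOp μ (u t) (x - q.2)
          + F (t + q.1.1 - q.1.2) (x - q.2)) ((0, 0), 0) := by
        refine ContinuousAt.add ?_ ?_
        · exact (hLc.comp (by fun_prop : Continuous fun q : (ℝ × ℝ) × Rd d =>
            x - q.2)).continuousAt
        · refine ContinuousAt.comp (f := fun q : (ℝ × ℝ) × Rd d => (t + q.1.1 - q.1.2, x - q.2))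
            (g := fun q : ℝ × Rd d => F q.1 q.2) ?_ h2.continuousAt
          simpa using h1
      have h4 := h3.tendsto
      simp only [add_zero, sub_zero] at h4
      refine h4.mono_left ?_
      rw [nhds_prod_eq (x := ((0 : ℝ), (0 : ℝ)))]
      exact Filter.prod_mono hle le_rfl
  rw [hasDerivWithinAt_iff_isLittleO, Asymptotics.isLittleO_iff]
  intro ε hε
  obtain ⟨pa, ha, pb, hb, hab⟩ := eventually_prod_iff.1 (Metric.tendsto_nhds.1 hlim ε hε)
  obtain ⟨δ₁, hδ₁, ha⟩ := Metric.eventually_nhds_iff.1 ha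
  obtain ⟨δ₂, hδ₂, hb⟩ := Metric.eventually_nhds_iff.1 (eventually_nhdsWithin_iff.1 hb)
  have hδ : 0 < min δ₁ (min δ₂ (T - t)) := lt_min hδ₁ (lt_min hδ₂ (by linarith [ht.2]))
  rw [eventually_nhdsWithin_iff]
  filter_upwards [Metric.ball_mem_nhds t hδ] with s hs hts
  rcases eq_or_lt_of_le (mem_Ici.1 hts) with rfl | hlt
  · simp
  rw [Metric.mem_ball, Real.dist_eq, abs_of_pos (by linarith)] at hs
  obtain ⟨h, rfl⟩ : ∃ h, s = t + h := ⟨s - t, by ring⟩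
  have hh : 0 < h := by linarith
  rw [add_sub_cancel_left] at hs ⊢
  have hs1 := hs.trans_le (min_le_left _ _)
  have hs2 := hs.trans_le ((min_le_right _ _).trans (min_le_left _ _))
  have hs3 := hs.trans_le ((min_le_right _ _).trans (min_le_right _ _))
  have hhT : h ∈ Ioo 0 T := ⟨hh, by linarith [ht.1]⟩
  have hr : u (t + h) x = (heatKernel μ h ⋆[smulB ℝ] u t) x
      + ∫ r in Ioo 0 h, (heatKernel μ r ⋆[smulB ℝ] F (t + h - r)) x :=
    hF'.restart hF hM hu₀ hM₀ hu ht.1 hh (by linarith) x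
  have hLd := hF'.isDuhamel (G := fun _ => levyOp μ (u t))
    ((hLc.comp continuous_snd).continuousOn) (M := (2 * a + b) * |C|) (fun s _ => hLb)
  have hL1 : IntegrableOn (fun r => (heatKernel μ r ⋆[smulB ℝ] levyOp μ (u t)) x) (Ioo 0 h) :=
    hLd.integrableOn hhT.2 x
  have hF1 : IntegrableOn (fun r => (heatKernel μ r ⋆[smulB ℝ] F (t + h - r)) x) (Ioo 0 h) :=
    ((hF'.isDuhamel hF hM).integrableOn (t := t + h) (by linarith) x).mono_set
      fun r hr => ⟨hr.1, by linarith [hr.2, ht.1]⟩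
  have key : u (t + h) x - u t x - h • w = ∫ r in Ioo 0 h,
      ((heatKernel μ r ⋆[smulB ℝ] levyOp μ (u t)) x
        + (heatKernel μ r ⋆[smulB ℝ] F (t + h - r)) x - w) := by
    have e := hK.convolution_sub hC (hv t ht) hhT x
    have e' := integral_add hL1 hF1
    have hLF : IntegrableOn (fun r => (heatKernel μ r ⋆[smulB ℝ] levyOp μ (u t)) x
        + (heatKernel μ r ⋆[smulB ℝ] F (t + h - r)) x) (Ioo 0 h) := hL1.add hF1
    rw [integral_sub hLF (integrable_const w), e', ← e, hr]
    simp [hh.le]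
    ring
  rw [key]
  have hb' : ∀ r ∈ Ioo 0 h, ‖(heatKernel μ r ⋆[smulB ℝ] levyOp μ (u t)) x
        + (heatKernel μ r ⋆[smulB ℝ] F (t + h - r)) x - w‖ ≤ ε := by
    intro r hr
    have hrT : r ∈ Ioo 0 T := ⟨hr.1, hr.2.trans hhT.2⟩
    have h1 := hab (ha (by simpa [abs_of_pos hh] using hs1 : dist h 0 < δ₁))
      (hb (by simpa [abs_of_pos hr.1] using hr.2.trans hs2 : dist r 0 < δ₂) hr.1)
    rw [dist_eq_norm] at h1
    have hsT : t + h - r ∈ Ioo 0 T := ⟨by linarith [ht.1, hr.2], by linarith [hr.1]⟩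
    have e : (heatKernel μ r ⋆[smulB ℝ] fun y => levyOp μ (u t) y + F (t + h - r) y) x
        = (heatKernel μ r ⋆[smulB ℝ] levyOp μ (u t)) x
          + (heatKernel μ r ⋆[smulB ℝ] F (t + h - r)) x := by
      refine Eq.trans (integral_congr_ae (ae_of_all _ fun y => ?_)) (integral_add
        (integrable_convolution_integrand (smulB ℝ) (hF'.int0 r hrT) hLc hLb x)
        (integrable_convolution_integrand (smulB ℝ) (hF'.int0 r hrT) (continuous_slice hF hsT)
          (hM _ hsT) x))
      exact map_add _ _ _
    rw [← e]
    exact h1.le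
  have := norm_setIntegral_le_of_norm_le_const (μ := volume) (s := Ioo 0 h) (C := ε) (by simp) hb'
  simpa [hh.le, abs_of_pos hh] using this

/-- A continuous function with continuous right derivative is differentiable. -/
lemma hasDerivAt_of_right {f w : ℝ → ℝ} {T : ℝ} (hf : ContinuousOn f (Ioo 0 T))
    (hw : ContinuousOn w (Ioo 0 T)) (h : ∀ t ∈ Ioo 0 T, HasDerivWithinAt f (w t) (Ici t) t)
    {t : ℝ} (ht : t ∈ Ioo 0 T) : HasDerivAt f (w t) t := by
  set c := t / 2 with hc
  set e := (t + T) / 2 with he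
  have hce : c < t ∧ t < e ∧ 0 < c ∧ e < T := by
    refine ⟨?_, ?_, ?_, ?_⟩ <;> linarith [ht.1, ht.2]
  have hsub : Icc c e ⊆ Ioo 0 T := fun s hs =>
    ⟨hce.2.2.1.trans_le hs.1, hs.2.trans_lt hce.2.2.2⟩
  have hsub' : ∀ s ∈ Icc c e, uIcc c s ⊆ Ioo 0 T := fun s hs => by
    rw [uIcc_of_le hs.1]
    exact (Icc_subset_Icc_right hs.2).trans hsub
  have hI : ∀ s ∈ Icc c e, HasDerivAt (fun s => ∫ r in c..s, w r) (w s) s := fun s hs =>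
    intervalIntegral.integral_hasDerivAt_right ((hw.mono (hsub' s hs)).intervalIntegrable)
      (hw.stronglyMeasurableAtFilter isOpen_Ioo s (hsub hs))
      (hw.continuousAt (isOpen_Ioo.mem_nhds (hsub hs)))
  have hconst := constant_of_has_deriv_right_zero (f := fun s => f s - ∫ r in c..s, w r)
    (a := c) (b := e)
    ((hf.mono hsub).sub fun s hs => (hI s hs).continuousAt.continuousWithinAt)
    fun s hs => by
      have hs' : s ∈ Icc c e := ⟨hs.1, hs.2.le⟩
      have := (h s (hsub hs')).sub (hI s hs').hasDerivWithinAt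
      rw [sub_self] at this
      exact this
  have hev : f =ᶠ[𝓝 t] fun s => (f c) + ∫ r in c..s, w r := by
    filter_upwards [Icc_mem_nhds hce.1 hce.2.1] with s hs
    have := hconst s hs
    simp only [intervalIntegral.integral_same, sub_zero] at this
    linarith
  exact ((hI t ⟨hce.1.le, hce.2.1.le⟩).const_add (f c)).congr_of_eventuallyEq hev

end TimeDerivative

/-! ### The maximum principle -/

section MaxPrinciple

variable {d : ℕ} {μ : Measure (Rd d)}

lemma integrable_levyIntegrand (hμ : Integrable levyWeight μ) {φ : Rd d → ℝ}
    (hφ : ContDiff ℝ 2 φ) {a : ℝ} (ha : ∀ x, |φ x| ≤ a) (x : Rd d) :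
    Integrable (levyIntegrand φ (fderiv ℝ φ x) x) μ := by
  have h1 : ContDiff ℝ 1 (fderiv ℝ φ) := hφ.fderiv_right (by norm_num)
  obtain ⟨b, hb⟩ := (isCompact_closedBall x 1).exists_bound_of_continuousOn
    (h1.continuous_fderiv one_ne_zero).continuousOn
  have hb0 : 0 ≤ b := (norm_nonneg _).trans (hb x (Metric.mem_closedBall_self zero_le_one))
  refine (hμ.const_mul (2 * a + b)).mono'
    (measurable_levyIntegrand hφ.continuous _ _).aestronglyMeasurable (ae_of_all _ ?_)
  refine abs_levyIntegrand_le (φ' := fderiv ℝ φ)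
    (fun y => (hφ.differentiable (by norm_num) y).hasFDerivAt) ha hb0 fun y hy => ?_
  refine (convex_closedBall x 1).norm_image_sub_le_of_norm_hasFDerivWithin_le
    (fun z _ => (h1.differentiable one_ne_zero z).hasFDerivAt.hasFDerivWithinAt) hb
    (Metric.mem_closedBall_self zero_le_one) ?_
  rw [mem_closedBall_iff_norm]
  exact hy.le

/-- The Lévy operator annihilates wide cutoff functions in the limit, uniformly in space. -/
lemma eventually_levyOp_cutoff (hμ : Integrable levyWeight μ) {ε : ℝ} (hε : 0 < ε) :
    ∀ᶠ r in 𝓝[>] (0 : ℝ), ∀ x, |levyOp μ (fun y => cutoff d (r • y)) x| ≤ ε := by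
  obtain ⟨c, hc⟩ := exists_isC11_cutoff d
  have hc0 := hc.b_nonneg
  let g : ℝ → Rd d → ℝ := fun r z => (2 + c) * (levyWeight z * min 1 (r * (1 + ‖z‖)))
  have hlim : Tendsto (fun r => ∫ z, g r z ∂μ) (𝓝[>] 0) (𝓝 0) := by
    have : Tendsto (fun r => ∫ z, g r z ∂μ) (𝓝[>] 0) (𝓝 (∫ _, (0 : ℝ) ∂μ)) := by
      refine tendsto_integral_filter_of_dominated_convergence (fun z => (2 + c) * levyWeight z) ?_ ?_
        (hμ.const_mul _) (ae_of_all _ fun z => ?_)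
      · refine Eventually.of_forall fun r => Continuous.aestronglyMeasurable ?_
        have := continuous_levyWeight (d := d)
        fun_prop
      · filter_upwards [self_mem_nhdsWithin] with r (hr : 0 < r)
        refine ae_of_all _ fun z => ?_
        have h1 := levyWeight_nonneg z
        have h2 : 0 ≤ min 1 (r * (1 + ‖z‖)) := le_min zero_le_one (by positivity)
        simp only [g]
        rw [Real.norm_of_nonneg (by positivity)]
        gcongr
        exact mul_le_of_le_one_right h1 (min_le_left _ _)
      · have h1 : Continuous fun r : ℝ => (2 + c) * (levyWeight z * min 1 (r * (1 + ‖z‖))) := by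
          fun_prop
        have := h1.tendsto 0
        simp only [zero_mul, min_eq_right zero_le_one, mul_zero] at this
        exact this.mono_left nhdsWithin_le_nhds
    simpa using this
  filter_upwards [hlim.eventually (gt_mem_nhds hε), Ioo_mem_nhdsGT one_pos] with r hr hr1 x
  have hχ := hc.comp_smul r
  have hr0 := hr1.1
  refine le_trans ?_ hr.le
  rw [levyOp_eq (hχ.hasFDerivAt x), ← Real.norm_eq_abs]
  have hgi : Integrable (g r) μ := by
    refine (hμ.const_mul (2 + c)).mono' (Continuous.aestronglyMeasurable ?_)
      (ae_of_all _ fun z => ?_)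
    · have := continuous_levyWeight (d := d)
      fun_prop
    · have h1 := levyWeight_nonneg z
      have h2 : 0 ≤ min 1 (r * (1 + ‖z‖)) := le_min zero_le_one (by positivity)
      rw [Real.norm_of_nonneg (by positivity)]
      simp only [g]
      gcongr
      exact mul_le_of_le_one_right h1 (min_le_left _ _)
  refine norm_integral_le_of_norm_le hgi (ae_of_all _ fun z => ?_)
  rw [Real.norm_eq_abs]
  rcases lt_or_ge ‖z‖ 1 with hz | hz
  · -- inside the unit ball the integrand is that of the unscaled cutoff at `r • x`, `r • z`
    have hrz : ‖r • z‖ < 1 := by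
      rw [norm_smul, Real.norm_of_nonneg hr0.le]
      nlinarith [hr1.2, norm_nonneg z]
    have e : levyIntegrand (fun y => cutoff d (r • y)) (r • fderiv ℝ (cutoff d) (r • x)) x z
        = levyIntegrand (cutoff d) (fderiv ℝ (cutoff d) (r • x)) (r • x) (r • z) := by
      rw [levyIntegrand, levyIntegrand, indicator_of_mem (by simpa using hz),
        indicator_of_mem (by simpa using hrz), smul_add]
      simp
    rw [e]
    refine (hc.abs_levyIntegrand_le (r • x) (r • z)).trans ?_
    rw [levyWeight_of_lt hrz, norm_smul, Real.norm_of_nonneg hr0.le, mul_one]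
    simp only [g]
    rw [levyWeight_of_lt hz]
    gcongr
    have h3 : r ≤ min 1 (r * (1 + ‖z‖)) := le_min hr1.2.le (by nlinarith [norm_nonneg z])
    have h4 : r ^ 2 ≤ min 1 (r * (1 + ‖z‖)) := by nlinarith [hr1.2]
    rw [mul_pow, mul_comm]
    gcongr
  · simp only [g]
    rw [levyIntegrand, indicator_of_notMem (by simpa using hz), levyWeight_of_le hz, sub_zero,
      one_mul]
    have h1 := abs_sub (cutoff d (r • (x + z))) (cutoff d (r • x))
    have h2 := hc.bdd (r • (x + z))
    have h3 := hc.bdd (r • x)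
    have h4 := hc.abs_sub_le (r • (x + z)) (r • x)
    rw [smul_add, add_sub_cancel_left, norm_smul, Real.norm_of_nonneg hr0.le, ← smul_add] at h4
    have h5 : 0 ≤ r * ‖z‖ := by positivity
    rcases min_cases 1 (r * (1 + ‖z‖)) with h | h
    · rw [h.1]; linarith
    · rw [h.1]; nlinarith

lemma nonneg_of_le_left {g : ℝ → ℝ} {g' t c : ℝ} (hg : HasDerivAt g g' t) (hc : c < t)
    (h : ∀ s ∈ Ioo c t, g s ≤ g t) : 0 ≤ g' := by
  have h1 := (hasDerivWithinAt_iff_tendsto_slope' (self_notMem_Iio (a := t))).1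
    (hg.hasDerivWithinAt (s := Iio t))
  refine ge_of_tendsto h1 ?_
  filter_upwards [Ioo_mem_nhdsLT hc] with s hs
  rw [slope_def_field]
  exact div_nonneg_of_nonpos (by linarith [h s hs]) (by linarith [hs.2])

/-- Maximum principle: a bounded function that is nonpositive initially stays nonpositive if it is
a subsolution of `∂ₜw - Lw ≤ Λ w + C |Dw|` at the points where it is positive and has a small
gradient. -/
theorem max_principle (hμ : Integrable levyWeight μ) {T : ℝ} {w wt : ℝ → Rd d → ℝ} {M Λ C : ℝ}
    (hw : ContinuousOn (fun q : ℝ × Rd d => w q.1 q.2) (Ico 0 T ×ˢ univ))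
    (hM : ∀ t ∈ Ico 0 T, ∀ x, |w t x| ≤ M) (hC2 : ∀ t ∈ Ioo 0 T, ContDiff ℝ 2 (w t))
    (ht : ∀ t ∈ Ioo 0 T, ∀ x, HasDerivAt (fun s => w s x) (wt t x) t)
    (h0 : ∀ x, w 0 x ≤ 0) (hΛ : 0 ≤ Λ) (hC : 0 ≤ C)
    (heq : ∀ t ∈ Ioo 0 T, ∀ x, 0 < w t x → ‖fderiv ℝ (w t) x‖ ≤ 1 →
      wt t x - levyOp μ (w t) x ≤ Λ * w t x + C * ‖fderiv ℝ (w t) x‖)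
    {t : ℝ} (htT : t ∈ Ico 0 T) (x : Rd d) : w t x ≤ 0 := by
  by_contra! hpos
  have ht0 : 0 < t := by
    rcases htT.1.eq_or_lt with h | h
    · rw [← h] at hpos
      exact absurd (h0 x) (not_le.2 hpos)
    · exact h
  obtain ⟨c, hc⟩ := exists_isC11_cutoff d
  have hc0 := hc.b_nonneg
  have hMpos : 0 < M := hpos.trans_le ((le_abs_self _).trans (hM t htT x))
  set P := Real.exp (-Λ * t) * w t x with hP
  have hP0 : 0 < P := mul_pos (Real.exp_pos _) hpos
  -- the drift `ε t` uses up half of the assumed positive value `P`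
  set ε := P / (2 * t) with hε
  have hε0 : 0 < ε := by positivity
  set A := M + 1 with hA
  have hA0 : 0 < A := by positivity
  have hlin : ∀ B : ℝ, ∀ δ > 0, ∀ᶠ r in 𝓝[>] (0 : ℝ), B * r < δ := by
    intro B δ hδ
    have : Tendsto (fun r : ℝ => B * r) (𝓝[>] 0) (𝓝 0) := by
      have h : Continuous fun r : ℝ => B * r := by fun_prop
      simpa using (h.tendsto 0).mono_left nhdsWithin_le_nhds
    exact this.eventually (gt_mem_nhds hδ)
  -- the cutoff is so wide that `x` is not penalized and that its derivatives and its image under `L`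
  -- do not compensate the drift
  obtain ⟨r, hr0, hr1, hr2, hr3, hr4⟩ := ((eventually_mem_nhdsWithin).and
    ((hlin ‖x‖ 1 one_pos).and ((hlin (Real.exp (Λ * t) * A * c) 1 one_pos).and
    ((hlin (C * A * c) (ε / 4) (by positivity)).and
    (eventually_levyOp_cutoff hμ (show 0 < ε / 4 / A by positivity)))))).exists
  have hr0 : 0 < r := hr0
  have hχ := hc.comp_smul r
  set χ : Rd d → ℝ := fun y => cutoff d (r • y) with hχdef
  have hχ1 : ∀ y, χ y ≤ 1 := fun y => (cutoff d).le_one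
  have hχout : ∀ y, 2 / r < ‖y‖ → χ y = 0 := by
    intro y hy
    refine (cutoff d).zero_of_le_dist ?_
    rw [dist_zero_right, norm_smul, Real.norm_of_nonneg hr0.le]
    change 2 ≤ r * ‖y‖
    rw [div_lt_iff₀ hr0] at hy
    linarith
  have hχx : χ x = 1 := by
    refine (cutoff d).one_of_mem_closedBall ?_
    rw [mem_closedBall_zero_iff, norm_smul, Real.norm_of_nonneg hr0.le]
    change r * ‖x‖ ≤ 1
    linarith
  -- outside the ball of radius `2 / r` the penalty is `A = M + 1`, more than the bound for `w`, so that
  -- a positive maximum is attained inside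
  set Φ : ℝ × Rd d → ℝ := fun q => Real.exp (-Λ * q.1) * w q.1 q.2 - ε * q.1 - A * (1 - χ q.2)
    with hΦ
  have hsub : Icc 0 t ×ˢ (univ : Set (Rd d)) ⊆ Ico 0 T ×ˢ univ :=
    prod_mono (fun s hs => ⟨hs.1, hs.2.trans_lt htT.2⟩) Subset.rfl
  have hΦc : ContinuousOn Φ (Icc 0 t ×ˢ univ) := by
    have h1 := hw.mono hsub
    have h2 := hχ.continuous
    fun_prop
  have hΦpos : 0 < Φ (t, x) := by
    have : ε * t = P / 2 := by rw [hε]; field_simp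
    simp only [hΦ, hχx, ← hP]
    rw [this]
    linarith
  obtain ⟨⟨s, y⟩, ⟨hs, hy⟩, hmax⟩ := (isCompact_Icc.prod (isCompact_closedBall (0 : Rd d)
    (2 / r))).exists_isMaxOn (f := Φ) ⟨(t, x), ⟨ht0.le, le_rfl⟩, by
      rw [mem_closedBall_zero_iff, le_div_iff₀ hr0]
      linarith⟩ (hΦc.mono (prod_mono Subset.rfl (subset_univ _)))
  have hs : s ∈ Icc 0 t := hs
  have hmaxpos : 0 < Φ (s, y) := hΦpos.trans_le (hmax ⟨⟨ht0.le, le_rfl⟩, by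
      rw [mem_closedBall_zero_iff, le_div_iff₀ hr0]
      linarith⟩)
  have hexp : ∀ s ∈ Icc 0 t, Real.exp (-Λ * s) ≤ 1 := fun s hs => by
    rw [Real.exp_le_one_iff]
    nlinarith [hs.1]
  have hglob : ∀ s' ∈ Icc 0 t, ∀ y', Φ (s', y') ≤ Φ (s, y) := by
    intro s' hs' y'
    by_cases hy' : ‖y'‖ ≤ 2 / r
    · exact hmax ⟨hs', by rwa [mem_closedBall_zero_iff]⟩
    · refine le_trans ?_ hmaxpos.le
      simp only [hΦ, hχout y' (not_le.1 hy')]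
      have h1 : Real.exp (-Λ * s') * w s' y' ≤ M :=
        ((mul_le_mul_of_nonneg_left ((le_abs_self _).trans (hM s' ⟨hs'.1, hs'.2.trans_lt htT.2⟩ y'))
          (Real.exp_pos _).le)).trans (mul_le_of_le_one_left hMpos.le (hexp s' hs'))
      have h2 : 0 ≤ ε * s' := mul_nonneg hε0.le hs'.1
      linarith
  have hAy : 0 ≤ A * (1 - χ y) := mul_nonneg hA0.le (by linarith [hχ1 y])
  have hs0 : 0 < s := by
    rcases hs.1.eq_or_lt with h | h
    · simp only [hΦ] at hmaxpos
      rw [← h] at hmaxpos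
      simp only [mul_zero, Real.exp_zero, one_mul, sub_zero] at hmaxpos
      linarith [h0 y]
    · exact h
  have hsT : s ∈ Ioo 0 T := ⟨hs0, hs.2.trans_lt htT.2⟩
  set e := Real.exp (-Λ * s) with he
  have he0 : 0 < e := Real.exp_pos _
  have hwpos : 0 < w s y := by
    have h2 : 0 ≤ ε * s := mul_nonneg hε0.le hs0.le
    have : 0 < e * w s y := by
      simp only [hΦ] at hmaxpos
      linarith
    exact pos_of_mul_pos_right this he0.le
  have hwd : HasFDerivAt (w s) (fderiv ℝ (w s) y) y :=
    ((hC2 s hsT).differentiable (by norm_num) y).hasFDerivAt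
  -- at the maximum the gradient is that of the penalty, hence small for small `r`
  have hgrad : e • fderiv ℝ (w s) y = -(A • (r • fderiv ℝ (cutoff d) (r • y))) := by
    have h1 : HasFDerivAt (fun z => Φ (s, z)) (e • fderiv ℝ (w s) y
        - A • -(r • fderiv ℝ (cutoff d) (r • y))) y :=
      ((hwd.const_mul e).sub_const (ε * s)).sub (((hχ.hasFDerivAt y).const_sub 1).const_mul A)
    have h2 : IsLocalMax (fun z => Φ (s, z)) y := Eventually.of_forall fun z => hglob s hs z
    have h3 := h2.hasFDerivAt_eq_zero h1
    rw [smul_neg, sub_neg_eq_add] at h3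
    exact eq_neg_of_add_eq_zero_left h3
  have hgn : e * ‖fderiv ℝ (w s) y‖ ≤ A * (r * c) := by
    have h1 := congrArg norm hgrad
    rw [norm_smul, norm_neg, norm_smul, norm_smul, Real.norm_of_nonneg he0.le,
      Real.norm_of_nonneg hA0.le, Real.norm_of_nonneg hr0.le] at h1
    rw [h1]
    gcongr
    exact hc.bdd' _
  have hgn1 : ‖fderiv ℝ (w s) y‖ ≤ 1 := by
    have h1 : ‖fderiv ℝ (w s) y‖ = Real.exp (Λ * s) * (e * ‖fderiv ℝ (w s) y‖) := by
      rw [← mul_assoc, he, ← Real.exp_add]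
      simp
    rw [h1]
    have h2 : Real.exp (Λ * s) ≤ Real.exp (Λ * t) := by
      rw [Real.exp_le_exp]
      gcongr
      exact hs.2
    calc Real.exp (Λ * s) * (e * ‖fderiv ℝ (w s) y‖) ≤ Real.exp (Λ * t) * (A * (r * c)) := by
          gcongr
      _ ≤ 1 := by linarith
  -- the maximum may be at the final time, which still gives the sign of the time derivative
  have htime : ε ≤ e * wt s y - Λ * e * w s y := by
    have h1 : HasDerivAt (fun s => Φ (s, y)) ((Real.exp (-Λ * s) * (-Λ)) * w s y
        + Real.exp (-Λ * s) * wt s y - ε) s := by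
      have h2 : HasDerivAt (fun s => Real.exp (-Λ * s)) (Real.exp (-Λ * s) * (-Λ)) s := by
        simpa using ((hasDerivAt_id s).const_mul (-Λ)).exp
      have h3 : HasDerivAt (fun s => ε * s) ε s := by
        simpa using (hasDerivAt_id s).const_mul ε
      exact ((h2.mul (ht s hsT y)).sub h3).sub_const (A * (1 - χ y))
    have h4 := nonneg_of_le_left h1 hs0 fun s' hs' => hglob s' ⟨hs'.1.le, hs'.2.le.trans hs.2⟩ y
    rw [← he] at h4
    linarith
  -- at the maximum the increments of `w` are dominated by those of the penalty
  have hlevy : e * levyOp μ (w s) y ≤ ε / 4 := by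
    have hi1 := integrable_levyIntegrand hμ (hC2 s hsT)
      (hM s ⟨hs0.le, hsT.2⟩) y
    have hi2 := hχ.integrable hμ y
    have h1 : e * levyOp μ (w s) y ≤ -A * levyOp μ χ y := by
      rw [levyOp_eq hwd, levyOp_eq (hχ.hasFDerivAt y), ← integral_const_mul, ← integral_const_mul]
      refine integral_mono (hi1.const_mul e) (hi2.const_mul (-A)) fun z => ?_
      have h2 := hglob s hs (y + z)
      simp only [hΦ] at h2
      rw [← he] at h2
      have h3 : e * (Metric.ball (0 : Rd d) 1).indicator (fderiv ℝ (w s) y) z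
          = -A * (Metric.ball (0 : Rd d) 1).indicator (r • fderiv ℝ (cutoff d) (r • y)) z := by
        by_cases hz : z ∈ Metric.ball (0 : Rd d) 1
        · rw [indicator_of_mem hz, indicator_of_mem hz]
          have := congrArg (fun l : Rd d →L[ℝ] ℝ => l z) hgrad
          simpa using this
        · rw [indicator_of_notMem hz, indicator_of_notMem hz]
          simp
      simp only [levyIntegrand, mul_sub]
      rw [h3]
      linarith
    have h2 := abs_le.1 (hr4 y)
    have h3 : A * (ε / 4 / A) = ε / 4 := by field_simp
    nlinarith [h2.1]
  have h1 := heq s hsT y hwpos hgn1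
  have h2 := mul_le_mul_of_nonneg_left h1 he0.le
  have h3 := mul_le_mul_of_nonneg_left hgn hC
  nlinarith

end MaxPrinciple

/-! ### Interpolation -/

section Interpolation

variable {V E : Type*} [NormedAddCommGroup V] [NormedSpace ℝ V] [NormedAddCommGroup E]
  [NormedSpace ℝ E]

/-- The gradient at `x` is read off, up to the oscillation of `g'`, from the increments of `g` of
length `h`. -/
lemma norm_fderiv_le_interpolation {g : V → E} {g' : V → V →L[ℝ] E}
    (hg : ∀ x, HasFDerivAt g (g' x) x) {a M : ℝ} (ha : ∀ x, ‖g x‖ ≤ a)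
    (hM : ∀ x y, ‖g' x - g' y‖ ≤ M * ‖x - y‖) (hM0 : 0 ≤ M) {h : ℝ} (hh : 0 < h) (x : V) :
    ‖g' x‖ ≤ 2 * a / h + M * h := by
  have ha0 : 0 ≤ a := (norm_nonneg _).trans (ha 0)
  refine ContinuousLinearMap.opNorm_le_of_unit_norm (by positivity) fun e he => ?_
  have h1 := (convex_closedBall x h).norm_image_sub_le_of_norm_hasFDerivWithin_le' (f := g)
    (f' := g') (φ := g' x) (C := M * h) (x := x) (y := x + h • e)
    (fun y _ => (hg y).hasFDerivWithinAt) (fun y hy => by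
      rw [mem_closedBall_iff_norm] at hy
      exact (hM y x).trans (by gcongr)) (by simp [hh.le])
      (by simp [norm_smul, he, abs_of_pos hh])
  rw [add_sub_cancel_left, norm_smul, he, mul_one, Real.norm_of_nonneg hh.le] at h1
  have h2 : ‖h • g' x e‖ ≤ 2 * a + M * h * h := by
    have e1 : h • g' x e = g (x + h • e) - g x - (g (x + h • e) - g x - g' x (h • e)) := by
      rw [map_smul]
      abel
    rw [e1]
    refine (norm_sub_le _ _).trans (add_le_add ((norm_sub_le _ _).trans ?_) h1)
    linarith [ha (x + h • e), ha x]
  rw [norm_smul, Real.norm_of_nonneg hh.le] at h2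
  rw [div_add' _ _ _ hh.ne', le_div_iff₀ hh]
  linarith

/-- The sup norm of the gradient is controlled by the square root of the sup norm of the
function. -/
lemma norm_fderiv_le_sqrt {g : V → E} {g' : V → V →L[ℝ] E}
    (hg : ∀ x, HasFDerivAt g (g' x) x) {a M : ℝ} (ha : ∀ x, ‖g x‖ ≤ a)
    (hM : ∀ x y, ‖g' x - g' y‖ ≤ M * ‖x - y‖) (hM0 : 0 ≤ M) (x : V) :
    ‖g' x‖ ≤ (2 + M) * √a := by
  have ha0 : 0 ≤ a := (norm_nonneg _).trans (ha 0)
  rcases ha0.eq_or_lt with h | h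
  · have h0 : g = fun _ => 0 := funext fun y => norm_le_zero_iff.1 ((ha y).trans h.ge)
    rw [h0] at hg
    rw [(hg x).unique (hasFDerivAt_const 0 x), norm_zero]
    positivity
  · have hs := Real.sqrt_pos.2 h
    -- the step `h = √a` balances the two terms
    refine (norm_fderiv_le_interpolation hg ha hM hM0 hs x).trans (le_of_eq ?_)
    have : a / √a = √a := Real.div_sqrt
    rw [mul_div_assoc, this]
    ring

end Interpolation

/-! ### Truncation of the Hamiltonian -/

section Truncation

/-- A map with bounded and Lipschitz derivative. -/
structure IsTame {V E : Type*} [NormedAddCommGroup V] [NormedSpace ℝ V] [NormedAddCommGroup E]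
    [NormedSpace ℝ E] (g : V → E) (g' : V → V →L[ℝ] E) (c : ℝ) : Prop where
  hasFDerivAt : ∀ x, HasFDerivAt g (g' x) x
  bdd' : ∀ x, ‖g' x‖ ≤ c
  lip' : ∀ x y, ‖g' x - g' y‖ ≤ c * ‖x - y‖

/-- Truncation of the real line: monotone, `1`-Lipschitz, bounded, and the identity on
`[-R, R]`. -/
lemma exists_truncation_real {R : ℝ} (hR : 0 < R) :
    ∃ (χ : ℝ → ℝ) (χ' : ℝ → ℝ →L[ℝ] ℝ) (c : ℝ), IsTame χ χ' c ∧ (∀ u, |u| ≤ R → χ u = u) ∧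
      (∀ u v, u ≤ v → χ u ≤ χ v ∧ χ v - χ u ≤ v - u) ∧ ∀ u, |χ u| ≤ R + 1 := by
  let b : ContDiffBump (0 : ℝ) := ⟨R, R + 1, hR, by linarith⟩
  have hbc : Continuous b := b.continuous
  have hii : ∀ u v : ℝ, IntervalIntegrable b volume u v := fun u v => hbc.intervalIntegrable u v
  obtain ⟨c, hc⟩ := (b.contDiff (n := 1)).lipschitzWith_of_hasCompactSupport b.hasCompactSupport
    one_ne_zero
  have hdiff : ∀ u v, (∫ s in (0)..v, b s) - ∫ s in (0)..u, b s = ∫ s in u..v, b s := fun u v =>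
    intervalIntegral.integral_interval_sub_left (hii _ _) (hii _ _)
  have hmono : ∀ u v, u ≤ v → (∫ s in (0)..u, b s) ≤ (∫ s in (0)..v, b s) ∧
      (∫ s in (0)..v, b s) - (∫ s in (0)..u, b s) ≤ v - u := by
    intro u v huv
    rw [← sub_nonneg, hdiff]
    refine ⟨intervalIntegral.integral_nonneg huv fun s _ => b.nonneg, ?_⟩
    have := intervalIntegral.integral_mono_on huv (hii u v)
      (intervalIntegrable_const (c := (1 : ℝ))) fun s _ => b.le_one
    simpa using this
  have hid : ∀ u, |u| ≤ R → ∫ s in (0)..u, b s = u := by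
    intro u hu
    have : ∫ s in (0)..u, b s = ∫ s in (0)..u, (1 : ℝ) := by
      refine intervalIntegral.integral_congr fun s hs => ?_
      refine b.one_of_mem_closedBall ?_
      rw [mem_closedBall_zero_iff, Real.norm_eq_abs]
      have h1 := abs_sub_left_of_mem_uIcc hs
      simp only [sub_zero] at h1
      exact h1.trans hu
    simpa using this
  have hzero : ∀ u v, (∀ s ∈ uIcc u v, R + 1 ≤ |s|) → ∫ s in u..v, b s = 0 := by
    intro u v h
    have : ∫ s in u..v, b s = ∫ s in u..v, (0 : ℝ) := by
      refine intervalIntegral.integral_congr fun s hs => b.zero_of_le_dist ?_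
      rw [dist_zero_right]
      exact h s hs
    simpa using this
  refine ⟨fun u => ∫ s in (0)..u, b s, fun u => ContinuousLinearMap.toSpanSingleton ℝ (b u),
    max 1 c, ⟨fun u => ?_, fun u => ?_, fun u v => ?_⟩, hid, hmono, ?_⟩
  · exact (intervalIntegral.integral_hasDerivAt_right (hii 0 u)
      (hbc.stronglyMeasurableAtFilter _ _) hbc.continuousAt).hasFDerivAt
  · rw [ContinuousLinearMap.norm_toSpanSingleton, Real.norm_of_nonneg b.nonneg]
    exact b.le_one.trans (le_max_left _ _)
  · have e : ContinuousLinearMap.toSpanSingleton ℝ (b u) - ContinuousLinearMap.toSpanSingleton ℝ (b v)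
        = ContinuousLinearMap.toSpanSingleton ℝ (b u - b v) := by
      ext
      simp
    rw [e, ContinuousLinearMap.norm_toSpanSingleton]
    have := hc.dist_le_mul u v
    rw [dist_eq_norm, dist_eq_norm] at this
    exact this.trans (by gcongr; exact le_max_right _ _)
  · -- the primitive is constant outside `[-(R + 1), R + 1]`
    have hb1 : ∀ u, |u| ≤ R + 1 → |∫ s in (0)..u, b s| ≤ R + 1 := by
      intro u hu
      rcases le_total 0 u with h | h
      · have := hmono 0 u h
        rw [intervalIntegral.integral_same] at this
        rw [abs_of_nonneg this.1]
        linarith [le_abs_self u]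
      · have := hmono u 0 h
        rw [intervalIntegral.integral_same] at this
        rw [abs_of_nonpos this.1]
        linarith [neg_abs_le u]
    intro u
    rcases le_or_gt |u| (R + 1) with h | h
    · exact hb1 u h
    · rcases le_total 0 u with h0 | h0
      · rw [abs_of_nonneg h0] at h
        have h1 := hdiff (R + 1) u
        rw [hzero (R + 1) u fun s hs => by
          rw [uIcc_of_le h.le] at hs
          exact hs.1.trans (le_abs_self s)] at h1
        change |∫ s in (0)..u, b s| ≤ R + 1
        rw [sub_eq_zero.1 h1]
        exact hb1 _ (by rw [abs_of_pos (by linarith)])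
      · rw [abs_of_nonpos h0] at h
        have h1 := hdiff u (-(R + 1))
        rw [hzero u (-(R + 1)) fun s hs => by
          rw [uIcc_of_le (by linarith)] at hs
          linarith [hs.2, neg_abs_le s]] at h1
        change |∫ s in (0)..u, b s| ≤ R + 1
        rw [← sub_eq_zero.1 h1]
        exact hb1 _ (by rw [abs_neg, abs_of_pos (by linarith)])

/-- Radial truncation of a Euclidean space. -/
lemma exists_truncation_vector (d : ℕ) {R : ℝ} (hR : 0 < R) :
    ∃ (χ : Rd d → Rd d) (χ' : Rd d → Rd d →L[ℝ] Rd d) (c : ℝ), IsTame χ χ' c ∧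
      (∀ p, ‖p‖ ≤ R → χ p = p) ∧ (∀ p, ‖χ p‖ ≤ ‖p‖) ∧ ∀ p, ‖χ p‖ ≤ R + 1 := by
  let b : ContDiffBump (0 : Rd d) := ⟨R, R + 1, hR, by linarith⟩
  have hsm : ContDiff ℝ 2 fun p => b p • p := b.contDiff.smul contDiff_id
  have hcs : HasCompactSupport fun p => b p • p := b.hasCompactSupport.smul_right
  have h1 : ContDiff ℝ 1 (fderiv ℝ fun p => b p • p) := hsm.fderiv_right (by norm_num)
  obtain ⟨c₁, hc₁⟩ := (hcs.fderiv ℝ).exists_bound_of_continuous h1.continuous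
  obtain ⟨c₂, hc₂⟩ := h1.lipschitzWith_of_hasCompactSupport (hcs.fderiv ℝ) one_ne_zero
  have hle : ∀ p, ‖b p • p‖ ≤ ‖p‖ := fun p => by
    rw [norm_smul, Real.norm_of_nonneg b.nonneg]
    exact mul_le_of_le_one_left (norm_nonneg _) b.le_one
  refine ⟨fun p => b p • p, fderiv ℝ fun p => b p • p, max c₁ c₂,
    ⟨fun p => (hsm.differentiable (by norm_num) p).hasFDerivAt,
      fun p => (hc₁ p).trans (le_max_left _ _), fun p q => ?_⟩, fun p hp => ?_, hle, fun p => ?_⟩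
  · have := hc₂.dist_le_mul p q
    rw [dist_eq_norm, dist_eq_norm] at this
    exact this.trans (by gcongr; exact le_max_right _ _)
  · change b p • p = p
    rw [b.one_of_mem_closedBall (by rwa [mem_closedBall_zero_iff]), one_smul]
  · rcases le_or_gt ‖p‖ (R + 1) with h | h
    · exact (hle p).trans h
    · change ‖b p • p‖ ≤ R + 1
      rw [b.zero_of_le_dist (by rw [dist_zero_right]; exact h.le), zero_smul, norm_zero]
      linarith

variable {d : ℕ}

/-- The nonlinearity `f - H` of the truncated equation. The gradient enters as a covector. -/
def truncatedSource (f : ℝ → Rd d → ℝ) (H : Rd d → ℝ → Rd d → ℝ) (χ₁ : ℝ → ℝ) (χ₂ : Rd d → Rd d)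
    (s : ℝ) (q : Rd d × ℝ × (Rd d →L[ℝ] ℝ)) : ℝ :=
  f s q.1 - H q.1 (χ₁ q.2.1) (χ₂ ((InnerProductSpace.toDual ℝ (Rd d)).symm q.2.2))

lemma HamiltonianBounds.abs_apply_le {H : Rd d → ℝ → Rd d → ℝ} {CH : ℝ → ℝ} (hH : HamiltonianBounds H CH)
    {R : ℝ} {u : ℝ} {p : Rd d} (hu : |u| ≤ R) (hp : ‖p‖ < R) (x : Rd d) : |H x u p| ≤ CH R := by
  have := hH.2 R ((norm_nonneg _).trans_lt hp) x u (abs_le.1 hu) p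
    (by simpa using hp) 0 (by norm_num)
  simpa using this

lemma HamiltonianBounds.norm_fderiv_le {H : Rd d → ℝ → Rd d → ℝ} {CH : ℝ → ℝ}
    (hH : HamiltonianBounds H CH) {R : ℝ} {u : ℝ} {p : Rd d} (hu : |u| ≤ R) (hp : ‖p‖ < R)
    (x : Rd d) :
    ‖fderiv ℝ (fun q : Rd d × ℝ × Rd d => H q.1 q.2.1 q.2.2) (x, u, p)‖ ≤ CH R := by
  have := hH.2 R ((norm_nonneg _).trans_lt hp) x u (abs_le.1 hu) p
    (by simpa using hp) 1 (by norm_num)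
  rwa [norm_iteratedFDeriv_one] at this

lemma convex_slab (R : ℝ) :
    Convex ℝ ((univ : Set (Rd d)) ×ˢ (Icc (-R) R ×ˢ Metric.ball (0 : Rd d) R)) :=
  convex_univ.prod ((convex_Icc _ _).prod (convex_ball _ _))

lemma HamiltonianBounds.lipschitz_fderiv {H : Rd d → ℝ → Rd d → ℝ} {CH : ℝ → ℝ}
    (hH : HamiltonianBounds H CH) {R : ℝ} {q r : Rd d × ℝ × Rd d}
    (hq : |q.2.1| ≤ R ∧ ‖q.2.2‖ < R) (hr : |r.2.1| ≤ R ∧ ‖r.2.2‖ < R) :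
    ‖fderiv ℝ (fun q : Rd d × ℝ × Rd d => H q.1 q.2.1 q.2.2) q
      - fderiv ℝ (fun q : Rd d × ℝ × Rd d => H q.1 q.2.1 q.2.2) r‖ ≤ CH R * ‖q - r‖ := by
  have h1 : ContDiff ℝ 2 (fderiv ℝ (fun q : Rd d × ℝ × Rd d => H q.1 q.2.1 q.2.2)) :=
    hH.1.fderiv_right (by norm_num)
  refine (convex_slab R).norm_image_sub_le_of_norm_hasFDerivWithin_le
    (fun z _ => (h1.differentiable (by norm_num) z).hasFDerivAt.hasFDerivWithinAt) ?_
    ⟨mem_univ _, abs_le.1 hr.1, by simpa using hr.2⟩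
    ⟨mem_univ _, abs_le.1 hq.1, by simpa using hq.2⟩
  rintro ⟨x, u, p⟩ ⟨-, hu, hp⟩
  rw [norm_fderiv_fderiv_eq]
  have hp' : p ∈ Metric.ball (0 : Rd d) R := hp
  exact hH.2 R ((norm_nonneg p).trans_lt (by simpa using hp')) x u hu p hp' 2 (by norm_num)

lemma HamiltonianBounds.lipschitz {H : Rd d → ℝ → Rd d → ℝ} {CH : ℝ → ℝ}
    (hH : HamiltonianBounds H CH) {R : ℝ} {x : Rd d} {u : ℝ} {p q : Rd d}
    (hu : |u| ≤ R) (hp : ‖p‖ < R) (hq : ‖q‖ < R) : |H x u p - H x u q| ≤ CH R * ‖p - q‖ := by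
  have h := (convex_slab R).norm_image_sub_le_of_norm_hasFDerivWithin_le (C := CH R)
    (f := fun q : Rd d × ℝ × Rd d => H q.1 q.2.1 q.2.2)
    (fun z _ => (hH.1.differentiable (by norm_num) z).hasFDerivAt.hasFDerivWithinAt)
    (fun z hz => hH.norm_fderiv_le (abs_le.2 hz.2.1) (by simpa using hz.2.2) z.1)
    (x := (x, u, q)) (y := (x, u, p))
    ⟨mem_univ _, abs_le.1 hu, by simpa using hq⟩ ⟨mem_univ _, abs_le.1 hu, by simpa using hp⟩
  simpa [Prod.norm_def] using h

lemma CbBound.isTame {g : Rd d → ℝ} {M : ℝ} (h : CbBound 2 g M) : IsTame g (fderiv ℝ g) M := by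
  have h1 : ContDiff ℝ 1 (fderiv ℝ g) := h.1.fderiv_right (by norm_num)
  refine ⟨fun x => (h.1.differentiable (by norm_num) x).hasFDerivAt, fun x => ?_, fun x y => ?_⟩
  · have := h.2 1 (by norm_num) x
    rwa [norm_iteratedFDeriv_one] at this
  · refine convex_univ.norm_image_sub_le_of_norm_hasFDerivWithin_le
      (fun z _ => (h1.differentiable one_ne_zero z).hasFDerivAt.hasFDerivWithinAt) (fun z _ => ?_)
      (mem_univ _) (mem_univ _)
    rw [norm_fderiv_fderiv_eq]
    exact h.2 2 le_rfl z

variable {T L Cf Cu : ℝ} {f : ℝ → Rd d → ℝ} {u₀ : Rd d → ℝ} {ωf : ℝ → ℝ}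

/-- The gradient of the source is jointly continuous: it is Lipschitz in space uniformly in time,
and continuous in time by interpolation. -/
lemma DataBounds.continuousOn_fderiv (hf : DataBounds T f u₀ L Cf Cu ωf) (hω : IsModulus ωf) :
    ContinuousOn (fun q : ℝ × Rd d => fderiv ℝ (f q.1) q.2) (Ioo 0 T ×ˢ univ) := by
  rintro ⟨t, x⟩ ⟨ht, -⟩
  refine ContinuousAt.continuousWithinAt ?_
  have ht' := Ioo_subset_Icc_self ht
  have hCf : 0 ≤ Cf := (norm_nonneg _).trans ((hf.f_C2 t ht').2 0 (by norm_num) 0)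
  rw [ContinuousAt, tendsto_iff_norm_sub_tendsto_zero]
  have hlim : Tendsto (fun q : ℝ × Rd d => Cf * ‖q.2 - x‖
      + (2 + (Cf + Cf)) * √(ωf (|q.1 - t|))) (𝓝 (t, x)) (𝓝 0) := by
    have h1 : Tendsto (fun q : ℝ × Rd d => Cf * ‖q.2 - x‖) (𝓝 (t, x)) (𝓝 0) := by
      have : Continuous fun q : ℝ × Rd d => Cf * ‖q.2 - x‖ := by fun_prop
      simpa using this.tendsto (t, x)
    have h2 : Tendsto (fun q : ℝ × Rd d => |q.1 - t|) (𝓝 (t, x)) (𝓝[≥] 0) := by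
      refine tendsto_nhdsWithin_iff.2 ⟨?_, Eventually.of_forall fun q => mem_Ici.2 (abs_nonneg _)⟩
      have : Continuous fun q : ℝ × Rd d => |q.1 - t| := by fun_prop
      simpa using this.tendsto (t, x)
    have h3 := (Real.continuous_sqrt.tendsto 0).comp (hω.tendsto.comp h2)
    rw [Real.sqrt_zero] at h3
    simpa using h1.add (h3.const_mul (2 + (Cf + Cf)))
  refine squeeze_zero' (Eventually.of_forall fun _ => norm_nonneg _) ?_ hlim
  filter_upwards [(continuous_fst.tendsto (t, x)).eventually (Ioo_mem_nhds ht.1 ht.2)] with q hq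
  have hq' := Ioo_subset_Icc_self hq
  have e : fderiv ℝ (f q.1) q.2 - fderiv ℝ (f t) x
      = (fderiv ℝ (f t) q.2 - fderiv ℝ (f t) x) + (fderiv ℝ (f q.1) q.2 - fderiv ℝ (f t) q.2) := by
    abel
  rw [e]
  refine (norm_add_le _ _).trans (add_le_add ((hf.f_C2 t ht').isTame.lip' _ _) ?_)
  refine norm_fderiv_le_sqrt (g := fun y => f q.1 y - f t y)
    (g' := fun y => fderiv ℝ (f q.1) y - fderiv ℝ (f t) y)
    (fun y => ((hf.f_C2 _ hq').isTame.hasFDerivAt y).sub ((hf.f_C2 t ht').isTame.hasFDerivAt y))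
    (fun y => ?_) (fun y z => ?_) (by positivity) q.2
  · have := hf.f_modulus t ht' q.1 hq' y y
    rwa [sub_self, norm_zero, add_zero] at this
  · rw [sub_sub_sub_comm]
    refine (norm_sub_le _ _).trans ?_
    rw [add_mul]
    exact add_le_add ((hf.f_C2 _ hq').isTame.lip' y z) ((hf.f_C2 t ht').isTame.lip' y z)

end Truncation

section TruncatedSource

variable {d : ℕ} {T L Cf Cu : ℝ} {f : ℝ → Rd d → ℝ} {u₀ : Rd d → ℝ} {ωf : ℝ → ℝ}

lemma IsTame.continuous {V E : Type*} [NormedAddCommGroup V] [NormedSpace ℝ V]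
    [NormedAddCommGroup E] [NormedSpace ℝ E] {g : V → E} {g' : V → V →L[ℝ] E} {c : ℝ}
    (h : IsTame g g' c) : Continuous g :=
  continuous_iff_continuousAt.2 fun x => (h.hasFDerivAt x).continuousAt

lemma IsTame.nonneg {V E : Type*} [NormedAddCommGroup V] [NormedSpace ℝ V]
    [NormedAddCommGroup E] [NormedSpace ℝ E] {g : V → E} {g' : V → V →L[ℝ] E} {c : ℝ}
    (h : IsTame g g' c) : 0 ≤ c := (norm_nonneg _).trans (h.bdd' 0)

lemma IsTame.continuous' {V E : Type*} [NormedAddCommGroup V] [NormedSpace ℝ V]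
    [NormedAddCommGroup E] [NormedSpace ℝ E] {g : V → E} {g' : V → V →L[ℝ] E} {c : ℝ}
    (h : IsTame g g' c) : Continuous g' := by
  have : LipschitzWith c.toNNReal g' := LipschitzWith.of_dist_le_mul fun y z => by
    rw [Real.coe_toNNReal _ h.nonneg, dist_eq_norm, dist_eq_norm]
    exact h.lip' y z
  exact this.continuous

lemma IsTame.lip {V E : Type*} [NormedAddCommGroup V] [NormedSpace ℝ V]
    [NormedAddCommGroup E] [NormedSpace ℝ E] {g : V → E} {g' : V → V →L[ℝ] E} {c : ℝ}
    (h : IsTame g g' c) (x y : V) : ‖g x - g y‖ ≤ c * ‖x - y‖ :=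
  convex_univ.norm_image_sub_le_of_norm_hasFDerivWithin_le
    (fun z _ => (h.hasFDerivAt z).hasFDerivWithinAt) (fun z _ => h.bdd' z) (mem_univ _)
    (mem_univ _)

/-- The change of variables `(x, u, ℓ) ↦ (x, χ₁ u, χ₂ ℓ)` of the truncation. -/
lemma exists_isTame_truncation {χ₁ : ℝ → ℝ} {χ₁' : ℝ → ℝ →L[ℝ] ℝ} {c₁ : ℝ} (h₁ : IsTame χ₁ χ₁' c₁)
    {χ₂ : Rd d → Rd d} {χ₂' : Rd d → Rd d →L[ℝ] Rd d} {c₂ : ℝ} (h₂ : IsTame χ₂ χ₂' c₂) :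
    ∃ Θ', IsTame (fun q : Rd d × ℝ × (Rd d →L[ℝ] ℝ) =>
      (q.1, χ₁ q.2.1, χ₂ ((InnerProductSpace.toDual ℝ (Rd d)).symm q.2.2))) Θ' (1 + c₁ + c₂) := by
  let J : (Rd d →L[ℝ] ℝ) →L[ℝ] Rd d :=
    (InnerProductSpace.toDual ℝ (Rd d)).symm.toContinuousLinearEquiv.toContinuousLinearMap
  have hJ : ∀ ℓ, ‖J ℓ‖ = ‖ℓ‖ := fun ℓ => (InnerProductSpace.toDual ℝ (Rd d)).symm.norm_map ℓ
  have hc₁ := h₁.nonneg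
  have hc₂ := h₂.nonneg
  refine ⟨fun q => (ContinuousLinearMap.id ℝ (Rd d)).prodMap
    ((χ₁' q.2.1).prodMap ((χ₂' (J q.2.2)).comp J)), fun q => ?_, fun q => ?_, fun q r => ?_⟩
  · have e1 : HasFDerivAt (fun q : Rd d × ℝ × (Rd d →L[ℝ] ℝ) => χ₁ q.2.1)
        ((χ₁' q.2.1).comp ((ContinuousLinearMap.fst ℝ _ _).comp (ContinuousLinearMap.snd ℝ _ _))) q :=
      (h₁.hasFDerivAt q.2.1).comp q (hasFDerivAt_snd.fst)
    have e2 : HasFDerivAt (fun q : Rd d × ℝ × (Rd d →L[ℝ] ℝ) => J q.2.2)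
        (J.comp ((ContinuousLinearMap.snd ℝ _ _).comp (ContinuousLinearMap.snd ℝ _ _))) q :=
      J.hasFDerivAt.comp q (hasFDerivAt_snd.snd)
    have e3 := (h₂.hasFDerivAt (J q.2.2)).comp q e2
    exact (hasFDerivAt_fst.prodMk (e1.prodMk e3))
  · refine ContinuousLinearMap.opNorm_le_bound _ (by positivity) fun z => ?_
    have n1 : ‖z.1‖ ≤ ‖z‖ := norm_fst_le z
    have n2 : ‖z.2.1‖ ≤ ‖z‖ := (norm_fst_le z.2).trans (norm_snd_le z)
    have n3 : ‖z.2.2‖ ≤ ‖z‖ := (norm_snd_le z.2).trans (norm_snd_le z)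
    have m2 := (χ₁' q.2.1).le_of_opNorm_le_of_le (h₁.bdd' _) n2
    have m3 := (χ₂' (J q.2.2)).le_of_opNorm_le_of_le (h₂.bdd' _) ((hJ z.2.2).le.trans n3)
    have hz := norm_nonneg z
    refine norm_prod_le_iff.2 ⟨?_, norm_prod_le_iff.2 ⟨m2.trans ?_, m3.trans ?_⟩⟩
    · exact n1.trans (le_mul_of_one_le_left hz (by linarith))
    · gcongr; linarith
    · gcongr; linarith
  · refine ContinuousLinearMap.opNorm_le_bound _ (by positivity) fun z => ?_
    have n2 : ‖z.2.1‖ ≤ ‖z‖ := (norm_fst_le z.2).trans (norm_snd_le z)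
    have n3 : ‖z.2.2‖ ≤ ‖z‖ := (norm_snd_le z.2).trans (norm_snd_le z)
    have k2 : ‖q.2.1 - r.2.1‖ ≤ ‖q - r‖ := (norm_fst_le (q - r).2).trans (norm_snd_le (q - r))
    have k3 : ‖J q.2.2 - J r.2.2‖ ≤ ‖q - r‖ := by
      rw [← map_sub, hJ]
      exact (norm_snd_le (q - r).2).trans (norm_snd_le (q - r))
    have m2 := (χ₁' q.2.1 - χ₁' r.2.1).le_of_opNorm_le_of_le ((h₁.lip' _ _).trans
      (mul_le_mul_of_nonneg_left k2 hc₁)) n2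
    have m3 := (χ₂' (J q.2.2) - χ₂' (J r.2.2)).le_of_opNorm_le_of_le ((h₂.lip' _ _).trans
      (mul_le_mul_of_nonneg_left k3 hc₂)) ((hJ z.2.2).le.trans n3)
    have hz := norm_nonneg z
    have hqr := norm_nonneg (q - r)
    refine norm_prod_le_iff.2 ⟨?_, norm_prod_le_iff.2 ⟨m2.trans ?_, m3.trans ?_⟩⟩
    · simp
      positivity
    · gcongr; linarith
    · gcongr; linarith

/-- The truncated nonlinearity is bounded with bounded and Lipschitz derivative; the constants
depend only on the structural bounds. -/
lemma exists_isNonlinearity_truncatedSource {CH : ℝ → ℝ} {R : ℝ} {χ₁ : ℝ → ℝ}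
    {χ₁' : ℝ → ℝ →L[ℝ] ℝ} {c₁ : ℝ} (h₁ : IsTame χ₁ χ₁' c₁) (hχ₁ : ∀ u, |χ₁ u| ≤ R)
    {χ₂ : Rd d → Rd d} {χ₂' : Rd d → Rd d →L[ℝ] Rd d} {c₂ : ℝ} (h₂ : IsTame χ₂ χ₂' c₂)
    (hχ₂ : ∀ p, ‖χ₂ p‖ < R) {H : Rd d → ℝ → Rd d → ℝ} (hH : HamiltonianBounds H CH)
    (hf : DataBounds T f u₀ L Cf Cu ωf) (hω : IsModulus ωf) :
    ∃ N', IsNonlinearity (truncatedSource f H χ₁ χ₂) N' T (|Cf| + |CH R|)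
      (|Cf| + |CH R| * (1 + c₁ + c₂) * (2 + c₁ + c₂)) := by
  obtain ⟨Θ', hΘ⟩ := exists_isTame_truncation h₁ h₂
  set Θ : Rd d × ℝ × (Rd d →L[ℝ] ℝ) → Rd d × ℝ × Rd d := fun q =>
    (q.1, χ₁ q.2.1, χ₂ ((InnerProductSpace.toDual ℝ (Rd d)).symm q.2.2)) with hΘdef
  set h : Rd d × ℝ × Rd d → ℝ := fun q => H q.1 q.2.1 q.2.2 with hdef
  have hΘR : ∀ q, |(Θ q).2.1| ≤ R ∧ ‖(Θ q).2.2‖ < R := fun q => ⟨hχ₁ _, hχ₂ _⟩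
  have hc0 := hΘ.nonneg
  set c := 1 + c₁ + c₂ with hc
  have hdh : ∀ q, HasFDerivAt h (fderiv ℝ h q) q := fun q =>
    (hH.1.differentiable (by norm_num) q).hasFDerivAt
  have hb : ∀ q, ‖fderiv ℝ h (Θ q)‖ ≤ |CH R| := fun q =>
    (hH.norm_fderiv_le (hΘR q).1 (hΘR q).2 _).trans (le_abs_self _)
  have hcd : Continuous (fderiv ℝ h) := hH.1.continuous_fderiv (by norm_num)
  have htame : ∀ s ∈ Ioo 0 T, IsTame (f s) (fderiv ℝ (f s)) |Cf| := fun s hs => by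
    have := (hf.f_C2 s (Ioo_subset_Icc_self hs)).isTame
    exact ⟨this.hasFDerivAt, fun x => (this.bdd' x).trans (le_abs_self _),
      fun x y => (this.lip' x y).trans (by gcongr; exact le_abs_self _)⟩
  let fstL : (Rd d × ℝ × (Rd d →L[ℝ] ℝ)) →L[ℝ] Rd d := ContinuousLinearMap.fst ℝ _ _
  have hfst : ‖fstL‖ ≤ 1 := ContinuousLinearMap.norm_fst_le _ _ _
  refine ⟨fun s q => (fderiv ℝ (f s) q.1).comp fstL - (fderiv ℝ h (Θ q)).comp (Θ' q),
    ?_, fun s hs q => ?_, fun s hs q => ?_, ?_, fun s hs q => ?_, fun s hs q r => ?_⟩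
  · have h1 : ContinuousOn (fun q : ℝ × Rd d × ℝ × (Rd d →L[ℝ] ℝ) => f q.1 q.2.1)
        (Ioo 0 T ×ˢ univ) :=
      hf.cont_f.comp (f := fun q : ℝ × Rd d × ℝ × (Rd d →L[ℝ] ℝ) => (q.1, q.2.1)) (by fun_prop)
        fun q hq => ⟨Ioo_subset_Icc_self hq.1, mem_univ _⟩
    exact h1.sub ((hH.1.continuous.comp (hΘ.continuous.comp continuous_snd)).continuousOn)
  · have h1 := (hf.f_C2 s (Ioo_subset_Icc_self hs)).2 0 (by norm_num) q.1
    rw [norm_iteratedFDeriv_zero] at h1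
    refine (norm_sub_le _ _).trans (add_le_add (h1.trans (le_abs_self _)) ?_)
    exact (hH.abs_apply_le (hΘR q).1 (hΘR q).2 q.1).trans (le_abs_self _)
  · exact (((htame s hs).hasFDerivAt q.1).comp q hasFDerivAt_fst).sub
      ((hdh (Θ q)).comp q (hΘ.hasFDerivAt q))
  · have h1 : ContinuousOn (fun q : ℝ × Rd d × ℝ × (Rd d →L[ℝ] ℝ) => fderiv ℝ (f q.1) q.2.1)
        (Ioo 0 T ×ˢ univ) :=
      (hf.continuousOn_fderiv hω).comp
        (f := fun q : ℝ × Rd d × ℝ × (Rd d →L[ℝ] ℝ) => (q.1, q.2.1)) (by fun_prop)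
        fun q hq => ⟨hq.1, mem_univ _⟩
    refine (h1.clm_comp continuousOn_const).sub (Continuous.continuousOn ?_)
    exact (hcd.comp (hΘ.continuous.comp continuous_snd)).clm_comp
      (hΘ.continuous'.comp continuous_snd)
  · refine (norm_sub_le _ _).trans (add_le_add ?_ ?_)
    · refine (ContinuousLinearMap.opNorm_comp_le _ _).trans ?_
      exact (mul_le_of_le_one_right (norm_nonneg _) hfst).trans ((htame s hs).bdd' q.1)
    · refine (ContinuousLinearMap.opNorm_comp_le _ _).trans ?_
      have h1 : |CH R| * c * 1 ≤ |CH R| * c * (2 + c₁ + c₂) := by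
        have := h₁.nonneg
        have := h₂.nonneg
        gcongr
        linarith
      refine le_trans ?_ h1
      rw [mul_one]
      exact mul_le_mul (hb q) (hΘ.bdd' q) (norm_nonneg _) (abs_nonneg _)
  · have hqr := norm_nonneg (q - r)
    have e : (fderiv ℝ (f s) q.1).comp fstL - (fderiv ℝ h (Θ q)).comp (Θ' q)
        - ((fderiv ℝ (f s) r.1).comp fstL - (fderiv ℝ h (Θ r)).comp (Θ' r))
        = (fderiv ℝ (f s) q.1 - fderiv ℝ (f s) r.1).comp fstL
          - ((fderiv ℝ h (Θ q) - fderiv ℝ h (Θ r)).comp (Θ' q)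
            + (fderiv ℝ h (Θ r)).comp (Θ' q - Θ' r)) := by
      ext z <;> simp <;> ring
    have n1 : ‖(fderiv ℝ (f s) q.1 - fderiv ℝ (f s) r.1).comp fstL‖ ≤ |Cf| * ‖q - r‖ := by
      refine (ContinuousLinearMap.opNorm_comp_le _ _).trans ?_
      refine (mul_le_of_le_one_right (norm_nonneg _) hfst).trans (((htame s hs).lip' q.1 r.1).trans ?_)
      gcongr
      exact norm_fst_le (q - r)
    have n2 : ‖(fderiv ℝ h (Θ q) - fderiv ℝ h (Θ r)).comp (Θ' q)‖
        ≤ |CH R| * (c * ‖q - r‖) * c := by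
      refine (ContinuousLinearMap.opNorm_comp_le _ _).trans ?_
      refine mul_le_mul ?_ (hΘ.bdd' q) (norm_nonneg _) (by positivity)
      refine (hH.lipschitz_fderiv (hΘR q) (hΘR r)).trans ?_
      exact mul_le_mul (le_abs_self _) (hΘ.lip q r) (norm_nonneg _) (abs_nonneg _)
    have n3 : ‖(fderiv ℝ h (Θ r)).comp (Θ' q - Θ' r)‖ ≤ |CH R| * (c * ‖q - r‖) := by
      refine (ContinuousLinearMap.opNorm_comp_le _ _).trans ?_
      exact mul_le_mul (hb r) (hΘ.lip' q r) (norm_nonneg _) (abs_nonneg _)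
    simp only
    rw [e]
    refine (norm_sub_le _ _).trans ((add_le_add n1 ((norm_add_le _ _).trans
      (add_le_add n2 n3))).trans (le_of_eq ?_))
    rw [hc]
    ring

end TruncatedSource

/-! ### Smooth solutions for bounded nonlinearities -/

section Strong

variable {d : ℕ} {μ : Measure (Rd d)}

lemma IsC3.isC11 {T R : ℝ} {u : ℝ → Rd d → ℝ} {v : ℝ → Rd d → Rd d →L[ℝ] ℝ}
    {w : ℝ → Rd d → Rd d →L[ℝ] Rd d →L[ℝ] ℝ} {z : ℝ → Rd d → Rd d →L[ℝ] Rd d →L[ℝ] Rd d →L[ℝ] ℝ}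
    (h : IsC3 T R u v w z) {t : ℝ} (ht : t ∈ Ioo 0 T) : IsC11 (u t) (v t) R R :=
  ⟨h.d1 t ht, h.b0 t ht, h.b1 t ht, fun _ _ =>
    convex_univ.norm_image_sub_le_of_norm_hasFDerivWithin_le
      (fun p _ => (h.d2 t ht p).hasFDerivWithinAt) (fun p _ => h.b2 t ht p) (mem_univ _)
      (mem_univ _)⟩

lemma IsC3.continuousOn_levyOp {T R : ℝ} {u : ℝ → Rd d → ℝ} {v : ℝ → Rd d → Rd d →L[ℝ] ℝ}
    {w : ℝ → Rd d → Rd d →L[ℝ] Rd d →L[ℝ] ℝ} {z : ℝ → Rd d → Rd d →L[ℝ] Rd d →L[ℝ] Rd d →L[ℝ] ℝ}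
    (h : IsC3 T R u v w z) (hμ : Integrable levyWeight μ) :
    ContinuousOn (fun q : ℝ × Rd d => levyOp μ (u q.1) q.2) (Ioo 0 T ×ˢ univ) := by
  rintro ⟨t, x⟩ ⟨ht, -⟩
  refine ContinuousAt.continuousWithinAt ?_
  have hc0 : ∀ y, ContinuousAt (fun q : ℝ × Rd d => u q.1 q.2) (t, y) := fun y =>
    h.c0.continuousAt (prod_mem_nhds (Ioo_mem_nhds ht.1 ht.2) univ_mem)
  have hc1 : ContinuousAt (fun q : ℝ × Rd d => v q.1 q.2) (t, x) :=
    h.c1.continuousAt (prod_mem_nhds (Ioo_mem_nhds ht.1 ht.2) univ_mem)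
  refine tendsto_levyOp (l := 𝓝 (t, x)) (φ := fun q : ℝ × Rd d => u q.1)
    (φ' := fun q : ℝ × Rd d => v q.1) (x := fun q => q.2) hμ (a := R) (b := R) ?_
    (h.d1 t ht) (fun p => ?_) hc1
  · filter_upwards [(continuous_fst.tendsto (t, x)).eventually (Ioo_mem_nhds ht.1 ht.2)] with q hq
      using h.isC11 hq
  · exact ContinuousAt.comp (f := fun q : ℝ × Rd d => (q.1, q.2 + p))
      (g := fun q : ℝ × Rd d => u q.1 q.2) (hc0 (x + p)) (by fun_prop)

/-- A `C³` solution `u` of `∂ₜu = Lu + N(t, x, u, Du)` with initial value `u₀`, together with its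
space derivatives `v`, `w`, `z`, all bounded by `R`. -/
structure IsStrong (μ : Measure (Rd d)) (T R : ℝ) (N : ℝ → Rd d × ℝ × (Rd d →L[ℝ] ℝ) → ℝ)
    (u₀ : Rd d → ℝ) (u : ℝ → Rd d → ℝ) (v : ℝ → Rd d → Rd d →L[ℝ] ℝ)
    (w : ℝ → Rd d → Rd d →L[ℝ] Rd d →L[ℝ] ℝ)
    (z : ℝ → Rd d → Rd d →L[ℝ] Rd d →L[ℝ] Rd d →L[ℝ] ℝ) : Prop where
  isC3 : IsC3 T R u v w z
  equation : ∀ t ∈ Ioo 0 T, ∀ x,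
    HasDerivAt (fun s => u s x) (levyOp μ (u t) x + N t (x, u t x, v t x)) t
  lip : ∀ s t x y, |u s x - u t y| ≤ R * (|s - t| + ‖x - y‖)
  initial : u 0 = u₀

/-- Existence of a `C³` solution for a bounded nonlinearity with bounded and Lipschitz derivative. The
bound `R` is chosen before the measure, the nonlinearity and the initial value. -/
theorem exists_isStrong (d : ℕ) {T σ Cμ : ℝ} {κ : ℕ → ℝ → ℝ} {M C C₀ : ℝ} (hT : 0 < T)
    (hσ : 1 < σ) (hM : 0 ≤ M) (hC : 0 ≤ C) (hC₀ : 0 ≤ C₀) :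
    ∃ R : ℝ, ∀ μ : Measure (Rd d), LevyCondition μ Cμ → KernelBounds (heatKernel μ) σ T κ →
      ∀ N N', IsNonlinearity N N' T M C → ∀ u₀ : Rd d → ℝ, ContDiff ℝ 3 u₀ →
      (∀ x, ‖u₀ x‖ ≤ C₀) → (∀ x, ‖fderiv ℝ u₀ x‖ ≤ C₀) →
      (∀ x, ‖fderiv ℝ (fderiv ℝ u₀) x‖ ≤ C₀) →
      (∀ x, ‖fderiv ℝ (fderiv ℝ (fderiv ℝ u₀)) x‖ ≤ C₀) →
      ∃ u v w z, IsStrong μ T R N u₀ u v w z := by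
  obtain ⟨R, hR⟩ := exists_isC3_of_isMild (Rd d) (κ := max (κ 1 1) 0) hT hσ hM hC hC₀
  set D := 3 * R * |Cμ| + M with hD
  refine ⟨R + D, fun μ hμ hK N N' hN u₀ hu₀ b0 b1 b2 b3 => ?_⟩
  have hF := hK.isHeatFamily hμ.integrable
  obtain ⟨u, v, huv⟩ : ∃ u v, IsMild (heatKernel μ) T (fun s y a => N s (y, a)) u₀ u v :=
    hF.exists_isMild hT hσ hN.cont (fun s hs y a => hN.bdd s hs _) hC
      (fun s hs y a b => (hN.lip hs _ _).trans (by simp [Prod.norm_def]))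
      (hu₀.of_le (by norm_num)) b0 b1
  obtain ⟨w, z, h3⟩ := hR _ hF N N' hN u₀ hu₀ b0 b1 b2 b3 u v huv
  have hR0 : 0 ≤ R := (norm_nonneg _).trans (h3.b0 (T / 2) ⟨by linarith, by linarith⟩ 0)
  have hD0 : 0 ≤ D := by positivity
  set F : ℝ → Rd d → ℝ := fun s y => N s (y, u s y, v s y) with hFdef
  have hFc : ContinuousOn (fun q : ℝ × Rd d => F q.1 q.2) (Ioo 0 T ×ˢ univ) :=
    hN.cont.comp (f := fun q : ℝ × Rd d => (q.1, q.2, u q.1 q.2, v q.1 q.2))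
      (continuousOn_fst.prodMk (continuousOn_snd.prodMk (h3.c0.prodMk h3.c1)))
      fun q hq => ⟨hq.1, mem_univ _⟩
  have hFM : ∀ s ∈ Ioo 0 T, ∀ y, ‖F s y‖ ≤ M := fun s hs y => hN.bdd s hs _
  have hLc := h3.continuousOn_levyOp hμ.integrable
  have hLb : ∀ t ∈ Ioo 0 T, ∀ x, |levyOp μ (u t) x| ≤ 3 * R * |Cμ| := fun t ht x =>
    ((h3.isC11 ht).abs_levyOp_le hμ x).trans (le_of_eq (by ring))
  have hslice : ∀ {g : ℝ → Rd d → ℝ} (x : Rd d),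
      ContinuousOn (fun q : ℝ × Rd d => g q.1 q.2) (Ioo 0 T ×ˢ univ) →
      ContinuousOn (fun t => g t x) (Ioo 0 T) := fun x hg =>
    hg.comp (f := fun t : ℝ => (t, x)) (by fun_prop) fun t ht => ⟨ht, mem_univ _⟩
  have hder : ∀ t ∈ Ioo 0 T, ∀ x,
      HasDerivAt (fun s => u s x) (levyOp μ (u t) x + F t x) t := fun t ht x =>
    hasDerivAt_of_right (w := fun t => levyOp μ (u t) x + F t x) (hslice x h3.c0)
      ((hslice x hLc).add (hslice x hFc)) (fun s hs => hK.hasDerivWithinAt hμ hFc hFM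
        hu₀.continuous b0 huv.eq (fun t ht => h3.isC11 ht) hs x) ht
  have hderb : ∀ t ∈ Ioo 0 T, ∀ x, ‖levyOp μ (u t) x + F t x‖ ≤ D := fun t ht x =>
    (norm_add_le _ _).trans (add_le_add (hLb t ht x) (hFM t ht x))
  have hlip : ∀ s ∈ Ioo 0 T, ∀ t ∈ Ioo 0 T, ∀ x y,
      |u s x - u t y| ≤ D * |s - t| + R * ‖x - y‖ := by
    intro s hs t ht x y
    have h1 : ‖u s x - u t x‖ ≤ D * ‖s - t‖ :=
      (convex_Ioo 0 T).norm_image_sub_le_of_norm_hasDerivWithin_le (f := fun s => u s x)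
        (fun r hr => (hder r hr x).hasDerivWithinAt) (fun r hr => hderb r hr x) ht hs
    have h2 := (h3.isC11 ht).abs_sub_le x y
    exact (abs_sub_le _ (u t x) _).trans (add_le_add h1 h2)
  have hLO : LipschitzOnWith (D + R).toNNReal (fun q : ℝ × Rd d => u q.1 q.2)
      (Ioo 0 T ×ˢ univ) := by
    refine LipschitzOnWith.of_dist_le_mul fun p hp q hq => ?_
    rw [Real.coe_toNNReal _ (by positivity), Real.dist_eq, add_mul]
    refine (hlip _ hp.1 _ hq.1 _ _).trans ?_
    have h1 : |p.1 - q.1| ≤ dist p q := by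
      rw [← Real.dist_eq]
      exact le_max_left _ _
    have h2 : ‖p.2 - q.2‖ ≤ dist p q := by
      rw [← dist_eq_norm]
      exact le_max_right _ _
    gcongr
  -- a mild solution is only constrained on `(0, T)`; the Lipschitz extension supplies the value at `0`
  obtain ⟨U, hU, hUu⟩ := hLO.extend_real
  have hUt : ∀ t ∈ Ioo 0 T, (fun x => U (t, x)) = u t := fun t ht =>
    funext fun x => (hUu (show (t, x) ∈ Ioo 0 T ×ˢ univ from ⟨ht, mem_univ _⟩)).symm
  refine ⟨fun t x => U (t, x), v, w, z, ?_, ?_, ?_, ?_⟩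
  · refine ⟨fun t ht => by simpa only [hUt t ht] using h3.d1 t ht, h3.d2, h3.d3,
      hU.continuous.continuousOn, h3.c1, h3.c2, h3.c3, fun t ht x => ?_, ?_, ?_, ?_⟩
    · have := h3.b0 t ht x
      rw [← hUt t ht] at this
      exact this.trans (by linarith)
    · exact fun t ht x => (h3.b1 t ht x).trans (by linarith)
    · exact fun t ht x => (h3.b2 t ht x).trans (by linarith)
    · exact fun t ht x => (h3.b3 t ht x).trans (by linarith)
  · intro t ht x
    have e : (fun s => U (s, x)) =ᶠ[𝓝 t] fun s => u s x := by
      filter_upwards [Ioo_mem_nhds ht.1 ht.2] with s hs using congrFun (hUt s hs) x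
    have := (hder t ht x).congr_of_eventuallyEq e
    simp only [hFdef] at this
    rw [← hUt t ht] at this
    exact this
  · intro s t x y
    have h1 := hU.dist_le_mul (s, x) (t, y)
    rw [Real.coe_toNNReal _ (by positivity), Real.dist_eq] at h1
    rw [add_comm R D]
    refine h1.trans ?_
    gcongr
    rw [Prod.dist_eq, Real.dist_eq, dist_eq_norm]
    exact max_le_add_of_nonneg (abs_nonneg _) (norm_nonneg _)
  · ext x
    -- both sides are the limit of `u t x` as `t → 0`
    have hne : (𝓝[Ioo 0 T] (0 : ℝ)).NeBot := by
      rw [nhdsWithin_Ioo_eq_nhdsGT hT]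
      infer_instance
    have l1 : Tendsto (fun t => U (t, x)) (𝓝[Ioo 0 T] 0) (𝓝 (U (0, x))) := by
      have : Continuous fun t : ℝ => U (t, x) := hU.continuous.comp (by fun_prop)
      exact (this.tendsto 0).mono_left nhdsWithin_le_nhds
    have hdu₀ : ContDiff ℝ 2 (fderiv ℝ u₀) := hu₀.fderiv_right (by norm_num)
    have hu₀C : IsC11 u₀ (fderiv ℝ u₀) C₀ C₀ :=
      ⟨fun y => (hu₀.differentiable (by norm_num) y).hasFDerivAt, b0, b1, fun y y' =>
        convex_univ.norm_image_sub_le_of_norm_hasFDerivWithin_le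
          (fun p _ => (hdu₀.differentiable (by norm_num) p).hasFDerivAt.hasFDerivWithinAt)
          (fun p _ => b2 p) (mem_univ _) (mem_univ _)⟩
    have l2 : Tendsto (fun t => U (t, x)) (𝓝[Ioo 0 T] 0) (𝓝 (u₀ x)) := by
      rw [tendsto_iff_norm_sub_tendsto_zero]
      have h1 : Tendsto (fun t : ℝ => (2 * C₀ + C₀) * |Cμ| * t + M * t) (𝓝[Ioo 0 T] 0) (𝓝 0) := by
        have : Continuous fun t : ℝ => (2 * C₀ + C₀) * |Cμ| * t + M * t := by fun_prop
        simpa using (this.tendsto 0).mono_left nhdsWithin_le_nhds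
      refine squeeze_zero' (Eventually.of_forall fun _ => norm_nonneg _) ?_ h1
      filter_upwards [self_mem_nhdsWithin] with t ht
      have e : U (t, x) - u₀ x = ((heatKernel μ t ⋆[smulB ℝ] u₀) x - u₀ x)
          + duhamel (smulB ℝ) (heatKernel μ) F t x := by
        have e1 : U (t, x) = u t x := congrFun (hUt t ht) x
        rw [e1, huv.eq t ht x]
        ring
      rw [e]
      refine (norm_add_le _ _).trans (add_le_add (hK.abs_convolution_sub_le hμ hu₀C ht x) ?_)
      have := FracHJB.norm_duhamel_le (B := smulB ℝ) (k := heatKernel μ) (G := F) (t := t) (x := x)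
        (c := fun _ => M) (by simp) fun r hr =>
        hF.norm_convolution_le ⟨hr.1, hr.2.trans ht.2⟩
          (hFM _ ⟨by linarith [hr.2], by linarith [hr.1, ht.2]⟩) x
      simpa [ht.1.le, mul_comm] using this
    exact tendsto_nhds_unique l1 l2

end Strong

/-! ### Comparison and a priori bounds -/

section Comparison

variable {d : ℕ} {μ : Measure (Rd d)}

lemma levyOp_sub {φ ψ : Rd d → ℝ} {p q : Rd d →L[ℝ] ℝ} {x : Rd d} (hφ : HasFDerivAt φ p x)
    (hψ : HasFDerivAt ψ q x) (hi : Integrable (levyIntegrand φ p x) μ)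
    (hj : Integrable (levyIntegrand ψ q x) μ) :
    levyOp μ (fun y => φ y - ψ y) x = levyOp μ φ x - levyOp μ ψ x := by
  have h : HasFDerivAt (fun y => φ y - ψ y) (p - q) x := hφ.sub hψ
  rw [levyOp_eq hφ, levyOp_eq hψ, levyOp_eq h, ← integral_sub hi hj]
  refine integral_congr_ae (ae_of_all _ fun z => ?_)
  by_cases hz : z ∈ Metric.ball (0 : Rd d) 1
  · simp only [levyIntegrand, indicator_of_mem hz, sub_apply]
    ring
  · simp only [levyIntegrand, indicator_of_notMem hz]
    ring

lemma levyOp_sub_const {φ : Rd d → ℝ} {p : Rd d →L[ℝ] ℝ} {x : Rd d} (hφ : HasFDerivAt φ p x)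
    (c : ℝ) : levyOp μ (fun y => φ y - c) x = levyOp μ φ x := by
  rw [levyOp_eq hφ, levyOp_eq (hφ.sub_const c)]
  refine integral_congr_ae (ae_of_all _ fun z => ?_)
  simp only [levyIntegrand]
  ring

lemma levyOp_neg {φ : Rd d → ℝ} {p : Rd d →L[ℝ] ℝ} {x : Rd d} (hφ : HasFDerivAt φ p x) :
    levyOp μ (fun y => -φ y) x = -levyOp μ φ x := by
  have h : HasFDerivAt (fun y => -φ y) (-p) x := hφ.neg
  rw [levyOp_eq hφ, levyOp_eq h, ← integral_neg]
  refine integral_congr_ae (ae_of_all _ fun z => ?_)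
  by_cases hz : z ∈ Metric.ball (0 : Rd d) 1
  · simp only [levyIntegrand, indicator_of_mem hz, neg_apply]
    ring
  · simp only [levyIntegrand, indicator_of_notMem hz]
    ring

lemma levyOp_comp_add {φ : Rd d → ℝ} {p : Rd d →L[ℝ] ℝ} {x h : Rd d}
    (hφ : HasFDerivAt φ p (x + h)) :
    levyOp μ (fun y => φ (y + h)) x = levyOp μ φ (x + h) := by
  have h1 : HasFDerivAt (fun y => φ (y + h)) p x := (hasFDerivAt_comp_add_right h).2 hφ
  rw [levyOp_eq hφ, levyOp_eq h1]
  refine integral_congr_ae (ae_of_all _ fun z => ?_)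
  simp only [levyIntegrand, add_right_comm]

/-- Bounded functions on `[0, T) × ℝ^d` that are differentiable in time and `C²` in space for
positive times. -/
structure IsC12 (T M : ℝ) (u ut : ℝ → Rd d → ℝ) : Prop where
  cont : ContinuousOn (fun q : ℝ × Rd d => u q.1 q.2) (Ico 0 T ×ˢ univ)
  bdd : ∀ t ∈ Ico 0 T, ∀ x, |u t x| ≤ M
  contDiff : ∀ t ∈ Ioo 0 T, ContDiff ℝ 2 (u t)
  hasDerivAt : ∀ t ∈ Ioo 0 T, ∀ x, HasDerivAt (fun s => u s x) (ut t x) t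

variable {T M M₁ M₂ : ℝ} {u ut u₁ u₁' u₂ u₂' : ℝ → Rd d → ℝ}

lemma IsC12.hasFDerivAt (h : IsC12 T M u ut) {t : ℝ} (ht : t ∈ Ioo 0 T) (x : Rd d) :
    HasFDerivAt (u t) (fderiv ℝ (u t) x) x :=
  ((h.contDiff t ht).differentiable (by norm_num) x).hasFDerivAt

lemma IsC12.neg (h : IsC12 T M u ut) : IsC12 T M (fun t x => -u t x) (fun t x => -ut t x) :=
  ⟨h.cont.neg, fun t ht x => by rw [abs_neg]; exact h.bdd t ht x, fun t ht => (h.contDiff t ht).neg,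
    fun t ht x => (h.hasDerivAt t ht x).neg⟩

lemma IsC12.comp_add (h : IsC12 T M u ut) (e : Rd d) :
    IsC12 T M (fun t x => u t (x + e)) (fun t x => ut t (x + e)) :=
  ⟨h.cont.comp (f := fun q : ℝ × Rd d => (q.1, q.2 + e)) (by fun_prop)
      fun q hq => ⟨hq.1, mem_univ _⟩, fun t ht x => h.bdd t ht _,
    fun t ht => (h.contDiff t ht).comp (contDiff_id.add contDiff_const),
    fun t ht x => h.hasDerivAt t ht _⟩

lemma IsC12.zero (T : ℝ) : IsC12 T 0 (fun _ (_ : Rd d) => 0) (fun _ _ => 0) :=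
  ⟨continuousOn_const, fun _ _ _ => by simp, fun _ _ => contDiff_const,
    fun t _ _ => hasDerivAt_const t 0⟩

/-- The maximum principle for a difference, compared with an exponential barrier. -/
theorem IsC12.comparison (hμ : Integrable levyWeight μ) (h₁ : IsC12 T M₁ u₁ u₁')
    (h₂ : IsC12 T M₂ u₂ u₂') {a B Λ C : ℝ} (ha : 0 ≤ a) (hB : 0 ≤ B) (hΛ : 0 ≤ Λ) (hC : 0 ≤ C)
    (h0 : ∀ x, u₁ 0 x - u₂ 0 x ≤ a)
    (heq : ∀ t ∈ Ioo 0 T, ∀ x, 0 < u₁ t x - u₂ t x - a * Real.exp (B * t) →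
      ‖fderiv ℝ (u₁ t) x - fderiv ℝ (u₂ t) x‖ ≤ 1 →
      (u₁' t x - levyOp μ (u₁ t) x) - (u₂' t x - levyOp μ (u₂ t) x) - a * B * Real.exp (B * t)
        ≤ Λ * (u₁ t x - u₂ t x - a * Real.exp (B * t))
          + C * ‖fderiv ℝ (u₁ t) x - fderiv ℝ (u₂ t) x‖)
    {t : ℝ} (ht : t ∈ Ico 0 T) (x : Rd d) : u₁ t x - u₂ t x ≤ a * Real.exp (B * t) := by
  have hd : ∀ t ∈ Ioo 0 T, ∀ x, HasFDerivAt (fun x => u₁ t x - u₂ t x - a * Real.exp (B * t))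
      (fderiv ℝ (u₁ t) x - fderiv ℝ (u₂ t) x) x := fun t ht x =>
    ((h₁.hasFDerivAt ht x).sub (h₂.hasFDerivAt ht x)).sub_const _
  have key := max_principle hμ (T := T)
    (w := fun t x => u₁ t x - u₂ t x - a * Real.exp (B * t))
    (wt := fun t x => u₁' t x - u₂' t x - a * B * Real.exp (B * t))
    (M := M₁ + M₂ + a * Real.exp (B * T)) ?_ (fun t ht x => ?_) (fun t ht => ?_)
    (fun t ht x => ?_) (fun x => ?_) hΛ hC (fun t ht x hpos hle => ?_) ht x
  · linarith
  · exact (h₁.cont.sub h₂.cont).sub (by fun_prop)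
  · have e1 : a * Real.exp (B * t) ≤ a * Real.exp (B * T) := by
      gcongr
      exact ht.2.le
    have e2 : 0 ≤ a * Real.exp (B * t) := by positivity
    have b1 := abs_le.1 (h₁.bdd t ht x)
    have b2 := abs_le.1 (h₂.bdd t ht x)
    rw [abs_le]
    constructor <;> linarith [b1.1, b1.2, b2.1, b2.2]
  · exact ((h₁.contDiff t ht).sub (h₂.contDiff t ht)).sub contDiff_const
  · refine ((h₁.hasDerivAt t ht x).sub (h₂.hasDerivAt t ht x)).sub ?_
    have h3 : HasDerivAt (fun t => B * t) B t := by simpa using (hasDerivAt_id t).const_mul B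
    refine (h3.exp.const_mul a).congr_deriv ?_
    ring
  · simpa using h0 x
  · rw [(hd t ht x).fderiv] at hle ⊢
    have ht' : t ∈ Ico 0 T := ⟨ht.1.le, ht.2⟩
    have h12 : HasFDerivAt (fun x => u₁ t x - u₂ t x)
        (fderiv ℝ (u₁ t) x - fderiv ℝ (u₂ t) x) x :=
      (h₁.hasFDerivAt ht x).sub (h₂.hasFDerivAt ht x)
    rw [levyOp_sub_const h12, levyOp_sub (h₁.hasFDerivAt ht x) (h₂.hasFDerivAt ht x)
      (integrable_levyIntegrand hμ (h₁.contDiff t ht) (h₁.bdd t ht') x)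
      (integrable_levyIntegrand hμ (h₂.contDiff t ht) (h₂.bdd t ht') x)]
    have := heq t ht x hpos hle
    linarith

lemma IsC3.contDiff {T R : ℝ} {u : ℝ → Rd d → ℝ} {v : ℝ → Rd d → Rd d →L[ℝ] ℝ}
    {w : ℝ → Rd d → Rd d →L[ℝ] Rd d →L[ℝ] ℝ} {z : ℝ → Rd d → Rd d →L[ℝ] Rd d →L[ℝ] Rd d →L[ℝ] ℝ}
    (h : IsC3 T R u v w z) {t : ℝ} (ht : t ∈ Ioo 0 T) : ContDiff ℝ 3 (u t) := by
  have h0 : ContDiff ℝ 0 (z t) := contDiff_zero.2 (continuous_slice h.c3 ht)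
  have h1 : ContDiff ℝ (0 + 1) (w t) := contDiff_succ_iff_hasFDerivAt.2 ⟨z t, h0, h.d3 t ht⟩
  have h2 : ContDiff ℝ (0 + 1 + 1) (v t) := contDiff_succ_iff_hasFDerivAt.2 ⟨w t, h1, h.d2 t ht⟩
  have h3 : ContDiff ℝ (0 + 1 + 1 + 1) (u t) :=
    contDiff_succ_iff_hasFDerivAt.2 ⟨v t, h2, h.d1 t ht⟩
  exact h3.of_le (by norm_num)

section Strong

variable {T R : ℝ} {N : ℝ → Rd d × ℝ × (Rd d →L[ℝ] ℝ) → ℝ} {u₀ : Rd d → ℝ}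
  {u : ℝ → Rd d → ℝ} {v : ℝ → Rd d → Rd d →L[ℝ] ℝ} {w : ℝ → Rd d → Rd d →L[ℝ] Rd d →L[ℝ] ℝ}
  {z : ℝ → Rd d → Rd d →L[ℝ] Rd d →L[ℝ] Rd d →L[ℝ] ℝ}

lemma IsStrong.nonneg (h : IsStrong μ T R N u₀ u v w z) (hT : 0 < T) : 0 ≤ R :=
  (norm_nonneg _).trans (h.isC3.b0 (T / 2) ⟨by linarith, by linarith⟩ 0)

lemma IsStrong.continuous (h : IsStrong μ T R N u₀ u v w z) (hT : 0 < T) :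
    Continuous fun q : ℝ × Rd d => u q.1 q.2 := by
  have hR := h.nonneg hT
  refine (LipschitzWith.of_dist_le_mul (K := (R + R).toNNReal) fun p q => ?_).continuous
  rw [Real.coe_toNNReal _ (by positivity), Real.dist_eq, add_mul]
  refine (h.lip _ _ _ _).trans ?_
  rw [mul_add, Prod.dist_eq, Real.dist_eq, dist_eq_norm]
  gcongr
  · exact le_max_left _ _
  · exact le_max_right _ _

lemma IsStrong.abs_le_add (h : IsStrong μ T R N u₀ u v w z) (hT : 0 < T) {t : ℝ}
    (ht : t ∈ Icc 0 T) (x : Rd d) : |u t x| ≤ R + R * T := by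
  have hT2 : T / 2 ∈ Ioo 0 T := ⟨by linarith, by linarith⟩
  have hR := h.nonneg hT
  have h1 := h.lip t (T / 2) x x
  rw [sub_self, norm_zero, add_zero] at h1
  have h2 : |t - T / 2| ≤ T := by
    rw [abs_le]
    constructor <;> linarith [ht.1, ht.2]
  have h3 := h.isC3.b0 _ hT2 x
  rw [Real.norm_eq_abs] at h3
  have h4 := abs_sub_abs_le_abs_sub (u t x) (u (T / 2) x)
  have h5 : R * |t - T / 2| ≤ R * T := by gcongr
  linarith

lemma IsStrong.isC12 (h : IsStrong μ T R N u₀ u v w z) (hT : 0 < T) :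
    IsC12 T (R + R * T) u (fun t x => levyOp μ (u t) x + N t (x, u t x, v t x)) :=
  ⟨(h.continuous hT).continuousOn, fun _ ht x => h.abs_le_add hT (Ico_subset_Icc_self ht) x,
    fun _ ht => (h.isC3.contDiff ht).of_le (by norm_num), h.equation⟩

end Strong

end Comparison

section APriori

variable {d : ℕ} {μ : Measure (Rd d)} {T R L Cf Cu γ : ℝ} {f : ℝ → Rd d → ℝ} {u₀ : Rd d → ℝ}
  {ωf : ℝ → ℝ} {CH CH' : ℝ → ℝ} {H : Rd d → ℝ → Rd d → ℝ} {χ₁ : ℝ → ℝ} {χ₂ : Rd d → Rd d}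
  {u : ℝ → Rd d → ℝ} {v : ℝ → Rd d → Rd d →L[ℝ] ℝ} {w : ℝ → Rd d → Rd d →L[ℝ] Rd d →L[ℝ] ℝ}
  {z : ℝ → Rd d → Rd d →L[ℝ] Rd d →L[ℝ] Rd d →L[ℝ] ℝ}

/-- A priori bound for the solution of the truncated equation. It does not depend on the levels of
the truncation. -/
lemma IsStrong.abs_apply_le (hT : 0 < T) (hμ : Integrable levyWeight μ)
    (hu : IsStrong μ T R (truncatedSource f H χ₁ χ₂) u₀ u v w z) (hH : HamiltonianBounds H CH)
    (hHm : HamiltonianMonotone H γ) (hf : DataBounds T f u₀ L Cf Cu ωf)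
    (hχ₁ : ∀ u v, u ≤ v → χ₁ u ≤ χ₁ v ∧ χ₁ v - χ₁ u ≤ v - u) (hχ₁0 : χ₁ 0 = 0)
    (hχ₂ : ∀ p, ‖χ₂ p‖ ≤ ‖p‖) {t : ℝ} (ht : t ∈ Ioo 0 T) (x : Rd d) :
    |u t x| ≤ (|Cf| + |CH 2| + |Cu|) * Real.exp ((|γ| + 1) * T) := by
  set A := |Cf| + |CH 2| + |Cu| with hA
  have hA0 : 0 ≤ A := by positivity
  have h12 := hu.isC12 hT
  have hu0 : ∀ x, |u 0 x| ≤ A := fun x => by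
    have := hf.u₀_C3.2 0 (by norm_num) x
    rw [norm_iteratedFDeriv_zero, Real.norm_eq_abs] at this
    rw [hu.initial]
    have := le_abs_self Cu
    have := abs_nonneg Cf
    have := abs_nonneg (CH 2)
    linarith
  have hfb : ∀ t ∈ Ioo 0 T, ∀ x, |f t x| ≤ |Cf| := fun t ht x => by
    have := (hf.f_C2 t (Ioo_subset_Icc_self ht)).2 0 (by norm_num) x
    rw [norm_iteratedFDeriv_zero, Real.norm_eq_abs] at this
    exact this.trans (le_abs_self _)
  have hH0 : ∀ t ∈ Ioo 0 T, ∀ x, ‖v t x‖ ≤ 1 →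
      |H x 0 (χ₂ ((InnerProductSpace.toDual ℝ (Rd d)).symm (v t x)))| ≤ |CH 2| := by
    intro t ht x hv
    refine (hH.abs_apply_le (by simp) ?_ x).trans (le_abs_self _)
    refine (hχ₂ _).trans_lt ?_
    rw [LinearIsometryEquiv.norm_map]
    linarith
  have hexp : ∀ t ∈ Ioo 0 T, 1 ≤ Real.exp ((|γ| + 1) * t) := fun t ht =>
    Real.one_le_exp (mul_nonneg (by positivity) ht.1.le)
  have hexpT : A * Real.exp ((|γ| + 1) * t) ≤ A * Real.exp ((|γ| + 1) * T) := by
    gcongr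
    exact ht.2.le
  rw [abs_le']
  constructor
  · refine le_trans ?_ hexpT
    have := IsC12.comparison hμ h12 (IsC12.zero T) hA0 (by positivity : 0 ≤ |γ| + 1)
      (abs_nonneg γ) le_rfl (fun x => ?_) (fun s hs y hpos hle => ?_) ⟨ht.1.le, ht.2⟩ x
    · simpa using this
    · rw [sub_zero]
      exact (le_abs_self _).trans (hu0 x)
    · have e0 : levyOp μ (fun _ : Rd d => (0 : ℝ)) y = 0 := by
        rw [levyOp_eq (hasFDerivAt_const (0 : ℝ) y)]
        simp [levyIntegrand]
      have e1 : fderiv ℝ (u s) y = v s y := (hu.isC3.d1 s hs y).fderiv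
      simp only [sub_zero, fderiv_fun_const, Pi.zero_apply, e1] at hle hpos
      simp only [e0, sub_zero, zero_mul, add_zero, add_sub_cancel_left, truncatedSource]
      have hE := hexp s hs
      have hu1 : 0 < u s y := by
        have : 0 ≤ A * Real.exp ((|γ| + 1) * s) := by positivity
        linarith
      have h1 := hχ₁ 0 (u s y) hu1.le
      rw [hχ₁0] at h1
      have h2 := hHm y 0 (χ₁ (u s y)) h1.1
        (χ₂ ((InnerProductSpace.toDual ℝ (Rd d)).symm (v s y)))
      have h3 := (abs_le.1 (hH0 s hs y hle)).1
      have h4 := (abs_le.1 (hfb s hs y)).2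
      have h5 : -(|γ| * u s y) ≤ γ * (χ₁ (u s y) - 0) := by
        have := neg_abs_le γ
        nlinarith [abs_nonneg γ]
      have h6 := abs_nonneg Cu
      nlinarith
  · refine le_trans ?_ hexpT
    have := IsC12.comparison hμ h12.neg (IsC12.zero T) hA0 (by positivity : 0 ≤ |γ| + 1)
      (abs_nonneg γ) le_rfl (fun x => ?_) (fun s hs y hpos hle => ?_) ⟨ht.1.le, ht.2⟩ x
    · simpa using this
    · rw [sub_zero]
      exact (neg_le_abs _).trans (hu0 x)
    · have e0 : levyOp μ (fun _ : Rd d => (0 : ℝ)) y = 0 := by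
        rw [levyOp_eq (hasFDerivAt_const (0 : ℝ) y)]
        simp [levyIntegrand]
      have e1 : fderiv ℝ (fun x => -u s x) y = -v s y := (hu.isC3.d1 s hs y).neg.fderiv
      simp only [sub_zero, fderiv_fun_const, Pi.zero_apply, e1, norm_neg] at hle hpos
      simp only [e0, sub_zero, zero_mul, add_zero, truncatedSource,
        levyOp_neg (hu.isC3.d1 s hs y)]
      have hE := hexp s hs
      have hu1 : u s y < 0 := by
        have : 0 ≤ A * Real.exp ((|γ| + 1) * s) := by positivity
        linarith
      have h1 := hχ₁ (u s y) 0 hu1.le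
      rw [hχ₁0] at h1
      have h2 := hHm y (χ₁ (u s y)) 0 h1.1
        (χ₂ ((InnerProductSpace.toDual ℝ (Rd d)).symm (v s y)))
      have h3 := (abs_le.1 (hH0 s hs y hle)).2
      have h4 := (abs_le.1 (hfb s hs y)).1
      have h5 : |γ| * u s y ≤ γ * (0 - χ₁ (u s y)) := by
        have := neg_abs_le γ
        nlinarith [abs_nonneg γ]
      have h6 := abs_nonneg Cu
      nlinarith

/-- A priori Lipschitz bound for the solution of the truncated equation. It depends on the level of
the truncation in `u`, but not on the level of the truncation in the gradient. -/
lemma IsStrong.norm_grad_le (hT : 0 < T) (hμ : Integrable levyWeight μ)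
    (hu : IsStrong μ T R (truncatedSource f H χ₁ χ₂) u₀ u v w z)
    {N' : ℝ → Rd d × ℝ × (Rd d →L[ℝ] ℝ) → (Rd d × ℝ × (Rd d →L[ℝ] ℝ)) →L[ℝ] ℝ} {MN CN : ℝ}
    (hN : IsNonlinearity (truncatedSource f H χ₁ χ₂) N' T MN CN) (hCN : 0 ≤ CN)
    (hHl : HamiltonianLipschitz H CH')
    (hHm : HamiltonianMonotone H γ) (hf : DataBounds T f u₀ L Cf Cu ωf)
    (hχ₁ : ∀ u v, u ≤ v → χ₁ u ≤ χ₁ v ∧ χ₁ v - χ₁ u ≤ v - u) {R₁ : ℝ} (hR₁ : 0 < R₁)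
    (hχ₁R : ∀ u, |χ₁ u| ≤ R₁) (hχ₂ : ∀ p, ‖χ₂ p‖ ≤ ‖p‖) {t : ℝ} (ht : t ∈ Ioo 0 T) (x : Rd d) :
    ‖v t x‖ ≤ 2 * (|L| + 1) * Real.exp ((|γ| + 2 * |CH' R₁| + 1) * T) := by
  set B := |γ| + 2 * |CH' R₁| + 1 with hB
  have hB0 : 0 ≤ B := by positivity
  have h12 := hu.isC12 hT
  have hR : 0 ≤ R := (norm_nonneg _).trans (hu.isC3.b0 _ ht 0)
  let I := {t : ℝ // t ∈ Ioo 0 T} × Rd d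
  -- every bound for `exp (-B t) |Du|` improves itself
  have key : ∀ i : I, Real.exp (-(B * i.1)) * ‖v i.1 i.2‖ ≤ 2 * (|L| + 1) := by
    refine le_of_self_improving (f := fun i : I => Real.exp (-(B * i.1)) * ‖v i.1 i.2‖)
      ⟨R, ?_⟩ fun θ hθ i => ?_
    · rintro _ ⟨i, rfl⟩
      have h1 : Real.exp (-(B * i.1)) ≤ 1 := by
        rw [Real.exp_le_one_iff]
        have := mul_nonneg hB0 i.1.2.1.le
        linarith
      exact (mul_le_of_le_one_left (norm_nonneg _) h1).trans (hu.isC3.b1 _ i.1.2 _)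
    · have hθ' : ∀ s ∈ Ioo 0 T, ∀ y, ‖v s y‖ ≤ θ * Real.exp (B * s) := by
        intro s hs y
        have h1 := hθ (⟨⟨s, hs⟩, y⟩ : I)
        simp only [Real.exp_neg] at h1
        rw [inv_mul_le_iff₀ (Real.exp_pos _)] at h1
        linarith
      have hθ0 : 0 ≤ θ := le_trans (by positivity) (hθ i)
      set G := |L| + 1 + θ / 2 with hG
      have hG0 : 0 ≤ G := by positivity
      have hinc : ∀ s ∈ Ioo 0 T, ∀ y h, u s (y + h) - u s y
          ≤ ‖h‖ * G * Real.exp (B * s) := by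
        intro s hs y h
        refine IsC12.comparison hμ (h12.comp_add h) h12 (by positivity) hB0 (abs_nonneg γ)
          hCN (fun x => ?_) (fun s hs y hpos hle => ?_) ⟨hs.1.le, hs.2⟩ y
        · have h1 := hf.lip 0 ⟨le_rfl, hT.le⟩ (x + h) x
          rw [add_sub_cancel_left] at h1
          rw [hu.initial]
          have h2 := le_abs_self (u₀ (x + h) - u₀ x)
          have h3 := abs_nonneg (f 0 (x + h) - f 0 x)
          have h4 := le_abs_self L
          nlinarith [norm_nonneg h]
        · have e1 : fderiv ℝ (u s) y = v s y := (hu.isC3.d1 s hs y).fderiv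
          have e2 : fderiv ℝ (fun x => u s (x + h)) y = v s (y + h) :=
            ((hasFDerivAt_comp_add_right h).2 (hu.isC3.d1 s hs (y + h))).fderiv
          rw [e1, e2] at hle ⊢
          rw [levyOp_comp_add (hu.isC3.d1 s hs (y + h))]
          set E := Real.exp (B * s) with hE
          have hE1 : 1 ≤ E := Real.one_le_exp (mul_nonneg hB0 hs.1.le)
          have hE0 : 0 < E := Real.exp_pos _
          have hlt : u s y < u s (y + h) := by
            have : 0 ≤ ‖h‖ * G * E := by positivity
            linarith
          have hn := norm_nonneg h
          -- the third increment: change of the gradient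
          have i3 := (abs_le.1 (hN.lip hs (y, u s y, v s (y + h)) (y, u s y, v s y))).2
          have i3' : ‖((y, u s y, v s (y + h)) - (y, u s y, v s y) :
              Rd d × ℝ × (Rd d →L[ℝ] ℝ))‖ = ‖v s (y + h) - v s y‖ := by
            simp [Prod.norm_def]
          rw [i3'] at i3
          -- the second increment: change of the value
          have i2 := hHm y (χ₁ (u s y)) (χ₁ (u s (y + h))) (hχ₁ _ _ hlt.le).1
            (χ₂ ((InnerProductSpace.toDual ℝ (Rd d)).symm (v s (y + h))))
          have i2' : -(|γ| * (u s (y + h) - u s y)) ≤ γ * (χ₁ (u s (y + h)) - χ₁ (u s y)) := by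
            have g1 := hχ₁ _ _ hlt.le
            have := neg_abs_le γ
            nlinarith [abs_nonneg γ, g1.1, g1.2]
          -- the first increment: change of the position
          have i1 := (abs_le.1 (hHl R₁ hR₁ (y + h) y (χ₁ (u s (y + h)))
            (abs_le.1 (hχ₁R _)) (χ₂ ((InnerProductSpace.toDual ℝ (Rd d)).symm (v s (y + h)))))).1
          rw [add_sub_cancel_left] at i1
          have i1' : CH' R₁ * (‖χ₂ ((InnerProductSpace.toDual ℝ (Rd d)).symm (v s (y + h)))‖ + 1)
              * ‖h‖ ≤ |CH' R₁| * (θ * E + 1) * ‖h‖ := by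
            have g1 := (hχ₂ ((InnerProductSpace.toDual ℝ (Rd d)).symm (v s (y + h)))).trans
              ((LinearIsometryEquiv.norm_map _ _).le.trans (hθ' s hs (y + h)))
            gcongr
            exact le_abs_self _
          have iF := hf.lip s (Ioo_subset_Icc_self hs) (y + h) y
          rw [add_sub_cancel_left] at iF
          have iF1 := le_abs_self (f s (y + h) - f s y)
          have iF2 := abs_nonneg (u₀ (y + h) - u₀ y)
          have iF3 : L * ‖h‖ ≤ |L| * ‖h‖ := by
            gcongr
            exact le_abs_self _
          simp only [truncatedSource] at i3 ⊢
          -- the barrier absorbs all increments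
          have hbar : |L| + |CH' R₁| * (θ * E + 1) + |γ| * (G * E) ≤ G * B * E := by
            have g1 : |L| ≤ |L| * E := le_mul_of_one_le_right (abs_nonneg _) hE1
            have g2 : |CH' R₁| ≤ |CH' R₁| * E := le_mul_of_one_le_right (abs_nonneg _) hE1
            have g3 : 0 ≤ |CH' R₁| * |L| * E := by positivity
            have g4 : 0 ≤ θ * E := by positivity
            have g5 : 0 ≤ |CH' R₁| * E := by positivity
            have g6 : G * B * E = |γ| * (G * E) + (|L| * E + E + θ * E / 2)
                + 2 * (|CH' R₁| * |L| * E) + 2 * (|CH' R₁| * E) + |CH' R₁| * (θ * E) := by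
              rw [hB, hG]
              ring
            linarith
          have hbar' := mul_le_mul_of_nonneg_right hbar hn
          linarith
      have hv : ‖v i.1 i.2‖ ≤ G * Real.exp (B * i.1) := by
        refine norm_le_of_lipschitz (hu.isC3.d1 _ i.1.2 i.2) (by positivity) fun y y' => ?_
        have g1 := hinc i.1 i.1.2 y' (y - y')
        have g2 := hinc i.1 i.1.2 y (y' - y)
        rw [add_sub_cancel] at g1 g2
        rw [norm_sub_rev y' y] at g2
        rw [Real.norm_eq_abs, abs_le]
        constructor <;> linarith
      change Real.exp (-(B * i.1)) * ‖v i.1 i.2‖ ≤ |L| + 1 + θ / 2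
      rw [Real.exp_neg, inv_mul_le_iff₀ (Real.exp_pos _)]
      exact hv.trans_eq (mul_comm _ _)
  have h1 := key (⟨⟨t, ht⟩, x⟩ : I)
  simp only [Real.exp_neg] at h1
  rw [inv_mul_le_iff₀ (Real.exp_pos _)] at h1
  refine h1.trans ?_
  rw [mul_comm]
  gcongr
  exact ht.2.le

end APriori

/-! ### Removing the truncation -/

section Existence

variable {d : ℕ}

lemma DataBounds.norm_le {T L Cf Cu : ℝ} {f : ℝ → Rd d → ℝ} {u₀ : Rd d → ℝ} {ωf : ℝ → ℝ}
    (hf : DataBounds T f u₀ L Cf Cu ωf) : ContDiff ℝ 3 u₀ ∧ (∀ x, ‖u₀ x‖ ≤ |Cu|) ∧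
      (∀ x, ‖fderiv ℝ u₀ x‖ ≤ |Cu|) ∧ (∀ x, ‖fderiv ℝ (fderiv ℝ u₀) x‖ ≤ |Cu|) ∧
      ∀ x, ‖fderiv ℝ (fderiv ℝ (fderiv ℝ u₀)) x‖ ≤ |Cu| := by
  have h := fun k hk x => (hf.u₀_C3.2 k hk x).trans (le_abs_self Cu)
  refine ⟨hf.u₀_C3.1, fun x => ?_, fun x => ?_, fun x => ?_, fun x => ?_⟩
  · simpa using h 0 (by norm_num) x
  · simpa using h 1 (by norm_num) x
  · rw [norm_fderiv_fderiv_eq]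
    exact h 2 (by norm_num) x
  · rw [norm_fderiv_fderiv_fderiv_eq]
    exact h 3 le_rfl x

/-- Existence of a `C³` solution of the Hamilton–Jacobi equation. The nonlinearity is truncated at
levels that exceed the a priori bounds, so that the truncation is not felt by the solution. -/
theorem exists_isStrong_hamiltonian (d : ℕ) {T σ : ℝ} (hT : 0 < T) (hσ : 1 < σ) (Cμ : ℝ)
    (κ : ℕ → ℝ → ℝ) (CH CH' : ℝ → ℝ) (γ L Cf Cu : ℝ) :
    ∃ R : ℝ, ∀ (μ : Measure (Rd d)) (H : Rd d → ℝ → Rd d → ℝ) (f : ℝ → Rd d → ℝ)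
      (u₀ : Rd d → ℝ) (ωf : ℝ → ℝ), IsModulus ωf →
      LevyCondition μ Cμ → KernelBounds (heatKernel μ) σ T κ → HamiltonianBounds H CH →
      HamiltonianLipschitz H CH' → HamiltonianMonotone H γ → DataBounds T f u₀ L Cf Cu ωf →
      ∃ N u v w z, IsStrong μ T R N u₀ u v w z ∧ ∀ t ∈ Ioo 0 T, ∀ x,
        N t (x, u t x, v t x) = f t x - H x (u t x) (gradient (u t) x) := by
  set R₀ := (|Cf| + |CH 2| + |Cu|) * Real.exp ((|γ| + 1) * T) + 1 with hR₀
  have hR₀0 : 0 < R₀ := by positivity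
  set R₁ := 2 * (|L| + 1) * Real.exp ((|γ| + 2 * |CH' (R₀ + 1)| + 1) * T) with hR₁
  have hR₁0 : 0 < R₁ := by positivity
  obtain ⟨χ₁, χ₁', c₁, h₁, h₁id, h₁mono, h₁b⟩ := exists_truncation_real hR₀0
  obtain ⟨χ₂, χ₂', c₂, h₂, h₂id, h₂le, h₂b⟩ := exists_truncation_vector d hR₁0
  have hc₁ := h₁.nonneg
  have hc₂ := h₂.nonneg
  set Q := max (R₀ + 1) (R₁ + 2) with hQ
  obtain ⟨R, hR⟩ := exists_isStrong d (Cμ := Cμ) (κ := κ) (M := |Cf| + |CH Q|)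
    (C := |Cf| + |CH Q| * (1 + c₁ + c₂) * (2 + c₁ + c₂)) (C₀ := |Cu|) hT hσ (by positivity)
    (by positivity) (abs_nonneg _)
  refine ⟨R, fun μ H f u₀ ωf hω hμ hK hH hHl hHm hf => ?_⟩
  obtain ⟨N', hN⟩ := exists_isNonlinearity_truncatedSource (R := Q) h₁
    (fun u => (h₁b u).trans (le_max_left _ _)) h₂
    (fun p => ((h₂b p).trans_lt (by linarith)).trans_le (le_max_right _ _)) hH hf hω
  obtain ⟨hu₀, b0, b1, b2, b3⟩ := hf.norm_le
  obtain ⟨u, v, w, z, hu⟩ := hR μ hμ hK _ N' hN u₀ hu₀ b0 b1 b2 b3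
  refine ⟨_, u, v, w, z, hu, fun t ht x => ?_⟩
  have e1 : χ₁ (u t x) = u t x := h₁id _ <| by
    have := hu.abs_apply_le hT hμ.integrable hH hHm hf h₁mono (h₁id 0 (by simpa using hR₀0.le))
      h₂le ht x
    linarith
  have e2 : gradient (u t) x = (InnerProductSpace.toDual ℝ (Rd d)).symm (v t x) := by
    rw [gradient, (hu.isC3.d1 t ht x).fderiv]
  have e3 : χ₂ (gradient (u t) x) = gradient (u t) x := h₂id _ <| by
    rw [e2, LinearIsometryEquiv.norm_map]
    exact hu.norm_grad_le hT hμ.integrable hN (by positivity) hHl hHm hf h₁mono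
      (by linarith : 0 < R₀ + 1) h₁b h₂le ht x
  rw [truncatedSource, e1, ← e2, e3]

end Existence

section Uniqueness

variable {d : ℕ} {μ : Measure (Rd d)} {T γ : ℝ} {H : Rd d → ℝ → Rd d → ℝ} {f : ℝ → Rd d → ℝ}
  {u₀ : Rd d → ℝ} {u v : ℝ → Rd d → ℝ} {CH : ℝ → ℝ}

lemma IsClassicalSolution.isC12 (h : IsClassicalSolution μ T H f u₀ u) {M : ℝ}
    (hM : ∀ t ∈ Icc 0 T, ∀ x, |u t x| ≤ M) :
    IsC12 T M u (fun t x => deriv (fun s => u s x) t) :=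
  ⟨h.cont.mono (prod_mono Ico_subset_Icc_self le_rfl), fun t ht => hM t (Ico_subset_Icc_self ht),
    h.diff_space, fun t ht x => (h.diff_time t ht x).hasDerivAt⟩

/-- Two bounded classical solutions are ordered as soon as one of them is Lipschitz in space. -/
lemma IsClassicalSolution.le (hμ : Integrable levyWeight μ) (hH : HamiltonianBounds H CH)
    (hHm : HamiltonianMonotone H γ) (hu : IsClassicalSolution μ T H f u₀ u)
    (hv : IsClassicalSolution μ T H f u₀ v) {M R : ℝ} (hMu : ∀ t ∈ Icc 0 T, ∀ x, |u t x| ≤ M)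
    (hMv : ∀ t ∈ Icc 0 T, ∀ x, |v t x| ≤ M)
    (hR : (∀ t ∈ Ioo 0 T, ∀ x, ‖fderiv ℝ (u t) x‖ ≤ R) ∨
      ∀ t ∈ Ioo 0 T, ∀ x, ‖fderiv ℝ (v t) x‖ ≤ R) {t : ℝ} (ht : t ∈ Ico 0 T) (x : Rd d) :
    u t x ≤ v t x := by
  set Q := |M| + |R| + 2 with hQ
  have := IsC12.comparison hμ (hu.isC12 hMu) (hv.isC12 hMv) le_rfl le_rfl (abs_nonneg γ)
    (abs_nonneg (CH Q)) (fun x => by simp [hu.initial, hv.initial]) (fun s hs y hpos hle => ?_) ht x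
  · simpa using this
  · have hs' := Ioo_subset_Icc_self hs
    simp only [zero_mul, sub_zero] at hpos ⊢
    have hgrad : ‖fderiv ℝ (u s) y‖ < Q ∧ ‖fderiv ℝ (v s) y‖ < Q := by
      have h1 := norm_sub_norm_le (fderiv ℝ (u s) y) (fderiv ℝ (v s) y)
      have h2 := norm_sub_norm_le (fderiv ℝ (v s) y) (fderiv ℝ (u s) y)
      rw [norm_sub_rev] at h2
      have h3 := le_abs_self R
      have h4 := abs_nonneg M
      rcases hR with hR | hR <;> have h5 := hR s hs y <;> constructor <;> linarith
    have hp : ∀ g : Rd d → ℝ, ‖gradient g y‖ = ‖fderiv ℝ g y‖ := fun g => by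
      rw [gradient, LinearIsometryEquiv.norm_map]
    have hpq : ‖gradient (v s) y - gradient (u s) y‖
        = ‖fderiv ℝ (u s) y - fderiv ℝ (v s) y‖ := by
      rw [gradient, gradient, ← map_sub, LinearIsometryEquiv.norm_map, norm_sub_rev]
    have hvQ : |v s y| ≤ Q := (hMv s hs' y).trans (by
      have := le_abs_self M
      have := abs_nonneg R
      linarith)
    have i1 := hHm y (v s y) (u s y) (by linarith) (gradient (u s) y)
    have i2 := (le_abs_self _).trans (hH.lipschitz (x := y) hvQ ((hp _).trans_lt hgrad.2)
      ((hp _).trans_lt hgrad.1))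
    rw [hpq] at i2
    have i3 : CH Q * ‖fderiv ℝ (u s) y - fderiv ℝ (v s) y‖
        ≤ |CH Q| * ‖fderiv ℝ (u s) y - fderiv ℝ (v s) y‖ := by
      gcongr
      exact le_abs_self _
    have i4 : -(|γ| * (u s y - v s y)) ≤ γ * (u s y - v s y) := by
      have := neg_abs_le γ
      nlinarith
    have eu := hu.equation s hs y
    have ev := hv.equation s hs y
    linarith

/-- A bounded classical solution with bounded gradient is the only bounded classical solution. -/
lemma IsClassicalSolution.eq (hT : 0 < T) (hμ : Integrable levyWeight μ)
    (hH : HamiltonianBounds H CH) (hHm : HamiltonianMonotone H γ)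
    (hu : IsClassicalSolution μ T H f u₀ u) (hub : IsBoundedSolution T u)
    (hv : IsClassicalSolution μ T H f u₀ v) (hvb : IsBoundedSolution T v) {R : ℝ}
    (hR : ∀ t ∈ Ioo 0 T, ∀ x, ‖fderiv ℝ (u t) x‖ ≤ R) {t : ℝ} (ht : t ∈ Icc 0 T) (x : Rd d) :
    v t x = u t x := by
  obtain ⟨M₁, h₁⟩ := hub
  obtain ⟨M₂, h₂⟩ := hvb
  have h₁' : ∀ t ∈ Icc 0 T, ∀ x, |u t x| ≤ max M₁ M₂ := fun t ht x =>
    (h₁ t ht x).trans (le_max_left _ _)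
  have h₂' : ∀ t ∈ Icc 0 T, ∀ x, |v t x| ≤ max M₁ M₂ := fun t ht x =>
    (h₂ t ht x).trans (le_max_right _ _)
  have key : EqOn (fun t => v t x) (fun t => u t x) (Ico 0 T) := fun t ht =>
    le_antisymm (hv.le hμ hH hHm hu h₂' h₁' (Or.inr hR) ht x)
      (hu.le hμ hH hHm hv h₁' h₂' (Or.inl hR) ht x)
  have hc : ∀ {g : ℝ → Rd d → ℝ}, IsClassicalSolution μ T H f u₀ g →
      ContinuousOn (fun t => g t x) (Icc 0 T) := fun hg =>
    hg.cont.comp (f := fun t : ℝ => (t, x)) (by fun_prop) fun t ht => ⟨ht, mem_univ _⟩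
  refine key.of_subset_closure (hc hv) (hc hu) Ico_subset_Icc_self ?_ ht
  rw [closure_Ico hT.ne]

end Uniqueness

/-! ### Regularity of the solution and moduli of continuity -/

section IteratedDerivatives

variable {V E : Type*} [NormedAddCommGroup V] [NormedSpace ℝ V] [NormedAddCommGroup E]
  [NormedSpace ℝ E]

lemma exists_isometry_iteratedFDeriv_one (V E : Type*) [NormedAddCommGroup V] [NormedSpace ℝ V]
    [NormedAddCommGroup E] [NormedSpace ℝ E] :
    ∃ J : (V →L[ℝ] E) →ₗᵢ[ℝ] ContinuousMultilinearMap ℝ (fun _ : Fin 1 => V) E,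
      ∀ (f : V → E) x, iteratedFDeriv ℝ 1 f x = J (fderiv ℝ f x) :=
  ⟨(continuousMultilinearCurryRightEquiv' ℝ 0 V E).symm.toLinearIsometry.comp
    (continuousMultilinearCurryFin0 ℝ V (V →L[ℝ] E)).symm.toLinearIsometry, fun f x => by
      rw [iteratedFDeriv_succ_eq_comp_right]
      rfl⟩

lemma exists_isometry_iteratedFDeriv_two (V E : Type*) [NormedAddCommGroup V] [NormedSpace ℝ V]
    [NormedAddCommGroup E] [NormedSpace ℝ E] :
    ∃ J : (V →L[ℝ] V →L[ℝ] E) →ₗᵢ[ℝ] ContinuousMultilinearMap ℝ (fun _ : Fin 2 => V) E,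
      ∀ (f : V → E) x, iteratedFDeriv ℝ 2 f x = J (fderiv ℝ (fderiv ℝ f) x) := by
  obtain ⟨J, hJ⟩ := exists_isometry_iteratedFDeriv_one V (V →L[ℝ] E)
  refine ⟨(continuousMultilinearCurryRightEquiv' ℝ 1 V E).symm.toLinearIsometry.comp J,
    fun f x => ?_⟩
  rw [iteratedFDeriv_succ_eq_comp_right, Function.comp_apply, hJ]
  rfl

lemma exists_isometry_iteratedFDeriv_three (V E : Type*) [NormedAddCommGroup V] [NormedSpace ℝ V]
    [NormedAddCommGroup E] [NormedSpace ℝ E] :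
    ∃ J : (V →L[ℝ] V →L[ℝ] V →L[ℝ] E) →ₗᵢ[ℝ] ContinuousMultilinearMap ℝ (fun _ : Fin 3 => V) E,
      ∀ (f : V → E) x, iteratedFDeriv ℝ 3 f x = J (fderiv ℝ (fderiv ℝ (fderiv ℝ f)) x) := by
  obtain ⟨J, hJ⟩ := exists_isometry_iteratedFDeriv_two V (V →L[ℝ] E)
  refine ⟨(continuousMultilinearCurryRightEquiv' ℝ 2 V E).symm.toLinearIsometry.comp J,
    fun f x => ?_⟩
  rw [iteratedFDeriv_succ_eq_comp_right, Function.comp_apply, hJ]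
  rfl

end IteratedDerivatives

section Regularity

variable {d : ℕ} {μ : Measure (Rd d)} {T R : ℝ} {N : ℝ → Rd d × ℝ × (Rd d →L[ℝ] ℝ) → ℝ}
  {u₀ : Rd d → ℝ} {u : ℝ → Rd d → ℝ} {v : ℝ → Rd d → Rd d →L[ℝ] ℝ}
  {w : ℝ → Rd d → Rd d →L[ℝ] Rd d →L[ℝ] ℝ} {z : ℝ → Rd d → Rd d →L[ℝ] Rd d →L[ℝ] Rd d →L[ℝ] ℝ}

lemma IsC3.fderiv_eq (h : IsC3 T R u v w z) {t : ℝ} (ht : t ∈ Ioo 0 T) :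
    fderiv ℝ (u t) = v t := funext fun x => (h.d1 t ht x).fderiv

lemma IsC3.fderiv_fderiv_eq (h : IsC3 T R u v w z) {t : ℝ} (ht : t ∈ Ioo 0 T) :
    fderiv ℝ (fderiv ℝ (u t)) = w t := by
  rw [h.fderiv_eq ht]
  exact funext fun x => (h.d2 t ht x).fderiv

lemma IsC3.fderiv_fderiv_fderiv_eq (h : IsC3 T R u v w z) {t : ℝ} (ht : t ∈ Ioo 0 T) :
    fderiv ℝ (fderiv ℝ (fderiv ℝ (u t))) = z t := by
  rw [h.fderiv_fderiv_eq ht]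
  exact funext fun x => (h.d3 t ht x).fderiv

lemma IsC3.continuousOn_iteratedFDeriv (h : IsC3 T R u v w z) {k : ℕ} (hk : k ≤ 3) :
    ContinuousOn (fun q : ℝ × Rd d => iteratedFDeriv ℝ k (u q.1) q.2) (Ioo 0 T ×ˢ univ) := by
  obtain ⟨J₁, h₁⟩ := exists_isometry_iteratedFDeriv_one (Rd d) ℝ
  obtain ⟨J₂, h₂⟩ := exists_isometry_iteratedFDeriv_two (Rd d) ℝ
  obtain ⟨J₃, h₃⟩ := exists_isometry_iteratedFDeriv_three (Rd d) ℝ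
  interval_cases k
  · exact (continuousMultilinearCurryFin0 ℝ (Rd d) ℝ).symm.continuous.comp_continuousOn h.c0
  · refine (J₁.continuous.comp_continuousOn h.c1).congr fun q hq => ?_
    simp only [h₁, h.fderiv_eq hq.1, Function.comp_apply]
  · refine (J₂.continuous.comp_continuousOn h.c2).congr fun q hq => ?_
    simp only [h₂, h.fderiv_fderiv_eq hq.1, Function.comp_apply]
  · refine (J₃.continuous.comp_continuousOn h.c3).congr fun q hq => ?_
    simp only [h₃, h.fderiv_fderiv_fderiv_eq hq.1, Function.comp_apply]

lemma IsC3.norm_iteratedFDeriv_le (h : IsC3 T R u v w z) {k : ℕ} (hk : k ≤ 3) {t : ℝ}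
    (ht : t ∈ Ioo 0 T) (x : Rd d) : ‖iteratedFDeriv ℝ k (u t) x‖ ≤ R := by
  interval_cases k
  · rw [norm_iteratedFDeriv_zero]
    exact h.b0 t ht x
  · rw [norm_iteratedFDeriv_one, h.fderiv_eq ht]
    exact h.b1 t ht x
  · rw [← norm_fderiv_fderiv_eq, h.fderiv_fderiv_eq ht]
    exact h.b2 t ht x
  · rw [← norm_fderiv_fderiv_fderiv_eq, h.fderiv_fderiv_fderiv_eq ht]
    exact h.b3 t ht x

lemma IsC3.norm_hess_sub (h : IsC3 T R u v w z) {t s : ℝ} (ht : t ∈ Ioo 0 T) (hs : s ∈ Ioo 0 T)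
    (x y : Rd d) : ‖iteratedFDeriv ℝ 2 (u t) x - iteratedFDeriv ℝ 2 (u s) y‖ = ‖w t x - w s y‖ := by
  obtain ⟨J, hJ⟩ := exists_isometry_iteratedFDeriv_two (Rd d) ℝ
  rw [hJ, hJ, ← map_sub, J.norm_map, h.fderiv_fderiv_eq ht, h.fderiv_fderiv_eq hs]

lemma IsC3.gradient_eq (h : IsC3 T R u v w z) {t : ℝ} (ht : t ∈ Ioo 0 T) (x : Rd d) :
    gradient (u t) x = (InnerProductSpace.toDual ℝ (Rd d)).symm (v t x) := by
  rw [gradient, h.fderiv_eq ht]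

lemma IsC3.norm_gradient_sub (h : IsC3 T R u v w z) {t s : ℝ} (ht : t ∈ Ioo 0 T)
    (hs : s ∈ Ioo 0 T) (x y : Rd d) :
    ‖gradient (u t) x - gradient (u s) y‖ = ‖v t x - v s y‖ := by
  rw [h.gradient_eq ht, h.gradient_eq hs, ← map_sub, LinearIsometryEquiv.norm_map]

lemma IsC11.comp_add {φ : Rd d → ℝ} {φ' : Rd d → Rd d →L[ℝ] ℝ} {a b : ℝ} (h : IsC11 φ φ' a b)
    (e : Rd d) : IsC11 (fun x => φ (x + e)) (fun x => φ' (x + e)) a b :=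
  ⟨fun _ => (hasFDerivAt_comp_add_right e).2 (h.hasFDerivAt _), fun _ => h.bdd _,
    fun _ => h.bdd' _, fun x y => by simpa using h.lip (x + e) (y + e)⟩

/-- Modulus of continuity of the gradient: interpolation between the Lipschitz bound for `u` in
time and the bound for `D²u`. -/
def gradModulus (R δ : ℝ) : ℝ := R * δ + (2 + 2 * R) * √(R * δ)

/-- Modulus of continuity of the Hessian: interpolation between the modulus of the gradient and the
bound for `D³u`. -/
def hessModulus (R δ : ℝ) : ℝ := R * δ + (2 + 2 * R) * √((2 + 2 * R) * √(R * δ))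

lemma IsStrong.modulus_grad (hu : IsStrong μ T R N u₀ u v w z) (hR : 0 ≤ R) {t s : ℝ}
    (ht : t ∈ Ioo 0 T) (hs : s ∈ Ioo 0 T) :
    (∀ x, ‖v t x - v s x‖ ≤ (2 + 2 * R) * √(R * |t - s|)) ∧
      ∀ x y, ‖v t x - v s y‖ ≤ gradModulus R (|t - s| + ‖x - y‖) := by
  have h := hu.isC3
  have key : ∀ x, ‖v t x - v s x‖ ≤ (2 + 2 * R) * √(R * |t - s|) := fun x => by
    refine norm_fderiv_le_sqrt (g := fun x => u t x - u s x) (g' := fun x => v t x - v s x)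
      (fun x => (h.d1 t ht x).sub (h.d1 s hs x)) (fun x => ?_) (fun x y => ?_) (by positivity) x
    · simpa using hu.lip t s x x
    · rw [sub_sub_sub_comm, two_mul, add_mul]
      exact (norm_sub_le _ _).trans (add_le_add ((h.isC11 ht).lip x y) ((h.isC11 hs).lip x y))
  refine ⟨key, fun x y => ?_⟩
  refine (norm_sub_le_norm_sub_add_norm_sub _ (v t y) _).trans (add_le_add ?_ ?_)
  · refine ((h.isC11 ht).lip x y).trans ?_
    gcongr
    linarith [abs_nonneg (t - s)]
  · refine (key y).trans ?_
    gcongr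
    linarith [norm_nonneg (x - y)]

lemma IsStrong.modulus_hess (hu : IsStrong μ T R N u₀ u v w z) (hR : 0 ≤ R) {t s : ℝ}
    (ht : t ∈ Ioo 0 T) (hs : s ∈ Ioo 0 T) (x y : Rd d) :
    ‖w t x - w s y‖ ≤ hessModulus R (|t - s| + ‖x - y‖) := by
  have h := hu.isC3
  have hl : ∀ {r : ℝ}, r ∈ Ioo 0 T → ∀ x y, ‖w r x - w r y‖ ≤ R * ‖x - y‖ := fun hr x y =>
    convex_univ.norm_image_sub_le_of_norm_hasFDerivWithin_le
      (fun p _ => (h.d3 _ hr p).hasFDerivWithinAt) (fun p _ => h.b3 _ hr p) (mem_univ _)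
      (mem_univ _)
  have key : ∀ x, ‖w t x - w s x‖ ≤ (2 + 2 * R) * √((2 + 2 * R) * √(R * |t - s|)) := fun x => by
    refine norm_fderiv_le_sqrt (g := fun x => v t x - v s x) (g' := fun x => w t x - w s x)
      (fun x => (h.d2 t ht x).sub (h.d2 s hs x)) (hu.modulus_grad hR ht hs).1 (fun x y => ?_)
      (by positivity) x
    rw [sub_sub_sub_comm, two_mul, add_mul]
    exact (norm_sub_le _ _).trans (add_le_add (hl ht x y) (hl hs x y))
  refine (norm_sub_le_norm_sub_add_norm_sub _ (w t y) _).trans (add_le_add ?_ ?_)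
  · refine (hl ht x y).trans ?_
    gcongr
    linarith [abs_nonneg (t - s)]
  · refine (key y).trans ?_
    gcongr
    linarith [norm_nonneg (x - y)]

/-- Modulus of continuity of `Lu`. -/
def levyModulus (R C δ : ℝ) : ℝ := (2 * (R * δ) + (gradModulus R δ + hessModulus R δ)) * |C|

lemma IsStrong.modulus_levyOp (hu : IsStrong μ T R N u₀ u v w z) (hR : 0 ≤ R) {C : ℝ}
    (hμ : LevyCondition μ C) {t s : ℝ} (ht : t ∈ Ioo 0 T) (hs : s ∈ Ioo 0 T) (x y : Rd d) :
    |levyOp μ (u t) x - levyOp μ (u s) y| ≤ levyModulus R C (|t - s| + ‖x - y‖) := by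
  have h := hu.isC3
  -- `Lu(t, x) - Lu(s, y)` is the operator applied to the difference of `u s` and a translate
  -- of `u t`
  set e := x - y with he
  set δ := |t - s| + ‖e‖ with hδ
  have h1 : HasFDerivAt (fun p => u t (p + e)) (v t (y + e)) y :=
    (hasFDerivAt_comp_add_right e).2 (h.d1 t ht (y + e))
  have hnorm : ∀ p, ‖p + e - p‖ = ‖e‖ := fun p => by rw [add_sub_cancel_left]
  have hg0 : 0 ≤ gradModulus R δ := by rw [gradModulus]; positivity
  have hh0 : 0 ≤ hessModulus R δ := by rw [hessModulus]; positivity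
  have hdiff : IsC11 (fun p => u t (p + e) - u s p) (fun p => v t (p + e) - v s p) (R * δ)
      (gradModulus R δ + hessModulus R δ) := by
    have h2 : ∀ p, HasFDerivAt (fun p => v t (p + e) - v s p) (w t (p + e) - w s p) p := fun p =>
      ((hasFDerivAt_comp_add_right e).2 (h.d2 t ht (p + e))).sub (h.d2 s hs p)
    refine ⟨fun p => ((hasFDerivAt_comp_add_right e).2 (h.d1 t ht (p + e))).sub (h.d1 s hs p),
      fun p => ?_, fun p => ?_, fun p q => ?_⟩
    · simpa only [hnorm] using hu.lip t s (p + e) p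
    · have := (hu.modulus_grad hR ht hs).2 (p + e) p
      rw [hnorm] at this
      linarith
    · refine convex_univ.norm_image_sub_le_of_norm_hasFDerivWithin_le
        (fun p _ => (h2 p).hasFDerivWithinAt) (fun p _ => ?_) (mem_univ _) (mem_univ _)
      have := hu.modulus_hess hR ht hs (p + e) p
      rw [hnorm] at this
      linarith
  have hex : y + e = x := by rw [he, add_sub_cancel]
  have h3 : levyOp μ (fun p => u t (p + e)) y = levyOp μ (u t) x := by
    rw [levyOp_comp_add (h.d1 t ht (y + e)), hex]
  have h4 : Integrable (levyIntegrand (fun p => u t (p + e)) (v t (y + e)) y) μ :=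
    ((h.isC11 ht).comp_add e).integrable hμ.integrable y
  rw [← h3, ← levyOp_sub h1 (h.d1 s hs y) h4 ((h.isC11 hs).integrable hμ.integrable y)]
  exact hdiff.abs_levyOp_le hμ y

end Regularity

section Conclusion

variable {d : ℕ} {μ : Measure (Rd d)} {T R : ℝ} {N : ℝ → Rd d × ℝ × (Rd d →L[ℝ] ℝ) → ℝ}
  {u₀ : Rd d → ℝ} {u : ℝ → Rd d → ℝ} {v : ℝ → Rd d → Rd d →L[ℝ] ℝ}
  {w : ℝ → Rd d → Rd d →L[ℝ] Rd d →L[ℝ] ℝ} {z : ℝ → Rd d → Rd d →L[ℝ] Rd d →L[ℝ] Rd d →L[ℝ] ℝ}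
  {H : Rd d → ℝ → Rd d → ℝ} {f : ℝ → Rd d → ℝ} {CH ωf : ℝ → ℝ} {L Cf Cu Cμ : ℝ}

lemma IsStrong.hasDerivAt_hamiltonian (hu : IsStrong μ T R N u₀ u v w z)
    (hN : ∀ t ∈ Ioo 0 T, ∀ x, N t (x, u t x, v t x) = f t x - H x (u t x) (gradient (u t) x))
    {t : ℝ} (ht : t ∈ Ioo 0 T) (x : Rd d) :
    HasDerivAt (fun s => u s x) (levyOp μ (u t) x + (f t x - H x (u t x) (gradient (u t) x))) t := by
  rw [← hN t ht x]
  exact hu.equation t ht x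

lemma IsStrong.isClassicalSolution (hu : IsStrong μ T R N u₀ u v w z) (hT : 0 < T)
    (hμ : Integrable levyWeight μ)
    (hN : ∀ t ∈ Ioo 0 T, ∀ x, N t (x, u t x, v t x) = f t x - H x (u t x) (gradient (u t) x))
    (hH : HamiltonianBounds H CH) (hf : DataBounds T f u₀ L Cf Cu ωf) :
    IsClassicalSolution μ T H f u₀ u := by
  have h := hu.isC3
  have hd := fun {t : ℝ} (ht : t ∈ Ioo 0 T) x => hu.hasDerivAt_hamiltonian hN ht x
  have hgrad : ContinuousOn (fun q : ℝ × Rd d => gradient (u q.1) q.2) (Ioo 0 T ×ˢ univ) :=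
    ((InnerProductSpace.toDual ℝ (Rd d)).symm.continuous.comp_continuousOn h.c1).congr
      fun q hq => h.gradient_eq hq.1 q.2
  have hlevy := h.continuousOn_levyOp hμ
  refine ⟨(hu.continuous hT).continuousOn, fun t ht x => (hd ht x).differentiableAt,
    fun t ht => (h.contDiff ht).of_le (by norm_num), ?_, hgrad,
    h.continuousOn_iteratedFDeriv (by norm_num), hlevy, fun x => by rw [hu.initial],
    fun t ht x => ?_⟩
  · have h1 : ContinuousOn (fun q : ℝ × Rd d => H q.2 (u q.1 q.2) (gradient (u q.1) q.2))
        (Ioo 0 T ×ˢ univ) :=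
      hH.1.continuous.comp_continuousOn (continuousOn_snd.prodMk (h.c0.prodMk hgrad))
    have h2 := hf.cont_f.mono (prod_mono Ioo_subset_Icc_self (le_refl (univ : Set (Rd d))))
    exact (hlevy.add (h2.sub h1)).congr fun q hq => (hd hq.1 q.2).deriv
  · rw [(hd ht x).deriv]
    ring

lemma IsStrong.isBoundedSolution (hu : IsStrong μ T R N u₀ u v w z) (hT : 0 < T) :
    IsBoundedSolution T u :=
  ⟨R + R * T, fun _ ht x => hu.abs_le_add hT ht x⟩

lemma IsStrong.hasBoundedDerivatives (hu : IsStrong μ T R N u₀ u v w z) :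
    HasBoundedDerivatives T u := by
  have h := hu.isC3
  refine ⟨fun t ht => h.contDiff ht, fun k hk => h.continuousOn_iteratedFDeriv hk,
    ⟨R, fun k hk t ht x => h.norm_iteratedFDeriv_le hk ht x⟩, ⟨R, fun t ht x => ?_⟩⟩
  have hR : 0 ≤ R := (norm_nonneg _).trans (h.b0 t ht x)
  rw [← Real.norm_eq_abs]
  refine norm_deriv_le_of_lip' hR (Eventually.of_forall fun s => ?_)
  simpa using hu.lip s t x x

/-- The common modulus of continuity of `u`, `Du`, `D²u`, `∂ₜu` and `Lu`, where `R` bounds the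
derivatives of `u` and `C` bounds those of the Hamiltonian. -/
def solutionModulus (R Cμ C : ℝ) (ωf : ℝ → ℝ) (δ : ℝ) : ℝ :=
  R * δ + gradModulus R δ + hessModulus R δ
    + (levyModulus R Cμ δ + (ωf δ + C * (δ + R * δ + gradModulus R δ))) + levyModulus R Cμ δ

lemma isModulus_solutionModulus (hR : 0 ≤ R) {C : ℝ} (hC : 0 ≤ C) (hω : IsModulus ωf) :
    IsModulus (solutionModulus R Cμ C ωf) := by
  have hcg : Continuous (gradModulus R) := by unfold gradModulus; fun_prop
  have hch : Continuous (hessModulus R) := by unfold hessModulus; fun_prop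
  have hcl : Continuous (levyModulus R Cμ) := by unfold levyModulus; fun_prop
  have g0 : gradModulus R 0 = 0 := by simp [gradModulus]
  have h0 : hessModulus R 0 = 0 := by simp [hessModulus]
  have l0 : levyModulus R Cμ 0 = 0 := by simp [levyModulus, g0, h0]
  refine ⟨fun a ha b hb hab => ?_, by simp [solutionModulus, g0, h0, l0, hω.zero], ?_⟩
  · have hg : gradModulus R a ≤ gradModulus R b := by unfold gradModulus; gcongr
    have hh : hessModulus R a ≤ hessModulus R b := by unfold hessModulus; gcongr
    have hl : levyModulus R Cμ a ≤ levyModulus R Cμ b := by unfold levyModulus; gcongr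
    have hw := hω.mono ha hb hab
    unfold solutionModulus
    gcongr
  · have h1 : Continuous fun δ => R * δ + gradModulus R δ + hessModulus R δ
        + (levyModulus R Cμ δ + C * (δ + R * δ + gradModulus R δ)) + levyModulus R Cμ δ := by
      fun_prop
    have h2 := ((h1.tendsto 0).mono_left (nhdsWithin_le_nhds (s := Ici 0))).add hω.tendsto
    simp only [g0, h0, l0, mul_zero, add_zero] at h2
    refine h2.congr fun δ => ?_
    rw [solutionModulus]
    ring

lemma IsStrong.hasDerivativeModulus (hu : IsStrong μ T R N u₀ u v w z) (hR : 0 ≤ R)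
    (hμ : LevyCondition μ Cμ)
    (hN : ∀ t ∈ Ioo 0 T, ∀ x, N t (x, u t x, v t x) = f t x - H x (u t x) (gradient (u t) x))
    (hH : HamiltonianBounds H CH) (hf : DataBounds T f u₀ L Cf Cu ωf) :
    HasDerivativeModulus μ T u (solutionModulus R Cμ |CH (R + 1)| ωf) := by
  intro t ht s hs x y
  have h := hu.isC3
  set δ := |t - s| + ‖x - y‖ with hδ
  have b0 := hu.lip t s x y
  have b1 := (hu.modulus_grad hR ht hs).2 x y
  have b2 := hu.modulus_hess hR ht hs x y
  have b3 := hu.modulus_levyOp hR hμ ht hs x y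
  rw [h.norm_gradient_sub ht hs, h.norm_hess_sub ht hs,
    (hu.hasDerivAt_hamiltonian hN ht x).deriv, (hu.hasDerivAt_hamiltonian hN hs y).deriv]
  have b4 : |f t x - f s y| ≤ ωf δ :=
    hf.f_modulus s (Ioo_subset_Icc_self hs) t (Ioo_subset_Icc_self ht) x y
  have b5 : |H x (u t x) (gradient (u t) x) - H y (u s y) (gradient (u s) y)|
      ≤ |CH (R + 1)| * (δ + R * δ + gradModulus R δ) := by
    have hmem : ∀ {r : ℝ}, r ∈ Ioo 0 T → ∀ p, (p, u r p, gradient (u r) p) ∈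
        (univ : Set (Rd d)) ×ˢ (Icc (-(R + 1)) (R + 1) ×ˢ Metric.ball (0 : Rd d) (R + 1)) := by
      intro r hr p
      have h1 := h.b0 r hr p
      rw [Real.norm_eq_abs] at h1
      have h2 := h.b1 r hr p
      refine ⟨mem_univ _, abs_le.1 (by linarith), ?_⟩
      rw [mem_ball_zero_iff, h.gradient_eq hr, LinearIsometryEquiv.norm_map]
      linarith
    have h1 := (convex_slab (R + 1)).norm_image_sub_le_of_norm_hasFDerivWithin_le
      (C := |CH (R + 1)|) (f := fun q : Rd d × ℝ × Rd d => H q.1 q.2.1 q.2.2)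
      (fun q _ => (hH.1.differentiable (by norm_num) q).hasFDerivAt.hasFDerivWithinAt)
      (fun q hq => (hH.norm_fderiv_le (abs_le.2 hq.2.1) (by simpa using hq.2.2) q.1).trans
        (le_abs_self _)) (hmem hs y) (hmem ht x)
    rw [Real.norm_eq_abs] at h1
    refine h1.trans ?_
    have hg0 : 0 ≤ gradModulus R δ := (norm_nonneg _).trans b1
    have hu0 : 0 ≤ R * δ := (abs_nonneg _).trans b0
    have hδ0 : 0 ≤ δ := by positivity
    gcongr
    refine norm_prod_le_iff.2 ⟨?_, norm_prod_le_iff.2 ⟨?_, ?_⟩⟩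
    · change ‖x - y‖ ≤ _
      have := abs_nonneg (t - s)
      linarith
    · change |u t x - u s y| ≤ _
      linarith
    · change ‖gradient (u t) x - gradient (u s) y‖ ≤ _
      rw [h.norm_gradient_sub ht hs]
      linarith
  have b6 : |levyOp μ (u t) x + (f t x - H x (u t x) (gradient (u t) x))
      - (levyOp μ (u s) y + (f s y - H y (u s y) (gradient (u s) y)))|
      ≤ levyModulus R Cμ δ + (ωf δ + |CH (R + 1)| * (δ + R * δ + gradModulus R δ)) := by
    have c3 := abs_le.1 b3
    have c4 := abs_le.1 b4
    have c5 := abs_le.1 b5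
    rw [abs_le]
    constructor <;> linarith [c3.1, c3.2, c4.1, c4.2, c5.1, c5.2]
  rw [solutionModulus]
  linarith

end Conclusion

end FracHJB

end

theorem theorem5p5 (d : ℕ) (hd : 1 ≤ d) (T σ : ℝ) (hT : 0 < T) (hσ : σ ∈ Set.Ioo (1 : ℝ) 2)
    (Cμ c : ℝ) (κ : ℕ → ℝ → ℝ) (CH CH' : ℝ → ℝ) (γ L Cf Cu : ℝ)
    (ωf : ℝ → ℝ) (hωf : FracHJB.IsModulus ωf) :
    ∃ ω : ℝ → ℝ, FracHJB.IsModulus ω ∧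
      ∀ (μ : MeasureTheory.Measure (FracHJB.Rd d))
        (H : FracHJB.Rd d → ℝ → FracHJB.Rd d → ℝ)
        (f : ℝ → FracHJB.Rd d → ℝ) (u₀ : FracHJB.Rd d → ℝ),
        FracHJB.LevyCondition μ Cμ →
        FracHJB.Nondegenerate μ σ T c κ →
        FracHJB.HamiltonianBounds H CH →
        FracHJB.HamiltonianLipschitz H CH' →
        FracHJB.HamiltonianMonotone H γ →
        FracHJB.DataBounds T f u₀ L Cf Cu ωf →
        ∃ u : ℝ → FracHJB.Rd d → ℝ,
          FracHJB.IsClassicalSolution μ T H f u₀ u ∧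
          FracHJB.IsBoundedSolution T u ∧
          FracHJB.HasBoundedDerivatives T u ∧
          (∀ v : ℝ → FracHJB.Rd d → ℝ,
            FracHJB.IsClassicalSolution μ T H f u₀ v → FracHJB.IsBoundedSolution T v →
              ∀ t ∈ Set.Icc 0 T, ∀ x, v t x = u t x) ∧
          FracHJB.HasDerivativeModulus μ T u ω := by
  obtain ⟨R, hR⟩ := FracHJB.exists_isStrong_hamiltonian d hT hσ.1 Cμ κ CH CH' γ L Cf Cu
  refine ⟨FracHJB.solutionModulus |R| Cμ |CH (|R| + 1)| ωf,
    FracHJB.isModulus_solutionModulus (abs_nonneg R) (abs_nonneg _) hωf,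
    fun μ H f u₀ hμ hK hH hHl hHm hf => ?_⟩
  obtain ⟨N, u, v, w, z, hu, hN⟩ := hR μ H f u₀ ωf hωf hμ hK.kernel hH hHl hHm hf
  have hR0 := hu.nonneg hT
  have hcl := hu.isClassicalSolution hT hμ.integrable hN hH hf
  have hb := hu.isBoundedSolution hT
  refine ⟨u, hcl, hb, hu.hasBoundedDerivatives, fun v' hv' hvb t ht x => ?_, ?_⟩
  · exact hcl.eq hT hμ.integrable hH hHm hb hv' hvb (R := R)
      (fun t ht x => by rw [hu.isC3.fderiv_eq ht]; exact hu.isC3.b1 t ht x) ht x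
  · rw [abs_of_nonneg hR0]
    exact hu.hasDerivativeModulus hR0 hμ hN hH hf
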